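/- Let $R$ be a commutative artinian ring and let $\Lambda$ be an artin $R$-algebra, i.e. an $R$-algebra that is finitely generated as an $R$-module. Let $D(\Lambda)=\operatorname{Hom}_R(\Lambda,E)$ be the Matlis dual of $\Lambda$, where $E$ is the injective envelope of $R/J(R)$ and $J(R)$ is the Jacobson radical of $R$; it is a $\Lambda$-$\Lambda$-bimodule via $(af)(x)=f(xa)$ and $(fa)(x)=f(ax)$. Write $\operatorname{mod}\Lambda$ and $\operatorname{mod}\Lambda^{op}$ for the finitely generated left and right $\Lambda$-modules. Infima below are taken in $\mathbb{N}\cup\{\infty\}$, with $\inf\emptyset=\infty$. For a ring $A$ ($A=\Lambda$ or $A=\Lambda^{op}$), let $0\to A\to I^0(A)\to I^1(A)\to\cdots$ be the minimal injective resolution of the left $A$-module $A$. For $n\ge 1$, $A$ is called Auslander $n$-Gorenstein if the flat dimension of $I^i(A)$ over $A$ is at most $i$ for all $0\le i\le n-1$. For an $A$-module $M$ put $\operatorname{grade}_AM=\inf\{i\ge 0\mid \operatorname{Ext}^i_A(M,A)\ne 0\}$, and say that $\operatorname{s.grade}_AM\ge m$ if $\operatorname{grade}_AX\ge m$ for every submodule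 $X$ of $M$. For a left $\Lambda$-module $M$ put $\operatorname{E\text{-}cograde}M=\inf\{i\ge0\mid\operatorname{Ext}^i_\Lambda(D(\Lambda),M)\ne0\}$, and say that $\operatorname{s.E\text{-}cograde}M\ge m$ if $\operatorname{E\text{-}cograde}X\ge m$ for every quotient module $X$ of $M$. Put $\operatorname{T\text{-}cograde}M=\inf\{i\ge0\mid\operatorname{Tor}_i^\Lambda(D(\Lambda),M)\ne0\}$, and say that $\operatorname{s.T\text{-}cograde}M\ge m$ if $\operatorname{T\text{-}cograde}Y\ge m$ for every submodule $Y$ of $M$. Then for every $n\ge 1$ the following statements are equivalent. - $(1)$ $\Lambda$ is Auslander $n$-Gorenstein. - $(1)^{op}$ $\Lambda^{op}$ is Auslander $n$-Gorenstein. - $(2)$ $\operatorname{s.grade}_{\Lambda^{op}}\operatorname{Ext}^i_\Lambda(M,\Lambda)\ge i$ for all $M\in\operatorname{mod}\Lambda$ and $1\le i\le n$, where $\operatorname{Ext}^i_\Lambda(M,\Lambda)$ is the right $\Lambda$-module with action induced by right multiplication on $\Lambda$. - $(2)^{op}$ $\operatorname{s.grade}_{\Lambda}\operatorname{Ext}^i_{\Lambda^{op}}(N,\Lambda)\ge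 i$ for all $N\in\operatorname{mod}\Lambda^{op}$ and $1\le i\le n$, where $\operatorname{Ext}^i_{\Lambda^{op}}(N,\Lambda)$ is the left $\Lambda$-module with action induced by left multiplication on $\Lambda$. - $(3)$ $\operatorname{s.E\text{-}cograde}\operatorname{Tor}_i^\Lambda(D(\Lambda),M)\ge i$ for all $M\in\operatorname{mod}\Lambda$ and $1\le i\le n$, where $\operatorname{Tor}_i^\Lambda(D(\Lambda),M)$ is a left $\Lambda$-module through the left action on $D(\Lambda)$. - $(4)$ $\operatorname{s.T\text{-}cograde}\operatorname{Ext}^i_\Lambda(D(\Lambda),M)\ge i$ for all $M\in\operatorname{mod}\Lambda$ and $1\le i\le n$, where $\operatorname{Ext}^i_\Lambda(D(\Lambda),M)$ is a left $\Lambda$-module through the right action on $D(\Lambda)$. -/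

import Mathlib

open CategoryTheory MulOpposite
open scoped TensorProduct

universe v u

noncomputable section

/-! ### Injective envelopes and minimal injective resolutions -/

/-- `i : M → E` is an injective envelope: `E` is injective, `i` is injective, and every nonzero
submodule of `E` meets the image of `i` nontrivially. -/
structure IsInjectiveEnvelope {A : Type u} [Ring A] {M E : Type u} [AddCommGroup M] [Module A M]
    [AddCommGroup E] [Module A E] (i : M →ₗ[A] E) : Prop where
  injective_module : Module.Injective A E
  injective_map : Function.Injective i
  essential : ∀ N : Submodule A E, N ⊓ LinearMap.range i = ⊥ → N = ⊥

theorem exists_injectiveEnvelope (A : Type u) [Ring A] (M : ModuleCat.{u} A) :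
    ∃ (E : ModuleCat.{u} A) (i : M →ₗ[A] E), IsInjectiveEnvelope i := by
  obtain ⟨⟨J, hinj, f, hf⟩⟩ := EnoughInjectives.presentation M
  have hJ : Module.Injective A J := Module.injective_module_of_injective_object A J
  have hι : Function.Injective f.hom := (ModuleCat.mono_iff_injective f).1 hf
  generalize f.hom = ι at hι
  set L : Submodule A J := LinearMap.range ι with hL
  let s : Set (Submodule A J) := {E | L ≤ E ∧ ∀ N ≤ E, N ⊓ L = ⊥ → N = ⊥}
  have hLs : L ∈ s := ⟨le_rfl, fun N hN h => by rwa [inf_eq_left.2 hN] at h⟩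
  obtain ⟨E, hLE, hEmax⟩ := zorn_le_nonempty₀ s (by
    intro c hc hchain y hy
    refine ⟨sSup c, ⟨(hc hy).1.trans (le_sSup hy), ?_⟩, fun z hz => le_sSup hz⟩
    intro N hN hNL
    rw [Submodule.eq_bot_iff]
    intro x hx
    obtain ⟨F, hF, hxF⟩ := (Submodule.mem_sSup_of_directed ⟨y, hy⟩ hchain.directedOn).1 (hN hx)
    have h1 := (hc hF).2 (Submodule.span A {x})
      ((Submodule.span_singleton_le_iff_mem _ _).2 hxF) (by
        rw [eq_bot_iff, ← hNL]
        exact inf_le_inf_right _ ((Submodule.span_singleton_le_iff_mem _ _).2 hx))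
    exact Submodule.span_singleton_eq_bot.1 h1) L hLs
  have hEs : E ∈ s := hEmax.1
  let t : Set (Submodule A J) := {C | C ⊓ E = ⊥}
  obtain ⟨C, -, hCmax⟩ := zorn_le_nonempty₀ t (by
    intro c hc hchain y hy
    refine ⟨sSup c, ?_, fun z hz => le_sSup hz⟩
    change sSup c ⊓ E = ⊥
    rw [Submodule.eq_bot_iff]
    rintro x ⟨hx, hxE⟩
    obtain ⟨F, hF, hxF⟩ := (Submodule.mem_sSup_of_directed ⟨y, hy⟩ hchain.directedOn).1 hx
    exact (Submodule.eq_bot_iff _).1 (hc hF) x ⟨hxF, hxE⟩) ⊥ (bot_inf_eq _)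
  have hC : C ⊓ E = ⊥ := hCmax.1
  have hCmem : ∀ K : Submodule A J, C ≤ K → K ⊓ E = ⊥ → K ≤ C := fun K h h' => hCmax.2 h' h
  have hφ : Function.Injective (C.mkQ ∘ₗ E.subtype) := by
    rw [← LinearMap.ker_eq_bot, Submodule.eq_bot_iff]
    rintro ⟨x, hx⟩ h
    have hxC : x ∈ C := by simpa using h
    exact Subtype.ext ((Submodule.eq_bot_iff _).1 hC x ⟨hxC, hx⟩)
  obtain ⟨g, hg⟩ := hJ.out (C.mkQ ∘ₗ E.subtype) hφ E.subtype
  have hgE : ∀ x ∈ E, g (C.mkQ x) = x := fun x hx => hg ⟨x, hx⟩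
  have hrange : LinearMap.range g ∈ s := by
    refine ⟨fun x hx => ⟨C.mkQ x, hgE x (hEs.1 hx)⟩, ?_⟩
    intro N hN hNL
    have hNE : N ⊓ E = ⊥ := hEs.2 _ inf_le_right (by
      rw [eq_bot_iff, ← hNL]; exact inf_le_inf_right _ inf_le_left)
    have hK := hCmem (N.comap (g ∘ₗ C.mkQ))
      (fun x hx => by
        have : C.mkQ x = 0 := by simpa using hx
        simp only [Submodule.mem_comap, LinearMap.comp_apply, this, map_zero, zero_mem])
      (by
        rw [Submodule.eq_bot_iff]
        rintro x ⟨hx, hxE⟩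
        have hxN : g (C.mkQ x) ∈ N := hx
        rw [hgE x hxE] at hxN
        exact (Submodule.eq_bot_iff _).1 hNE x ⟨hxN, hxE⟩)
    rw [Submodule.eq_bot_iff]
    intro y hy
    obtain ⟨q, rfl⟩ := hN hy
    obtain ⟨x, rfl⟩ := C.mkQ_surjective q
    have : C.mkQ x = 0 := by simpa using hK (show x ∈ N.comap (g ∘ₗ C.mkQ) from hy)
    rw [this, map_zero]
  have hle : LinearMap.range g ≤ E :=
    hEmax.2 hrange (fun x hx => ⟨C.mkQ x, hgE x hx⟩)
  let r : J →ₗ[A] E := LinearMap.codRestrict E (g ∘ₗ C.mkQ) (fun x => hle ⟨_, rfl⟩)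
  refine ⟨ModuleCat.of A E, LinearMap.codRestrict E ι (fun m => hEs.1 ⟨m, rfl⟩), ?_, ?_, ?_⟩
  · refine ⟨fun X Y _ _ _ _ f hf k => ?_⟩
    obtain ⟨h, hh⟩ := hJ.out f hf (E.subtype ∘ₗ k)
    refine ⟨r ∘ₗ h, fun x => Subtype.ext ?_⟩
    change g (C.mkQ (h (f x))) = k x
    rw [hh x]
    exact hgE _ (k x).2
  · exact fun a b hab => hι (congrArg Subtype.val hab)
  · intro N hN
    have := hEs.2 (N.map E.subtype) (Submodule.map_subtype_le _ _) (by
      rw [Submodule.eq_bot_iff]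
      rintro _ ⟨⟨x, hx, rfl⟩, ⟨m, hm⟩⟩
      have h0 := (Submodule.eq_bot_iff _).1 hN x ⟨hx, ⟨m, Subtype.ext hm⟩⟩
      rw [h0]; rfl)
    rw [Submodule.eq_bot_iff] at this ⊢
    exact fun x hx => Subtype.ext (this x ⟨x, hx, rfl⟩)

/-- The injective envelope `E⁰(M)` of a module. -/
def injectiveEnvelope {A : Type u} [Ring A] (M : ModuleCat.{u} A) : ModuleCat.{u} A :=
  (exists_injectiveEnvelope A M).choose

/-- The embedding of `M` into its injective envelope. -/
def injectiveEnvelopeMap {A : Type u} [Ring A] (M : ModuleCat.{u} A) :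
    M →ₗ[A] injectiveEnvelope M :=
  (exists_injectiveEnvelope A M).choose_spec.choose

theorem injectiveEnvelopeMap_spec {A : Type u} [Ring A] (M : ModuleCat.{u} A) :
    IsInjectiveEnvelope (injectiveEnvelopeMap M) :=
  (exists_injectiveEnvelope A M).choose_spec.choose_spec

/-- The `k`-th cosyzygy `coΩᵏ(M)`. -/
def cosyzygy {A : Type u} [Ring A] (M : ModuleCat.{u} A) : ℕ → ModuleCat.{u} A
  | 0 => M
  | k + 1 => ModuleCat.of A
      (injectiveEnvelope (cosyzygy M k) ⧸ LinearMap.range (injectiveEnvelopeMap (cosyzygy M k)))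

/-- The `k`-th term `Iᵏ(M)` of the minimal injective resolution
`0 → M → I⁰(M) → I¹(M) → ⋯`, where `Iᵏ(M)` is the injective envelope of `coΩᵏ(M)`. -/
def minimalInjectiveTerm {A : Type u} [Ring A] (M : ModuleCat.{u} A) (k : ℕ) : ModuleCat.{u} A :=
  injectiveEnvelope (cosyzygy M k)

/-! ### Tensor products over a noncommutative ring -/

section Tensor

section Group

variable (A : Type u) [Ring A] (X : Type u) [AddCommGroup X] [Module Aᵐᵒᵖ X]
  (Y : Type u) [AddCommGroup Y] [Module A Y]

/-- The subgroup of `X ⊗_ℤ Y` generated by the elements `x a ⊗ y - x ⊗ a y`. -/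
def balancedRelations : AddSubgroup (X ⊗[ℤ] Y) :=
  AddSubgroup.closure
    {z | ∃ (x : X) (a : A) (y : Y), z = (op a • x) ⊗ₜ[ℤ] y - x ⊗ₜ[ℤ] (a • y)}

/-- The tensor product `X ⊗_A Y` of a right `A`-module `X` and a left `A`-module `Y`. -/
def BalancedTensor : Type u := (X ⊗[ℤ] Y) ⧸ balancedRelations A X Y

end Group

namespace BalancedTensor

instance (A : Type u) [Ring A] (X : Type u) [AddCommGroup X] [Module Aᵐᵒᵖ X]
    (Y : Type u) [AddCommGroup Y] [Module A Y] : AddCommGroup (BalancedTensor A X Y) :=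
  inferInstanceAs (AddCommGroup ((X ⊗[ℤ] Y) ⧸ balancedRelations A X Y))

section

variable {A : Type u} [Ring A] {X : Type u} [AddCommGroup X] [Module Aᵐᵒᵖ X]
  {Y : Type u} [AddCommGroup Y] [Module A Y]

variable (A) in
/-- The element `x ⊗ y` of `X ⊗_A Y`. -/
def tmul (x : X) (y : Y) : BalancedTensor A X Y :=
  QuotientAddGroup.mk' (balancedRelations A X Y) (x ⊗ₜ[ℤ] y)

theorem tmul_add (x : X) (y y' : Y) : tmul A x (y + y') = tmul A x y + tmul A x y' :=
  (congrArg (QuotientAddGroup.mk' (balancedRelations A X Y)) (TensorProduct.tmul_add x y y')).trans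
    (map_add _ _ _)

theorem add_tmul (x x' : X) (y : Y) : tmul A (x + x') y = tmul A x y + tmul A x' y :=
  (congrArg (QuotientAddGroup.mk' (balancedRelations A X Y)) (TensorProduct.add_tmul x x' y)).trans
    (map_add _ _ _)

theorem op_smul_tmul (a : A) (x : X) (y : Y) : tmul A (op a • x) y = tmul A x (a • y) := by
  refine (QuotientAddGroup.eq_iff_sub_mem (N := balancedRelations A X Y)).2 ?_
  exact AddSubgroup.subset_closure ⟨x, a, y, rfl⟩

theorem tmul_induction {p : BalancedTensor A X Y → Prop} (z : BalancedTensor A X Y)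
    (zero : p 0) (tmul : ∀ x y, p (tmul A x y)) (add : ∀ z w, p z → p w → p (z + w)) : p z := by
  obtain ⟨t, rfl⟩ := QuotientAddGroup.mk'_surjective (balancedRelations A X Y) z
  induction t with
  | zero => exact zero
  | tmul x y => exact tmul x y
  | add a b ha hb => rw [map_add]; exact add _ _ ha hb

theorem addHom_ext {W : Type*} [AddCommGroup W] {f g : BalancedTensor A X Y →+ W}
    (h : ∀ x y, f (tmul A x y) = g (tmul A x y)) : f = g := by
  ext z
  induction z using tmul_induction with
  | zero => rw [map_zero, map_zero]
  | tmul x y => exact h x y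
  | add z w hz hw => rw [map_add, map_add, hz, hw]

/-- The universal property of `X ⊗_A Y`: balanced biadditive maps factor through it. -/
def lift {W : Type*} [AddCommGroup W] (φ : X →+ Y →+ W)
    (h : ∀ (a : A) (x : X) (y : Y), φ (op a • x) y = φ x (a • y)) : BalancedTensor A X Y →+ W :=
  QuotientAddGroup.lift (balancedRelations A X Y)
    (TensorProduct.liftAddHom φ fun r x y => by
      rw [map_zsmul, map_zsmul, AddMonoidHom.zsmul_apply])
    (by
      rw [balancedRelations, AddSubgroup.closure_le]
      rintro _ ⟨x, a, y, rfl⟩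
      change TensorProduct.liftAddHom φ _ ((op a • x) ⊗ₜ[ℤ] y - x ⊗ₜ[ℤ] (a • y)) = 0
      rw [map_sub, TensorProduct.liftAddHom_tmul, TensorProduct.liftAddHom_tmul, h, sub_self])

@[simp]
theorem lift_tmul {W : Type*} [AddCommGroup W] (φ : X →+ Y →+ W)
    (h : ∀ (a : A) (x : X) (y : Y), φ (op a • x) y = φ x (a • y)) (x : X) (y : Y) :
    lift φ h (tmul A x y) = φ x y := rfl

/-- The map `f ⊗ g : X ⊗_A Y → X' ⊗_A Y'`, for a map `f` of right and a map `g` of left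
`A`-modules. -/
def map {X' Y' : Type u} [AddCommGroup X'] [Module Aᵐᵒᵖ X'] [AddCommGroup Y'] [Module A Y']
    (f : X →ₗ[Aᵐᵒᵖ] X') (g : Y →ₗ[A] Y') : BalancedTensor A X Y →+ BalancedTensor A X' Y' :=
  lift (AddMonoidHom.mk' (fun x => AddMonoidHom.mk' (fun y => tmul A (f x) (g y))
      fun y y' => by rw [map_add, tmul_add])
      fun x x' => by ext y; simp [add_tmul])
    fun a x y => by
      change tmul A (f (op a • x)) (g y) = tmul A (f x) (g (a • y))
      rw [map_smul, map_smul, op_smul_tmul]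

@[simp]
theorem map_tmul {X' Y' : Type u} [AddCommGroup X'] [Module Aᵐᵒᵖ X'] [AddCommGroup Y']
    [Module A Y'] (f : X →ₗ[Aᵐᵒᵖ] X') (g : Y →ₗ[A] Y') (x : X) (y : Y) :
    map f g (tmul A x y) = tmul A (f x) (g y) := rfl

end

section Bimodule

variable {S : Type v} {A : Type u} [Ring S] [Ring A] {X : Type u} [AddCommGroup X] [Module S X]
  [Module Aᵐᵒᵖ X] [SMulCommClass S Aᵐᵒᵖ X] {Y : Type u} [AddCommGroup Y] [Module A Y]

/-- The action of `s : S` on an `S`-`A`-bimodule `X`, as a map of right `A`-modules. -/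
def leftMul (X : Type u) [AddCommGroup X] [Module S X] [Module Aᵐᵒᵖ X] [SMulCommClass S Aᵐᵒᵖ X]
    (s : S) : X →ₗ[Aᵐᵒᵖ] X where
  toFun x := s • x
  map_add' := smul_add s
  map_smul' a x := smul_comm s a x

/-- If `X` is an `S`-`A`-bimodule, then `X ⊗_A Y` is a left `S`-module with
`s (x ⊗ y) = (s x) ⊗ y`. -/
instance : Module S (BalancedTensor A X Y) where
  smul s z := map (leftMul X s) LinearMap.id z
  one_smul z := by
    change map (leftMul X (1 : S)) LinearMap.id z = AddMonoidHom.id _ z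
    exact DFunLike.congr_fun (addHom_ext fun x y => congrArg (tmul A · y) (one_smul S x)) z
  mul_smul s t z := by
    change map (leftMul X (s * t)) LinearMap.id z =
      ((map (leftMul X s) LinearMap.id).comp (map (leftMul X t) LinearMap.id)) z
    exact DFunLike.congr_fun (addHom_ext fun x y => congrArg (tmul A · y) (mul_smul s t x)) z
  smul_zero s := map_zero _
  smul_add s := map_add _
  add_smul s t z := by
    change map (leftMul X (s + t)) LinearMap.id z =
      (map (leftMul X s) LinearMap.id + map (leftMul X t) LinearMap.id :
        BalancedTensor A X Y →+ BalancedTensor A X Y) z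
    exact DFunLike.congr_fun (addHom_ext fun x y =>
      (congrArg (tmul A · y) (add_smul s t x)).trans (add_tmul _ _ y)) z
  zero_smul z := by
    change map (leftMul X (0 : S)) LinearMap.id z = (0 : _ →+ BalancedTensor A X Y) z
    refine DFunLike.congr_fun (addHom_ext fun x y => ?_) z
    change tmul A ((0 : S) • x) y = 0
    have h := add_tmul (A := A) (0 : X) 0 y
    rw [add_zero] at h
    rw [zero_smul]
    exact left_eq_add.1 h

theorem smul_tmul (s : S) (x : X) (y : Y) : s • tmul A x y = tmul A (s • x) y := rfl

variable (S X) in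
/-- The `S`-linear map `X ⊗_A g : X ⊗_A Y → X ⊗_A Z`, for an `S`-`A`-bimodule `X` and an
`A`-linear map `g : Y → Z`. -/
def mapRight {Z : Type u} [AddCommGroup Z] [Module A Z] (g : Y →ₗ[A] Z) :
    BalancedTensor A X Y →ₗ[S] BalancedTensor A X Z where
  toFun := map LinearMap.id g
  map_add' := map_add _
  map_smul' s z := by
    change ((map LinearMap.id g).comp (map (leftMul X s) LinearMap.id)) z =
      ((map (leftMul X s) LinearMap.id).comp (map LinearMap.id g)) z
    exact DFunLike.congr_fun (addHom_ext
      (f := (map LinearMap.id g).comp (map (leftMul X s) LinearMap.id))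
      (g := (map (leftMul X s) LinearMap.id).comp (map LinearMap.id g)) fun x y => rfl) z

end Bimodule

end BalancedTensor

variable (S : Type v) (A : Type u) [Ring S] [Ring A] (X : Type u) [AddCommGroup X] [Module S X]
  [Module Aᵐᵒᵖ X] [SMulCommClass S Aᵐᵒᵖ X]

/-- The functor `X ⊗_A -` from left `A`-modules to left `S`-modules, for an `S`-`A`-bimodule
`X`. -/
def tensorFunctor : ModuleCat.{u} A ⥤ ModuleCat.{u} S where
  obj Y := ModuleCat.of S (BalancedTensor A X Y)
  map f := ModuleCat.ofHom (BalancedTensor.mapRight S X f.hom)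
  map_id Y := by
    ext z
    exact DFunLike.congr_fun (BalancedTensor.addHom_ext
      (f := BalancedTensor.map LinearMap.id LinearMap.id) (g := AddMonoidHom.id _)
      fun x y => rfl) z
  map_comp f g := by
    ext z
    exact DFunLike.congr_fun (BalancedTensor.addHom_ext
      (f := BalancedTensor.map LinearMap.id (g.hom ∘ₗ f.hom))
      (g := (BalancedTensor.map LinearMap.id g.hom).comp (BalancedTensor.map LinearMap.id f.hom))
      fun x y => rfl) z

instance tensorFunctor_additive : (tensorFunctor S A X).Additive where
  map_add {Y Z f g} := by
    ext z
    exact DFunLike.congr_fun (BalancedTensor.addHom_ext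
      (f := BalancedTensor.map LinearMap.id (f.hom + g.hom))
      (g := BalancedTensor.map LinearMap.id f.hom + BalancedTensor.map LinearMap.id g.hom)
      fun x y => by
        rw [AddMonoidHom.add_apply, BalancedTensor.map_tmul, BalancedTensor.map_tmul,
          BalancedTensor.map_tmul, LinearMap.add_apply, BalancedTensor.tmul_add]) z

/-- `Tor_i^A(X, Y)` as a left `S`-module, for an `S`-`A`-bimodule `X`: the `i`-th left derived
functor of `X ⊗_A -`. -/
def torModule (i : ℕ) (Y : ModuleCat.{u} A) : ModuleCat.{u} S :=
  ((tensorFunctor S A X).leftDerived i).obj Y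

end Tensor

/-! ### Flat dimension -/

/-- A left `A`-module `M` is flat if `- ⊗_A M` preserves injectivity of maps of right
`A`-modules. -/
def IsFlatModule {A : Type u} [Ring A] (M : ModuleCat.{u} A) : Prop :=
  ∀ (X Y : Type u) [AddCommGroup X] [AddCommGroup Y] [Module Aᵐᵒᵖ X] [Module Aᵐᵒᵖ Y]
    (f : X →ₗ[Aᵐᵒᵖ] Y), Function.Injective f →
      Function.Injective (BalancedTensor.map f (LinearMap.id : M →ₗ[A] M))

/-- `fd_A M ≤ k`: there is an exact sequence `0 → F_k → ⋯ → F_1 → F_0 → M → 0` with all `F_j` flat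
(spliced from short exact sequences `0 → K → F_0 → M → 0` with `fd_A K ≤ k - 1`). -/
def FlatDimLE {A : Type u} [Ring A] : ℕ → ModuleCat.{u} A → Prop
  | 0, M => IsFlatModule M
  | k + 1, M => ∃ (K F : ModuleCat.{u} A) (f : K →ₗ[A] F) (g : F →ₗ[A] M),
      Function.Injective f ∧ Function.Exact f g ∧ Function.Surjective g ∧
        IsFlatModule F ∧ FlatDimLE k K

/-- `A` is Auslander `n`-Gorenstein: `fd_A Iⁱ(A) ≤ i` for `0 ≤ i ≤ n - 1`, where `Iⁱ(A)` are the
terms of the minimal injective resolution of the left module `A`. -/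
def IsAuslanderGorenstein (A : Type u) [Ring A] (n : ℕ) : Prop :=
  ∀ i < n, FlatDimLE i (minimalInjectiveTerm (ModuleCat.of A A) i)

/-! ### Module structures on Ext groups -/

section Ext

variable (S T : Type u) [Ring S] [Ring T] (B : Type u) [AddCommGroup B] [Module S B]

section Second

variable [Module T B] [SMulCommClass S T B]

/-- The action of `t : T` on `B`, as an endomorphism of the `S`-module `B`. -/
def actionHom (t : T) : ModuleCat.of S B ⟶ ModuleCat.of S B :=
  ModuleCat.ofHom
    { toFun := fun b => t • b
      map_add' := smul_add t
      map_smul' := fun s b => (smul_comm s t b).symm }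

variable {S T B}

theorem actionHom_one : actionHom S T B 1 = 𝟙 _ := by
  ext b; exact one_smul T b

theorem actionHom_mul (t t' : T) :
    actionHom S T B (t * t') = actionHom S T B t' ≫ actionHom S T B t := by
  ext b; exact mul_smul t t' b

theorem actionHom_add (t t' : T) :
    actionHom S T B (t + t') = actionHom S T B t + actionHom S T B t' := by
  ext b; exact add_smul t t' b

theorem actionHom_zero : actionHom S T B 0 = 0 := by
  ext b; exact zero_smul T b

/-- The `T`-module structure on `Ext^i_S(X, B)` induced by functoriality from a `T`-action on `B`
that commutes with the `S`-action. -/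
abbrev extSecondModule (X : ModuleCat.{u} S) (i : ℕ) :
    Module T (Abelian.Ext X (ModuleCat.of S B) i) where
  smul t x := x.comp (Abelian.Ext.mk₀ (actionHom S T B t)) (add_zero i)
  one_smul x := by
    change x.comp (Abelian.Ext.mk₀ (actionHom S T B 1)) (add_zero i) = x
    rw [actionHom_one, Abelian.Ext.comp_mk₀_id]
  mul_smul t t' x := by
    change x.comp (Abelian.Ext.mk₀ (actionHom S T B (t * t'))) (add_zero i) =
      (x.comp (Abelian.Ext.mk₀ (actionHom S T B t')) (add_zero i)).comp
        (Abelian.Ext.mk₀ (actionHom S T B t)) (add_zero i)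
    rw [actionHom_mul, Abelian.Ext.comp_assoc_of_third_deg_zero, Abelian.Ext.mk₀_comp_mk₀]
  smul_zero t := Abelian.Ext.zero_comp _ _ _ _ _
  smul_add t x y := Abelian.Ext.add_comp _ _ _ _
  add_smul t t' x := by
    change x.comp (Abelian.Ext.mk₀ (actionHom S T B (t + t'))) (add_zero i) =
      x.comp (Abelian.Ext.mk₀ (actionHom S T B t)) (add_zero i) +
        x.comp (Abelian.Ext.mk₀ (actionHom S T B t')) (add_zero i)
    rw [actionHom_add, Abelian.Ext.mk₀_add, Abelian.Ext.comp_add]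
  zero_smul x := by
    change x.comp (Abelian.Ext.mk₀ (actionHom S T B 0)) (add_zero i) = 0
    rw [actionHom_zero, Abelian.Ext.mk₀_zero, Abelian.Ext.comp_zero]

variable (S T B) in
/-- `Ext^i_S(X, B)` as a `T`-module, where `T` acts through `B`. -/
def extToBimodule (X : ModuleCat.{u} S) (i : ℕ) : ModuleCat.{u} T :=
  letI := extSecondModule (T := T) (B := B) X i
  ModuleCat.of T (Abelian.Ext X (ModuleCat.of S B) i)

end Second

section First

variable [Module Tᵐᵒᵖ B] [SMulCommClass S Tᵐᵒᵖ B]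

variable {S T B}

/-- The left `T`-module structure on `Ext^i_S(B, X)` induced by functoriality from the right
`T`-action on an `S`-`T`-bimodule `B`. -/
abbrev extFirstModule (X : ModuleCat.{u} S) (i : ℕ) :
    Module T (Abelian.Ext (ModuleCat.of S B) X i) where
  smul t x := (Abelian.Ext.mk₀ (actionHom S Tᵐᵒᵖ B (op t))).comp x (zero_add i)
  one_smul x := by
    change (Abelian.Ext.mk₀ (actionHom S Tᵐᵒᵖ B 1)).comp x (zero_add i) = x
    rw [actionHom_one, Abelian.Ext.mk₀_id_comp]
  mul_smul t t' x := by
    change (Abelian.Ext.mk₀ (actionHom S Tᵐᵒᵖ B (op t' * op t))).comp x (zero_add i) =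
      (Abelian.Ext.mk₀ (actionHom S Tᵐᵒᵖ B (op t))).comp
        ((Abelian.Ext.mk₀ (actionHom S Tᵐᵒᵖ B (op t'))).comp x (zero_add i)) (zero_add i)
    rw [actionHom_mul, Abelian.Ext.mk₀_comp_mk₀_assoc]
  smul_zero t := Abelian.Ext.comp_zero _ _ _ _ _
  smul_add t x y := Abelian.Ext.comp_add _ _ _ _
  add_smul t t' x := by
    change (Abelian.Ext.mk₀ (actionHom S Tᵐᵒᵖ B (op t + op t'))).comp x (zero_add i) =
      (Abelian.Ext.mk₀ (actionHom S Tᵐᵒᵖ B (op t))).comp x (zero_add i) +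
        (Abelian.Ext.mk₀ (actionHom S Tᵐᵒᵖ B (op t'))).comp x (zero_add i)
    rw [actionHom_add, Abelian.Ext.mk₀_add, Abelian.Ext.add_comp]
  zero_smul x := by
    change (Abelian.Ext.mk₀ (actionHom S Tᵐᵒᵖ B 0)).comp x (zero_add i) = 0
    rw [actionHom_zero, Abelian.Ext.mk₀_zero, Abelian.Ext.zero_comp]

variable (S T B) in
/-- `Ext^i_S(B, X)` as a left `T`-module, for an `S`-`T`-bimodule `B`. -/
def extFromBimodule (X : ModuleCat.{u} S) (i : ℕ) : ModuleCat.{u} T :=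
  letI := extFirstModule (T := T) (B := B) X i
  ModuleCat.of T (Abelian.Ext (ModuleCat.of S B) X i)

end First

end Ext

/-! ### Grade, Ext-cograde and Tor-cograde -/

/-- `grade_A M = inf {i ≥ 0 | Ext^i_A(M, A) ≠ 0}`, with `inf ∅ = ∞`. -/
def moduleGrade {A : Type u} [Ring A] (M : ModuleCat.{u} A) : ℕ∞ :=
  ⨅ (i : ℕ) (_ : Nontrivial (Abelian.Ext M (ModuleCat.of A A) i)), (i : ℕ∞)

/-- `s.grade_A M ≥ n`. -/
def StrongGradeGE {A : Type u} [Ring A] (M : ModuleCat.{u} A) (n : ℕ) : Prop :=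
  ∀ X : Submodule A M, (n : ℕ∞) ≤ moduleGrade (ModuleCat.of A X)

section Cograde

variable (S T : Type u) [Ring S] [Ring T] (W : Type u) [AddCommGroup W] [Module S W]

/-- The Ext-cograde of `M` with respect to `W`: `inf {i ≥ 0 | Ext^i_S(W, M) ≠ 0}`. -/
def extCograde (M : ModuleCat.{u} S) : ℕ∞ :=
  ⨅ (i : ℕ) (_ : Nontrivial (Abelian.Ext (ModuleCat.of S W) M i)), (i : ℕ∞)

/-- The strong Ext-cograde of `M` with respect to `W` is at least `n`. -/
def StrongExtCogradeGE (M : ModuleCat.{u} S) (n : ℕ) : Prop :=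
  ∀ K : Submodule S M, (n : ℕ∞) ≤ extCograde S W (ModuleCat.of S (M ⧸ K))

/-- The Tor-cograde of `N` with respect to the `S`-`T`-bimodule `W`:
`inf {i ≥ 0 | Tor_i^T(W, N) ≠ 0}`. -/
def torCograde [Module Tᵐᵒᵖ W] [SMulCommClass S Tᵐᵒᵖ W] (N : ModuleCat.{u} T) : ℕ∞ :=
  ⨅ (i : ℕ) (_ : Nontrivial (torModule S T W i N)), (i : ℕ∞)

/-- The strong Tor-cograde of `N` with respect to `W` is at least `n`. -/
def StrongTorCogradeGE [Module Tᵐᵒᵖ W] [SMulCommClass S Tᵐᵒᵖ W]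
    (N : ModuleCat.{u} T) (n : ℕ) : Prop :=
  ∀ Y : Submodule T N, (n : ℕ∞) ≤ torCograde S T W (ModuleCat.of T Y)

end Cograde

/-! ### The Matlis dual of an algebra -/

section Matlis

variable (R Λ : Type u) [CommRing R] [Ring Λ] [Algebra R Λ]

/-- The injective envelope `E⁰(R / J(R))`, with `J(R)` the Jacobson radical of `R`. -/
abbrev matlisModule : ModuleCat.{u} R :=
  injectiveEnvelope (ModuleCat.of R (R ⧸ Ring.jacobson R))

/-- `D(Λ) = Hom_R(Λ, E⁰(R / J(R)))`. -/
def MatlisDual : Type u :=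
  Λ →ₗ[R] matlisModule R

namespace MatlisDual

instance : AddCommGroup (MatlisDual R Λ) :=
  inferInstanceAs (AddCommGroup (Λ →ₗ[R] matlisModule R))

variable {R Λ} in
/-- An element of `D(Λ)` as a linear map. -/
def toLinearMap (f : MatlisDual R Λ) : Λ →ₗ[R] matlisModule R := f

/-- The left action `(a f)(x) = f(x a)`. -/
instance : Module Λ (MatlisDual R Λ) where
  smul a f := LinearMap.comp f (LinearMap.mulRight R a)
  one_smul f := LinearMap.ext fun x => congrArg (toLinearMap f) (mul_one x)
  mul_smul a b f := LinearMap.ext fun x => congrArg (toLinearMap f) (mul_assoc x a b).symm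
  smul_zero _ := LinearMap.zero_comp _
  smul_add _ f g := LinearMap.add_comp _ g f
  add_smul a b f := LinearMap.ext fun x =>
    (congrArg (toLinearMap f) (mul_add x a b)).trans (map_add (toLinearMap f) _ _)
  zero_smul f := LinearMap.ext fun x =>
    (congrArg (toLinearMap f) (mul_zero x)).trans (map_zero (toLinearMap f))

/-- The right action `(f a)(x) = f(a x)`. -/
instance : Module Λᵐᵒᵖ (MatlisDual R Λ) where
  smul a f := LinearMap.comp f (LinearMap.mulLeft R (unop a))
  one_smul f := LinearMap.ext fun x => congrArg (toLinearMap f) (one_mul x)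
  mul_smul a b f := LinearMap.ext fun x =>
    congrArg (toLinearMap f) (mul_assoc (unop b) (unop a) x)
  smul_zero _ := LinearMap.zero_comp _
  smul_add _ f g := LinearMap.add_comp _ g f
  add_smul a b f := LinearMap.ext fun x =>
    (congrArg (toLinearMap f) (add_mul (unop a) (unop b) x)).trans (map_add (toLinearMap f) _ _)
  zero_smul f := LinearMap.ext fun x =>
    (congrArg (toLinearMap f) (zero_mul x)).trans (map_zero (toLinearMap f))

variable {R Λ} in
theorem smul_apply (a : Λ) (f : MatlisDual R Λ) (x : Λ) :
    toLinearMap (a • f) x = toLinearMap f (x * a) := rfl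

variable {R Λ} in
theorem op_smul_apply (a : Λ) (f : MatlisDual R Λ) (x : Λ) :
    toLinearMap (op a • f) x = toLinearMap f (a * x) := rfl

instance : SMulCommClass Λ Λᵐᵒᵖ (MatlisDual R Λ) where
  smul_comm a b f := by
    refine LinearMap.ext fun x => ?_
    change toLinearMap f (unop b * (x * a)) = toLinearMap f (unop b * x * a)
    rw [mul_assoc]

end MatlisDual

end Matlis

end

/-! All six conditions are compared with the two strong grade conditions (2) and (2)^op, which
concern only Ext into the ring.

Auslander condition and grade. By Lambek's theorem, the flat dimension of a left module `I` is read
off the character module `I⁺`: it is at most `k` exactly when `Ext^{k+1}(N, I⁺) = 0` for all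
finitely generated right modules `N` (`flatDimLE_iff`). For injective `I` and a ring noetherian on
the right, this vanishing means `Hom(Ext^{k+1}(N, A), I) = 0` (`subsingleton_ext_charDual_iff`).
Thus Auslander `n`-Gorenstein says that `Ext^{i+1}(N, A)` has no nonzero map to `I^i(A)` for `i <
n`. Essentiality of injective envelopes turns such statements into vanishing of `Ext^j(X, A)` on
submodules `X` (`hom_minimalInjectiveTerm_eq_zero`). The module `N` lives on the opposite side, so
(1) matches (2)^op and (1)^op matches (2).

Symmetry. The passage between (2) and (2)^op (`StrongGradeCondition.symm`) is an Auslander–Bridger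
argument. A submodule `Y` of `Ext^{m+1}(M, A)` embeds in the transpose of a differential `d` of a
free resolution of `M`. The restriction from that transpose to `Y` is zero on `Ext^m(-, A)`, so
`Ext^m(Y, A)` embeds in an `Ext^{m+1}` of a finitely generated module on the other side and has
grade at least `m + 1` by assumption. A module of that grade has no nonzero map to `Ext^m(Y, A)`
(`hom_to_ext_eq_zero`); applied to the identity, this gives `Ext^m(Y, A) = 0`.

Cogrades. Over an artinian base, `W = D(Λ)` gives a duality of finitely generated modules in both
directions, and `End_Λ(W)` is `Λ` acting on the right. Hence `Tor_i(W, M)` is the dual of `Ext^i(M,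
Λ)` (`nonempty_tor_equiv`) and `Ext^i(W, M)` is `Ext^i` from the dual of `M` into `Λ`
(`nonempty_extFrom_equiv_dual`). Since duality exchanges submodules and quotients, (3) becomes (2)
and (4) becomes (2)^op.

The regular bimodule `B` and the isomorphism `ρ : A' ≃+* Aᵐᵒᵖ` keep the argument symmetric in the
two sides, so that no double opposite ring appears. -/

noncomputable section

/-! ### Short exact sequences of modules and vanishing of Ext groups -/

/-- `0 → X → Y → Z → 0` is a short exact sequence of modules. -/
structure IsShortExact {A : Type u} [Ring A] {X Y Z : Type u} [AddCommGroup X] [Module A X]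
    [AddCommGroup Y] [Module A Y] [AddCommGroup Z] [Module A Z] (f : X →ₗ[A] Y) (g : Y →ₗ[A] Z) :
    Prop where
  injective : Function.Injective f
  exact : Function.Exact f g
  surjective : Function.Surjective g

/-- The group `Ext^n_A(X, Y)` of unbundled modules. -/
abbrev ExtGroup (A : Type u) [Ring A] (X Y : Type u) [AddCommGroup X] [Module A X]
    [AddCommGroup Y] [Module A Y] (n : ℕ) : Type u :=
  Abelian.Ext (ModuleCat.of A X) (ModuleCat.of A Y) n

section ExtVanishing

variable {A : Type u} [Ring A] {X Y Z W : Type u} [AddCommGroup X] [Module A X]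
    [AddCommGroup Y] [Module A Y] [AddCommGroup Z] [Module A Z] [AddCommGroup W] [Module A W]

namespace IsShortExact

variable {f : X →ₗ[A] Y} {g : Y →ₗ[A] Z}

theorem ker_subtype_mkQ (K : Submodule A Y) : IsShortExact K.subtype K.mkQ where
  injective := K.injective_subtype
  exact := LinearMap.exact_iff.2 (by simp)
  surjective := K.mkQ_surjective

theorem of_surjective (hg : Function.Surjective g) :
    IsShortExact (LinearMap.ker g).subtype g where
  injective := Submodule.injective_subtype _
  exact := LinearMap.exact_iff.2 (by simp)
  surjective := hg

theorem of_injective (hf : Function.Injective f) :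
    IsShortExact f (LinearMap.range f).mkQ where
  injective := hf
  exact := LinearMap.exact_iff.2 (by simp)
  surjective := Submodule.mkQ_surjective _

/-- The short complex in the category of modules. -/
abbrev shortComplex (h : IsShortExact f g) : ShortComplex (ModuleCat.{u} A) :=
  ShortComplex.mk (ModuleCat.ofHom f) (ModuleCat.ofHom g) (by
    ext x; exact h.exact.apply_apply_eq_zero x)

theorem shortExact (h : IsShortExact f g) : h.shortComplex.ShortExact where
  exact := (ShortComplex.ShortExact.moduleCat_exact_iff_function_exact _).2 h.exact
  mono_f := (ModuleCat.mono_iff_injective _).2 h.injective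
  epi_g := (ModuleCat.epi_iff_surjective _).2 h.surjective

theorem subsingleton_ext_left (h : IsShortExact f g) {n : ℕ}
    (hY : Subsingleton (ExtGroup A W Y (n + 1))) (hZ : Subsingleton (ExtGroup A W Z n)) :
    Subsingleton (ExtGroup A W X (n + 1)) := by
  refine subsingleton_of_forall_eq 0 fun x => ?_
  obtain ⟨y, rfl⟩ := Abelian.Ext.covariant_sequence_exact₁ _ h.shortExact x
    (Subsingleton.elim (α := ExtGroup A W Y (n + 1)) _ _) rfl
  rw [Subsingleton.elim (α := ExtGroup A W Z n) y 0, Abelian.Ext.zero_comp]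

theorem subsingleton_ext_right (h : IsShortExact f g) {n : ℕ}
    (hY : Subsingleton (ExtGroup A W Y n)) (hX : Subsingleton (ExtGroup A W X (n + 1))) :
    Subsingleton (ExtGroup A W Z n) := by
  refine subsingleton_of_forall_eq 0 fun x => ?_
  obtain ⟨y, rfl⟩ := Abelian.Ext.covariant_sequence_exact₃ _ h.shortExact x rfl
    (Subsingleton.elim (α := ExtGroup A W X (n + 1)) _ _)
  rw [Subsingleton.elim (α := ExtGroup A W Y n) y 0, Abelian.Ext.zero_comp]

theorem subsingleton_ext_from_left (h : IsShortExact f g) {n : ℕ}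
    (hY : Subsingleton (ExtGroup A Y W n)) (hZ : Subsingleton (ExtGroup A Z W (n + 1))) :
    Subsingleton (ExtGroup A X W n) := by
  refine subsingleton_of_forall_eq 0 fun x => ?_
  obtain ⟨y, rfl⟩ := Abelian.Ext.contravariant_sequence_exact₁ h.shortExact _ x (add_comm 1 n)
    (Subsingleton.elim (α := ExtGroup A Z W (n + 1)) _ _)
  rw [Subsingleton.elim (α := ExtGroup A Y W n) y 0, Abelian.Ext.comp_zero]

theorem subsingleton_ext_from_right (h : IsShortExact f g) {n : ℕ}
    (hX : Subsingleton (ExtGroup A X W n)) (hY : Subsingleton (ExtGroup A Y W (n + 1))) :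
    Subsingleton (ExtGroup A Z W (n + 1)) := by
  refine subsingleton_of_forall_eq 0 fun x => ?_
  obtain ⟨y, rfl⟩ := Abelian.Ext.contravariant_sequence_exact₃ h.shortExact _ x
    (Subsingleton.elim (α := ExtGroup A Y W (n + 1)) _ _) (add_comm 1 n)
  rw [Subsingleton.elim (α := ExtGroup A X W n) y 0, Abelian.Ext.comp_zero]

end IsShortExact

theorem subsingleton_ext_zero_iff :
    Subsingleton (ExtGroup A X Y 0) ↔ ∀ f : X →ₗ[A] Y, f = 0 := by
  rw [(Abelian.Ext.addEquiv₀ (X := ModuleCat.of A X) (Y := ModuleCat.of A Y)).toEquiv.subsingleton_congr]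
  constructor
  · intro h f
    exact congrArg ModuleCat.Hom.hom (Subsingleton.elim (ModuleCat.ofHom f) 0)
  · intro h
    refine subsingleton_of_forall_eq 0 fun f => ?_
    ext1
    exact h f.hom

theorem subsingleton_ext_of_injective [Module.Injective A Y] (n : ℕ) :
    Subsingleton (ExtGroup A X Y (n + 1)) := by
  have : Injective (ModuleCat.of A Y) := Module.injective_object_of_injective_module A Y
  exact subsingleton_of_forall_eq 0 Abelian.Ext.eq_zero_of_injective

theorem subsingleton_ext_of_projective [Module.Projective A X] (n : ℕ) :
    Subsingleton (ExtGroup A X Y (n + 1)) := by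
  have : Projective (ModuleCat.of A X) := (IsProjective.iff_projective X).1 inferInstance
  exact subsingleton_of_forall_eq 0 Abelian.Ext.eq_zero_of_projective

theorem subsingleton_ext_congr_left (e : X ≃ₗ[A] Y) {n : ℕ}
    (h : Subsingleton (ExtGroup A Y Z n)) : Subsingleton (ExtGroup A X Z n) := by
  refine subsingleton_of_forall_eq 0 fun x => ?_
  have h1 : (Abelian.Ext.mk₀ e.symm.toModuleIso.hom).comp x (zero_add n) = 0 :=
    Subsingleton.elim (α := ExtGroup A Y Z n) _ _
  have h2 := congrArg (fun y => (Abelian.Ext.mk₀ e.symm.toModuleIso.inv).comp y (zero_add n)) h1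
  rw [Abelian.Ext.mk₀_comp_mk₀_assoc, Iso.inv_hom_id] at h2
  exact (Abelian.Ext.mk₀_id_comp x).symm.trans (h2.trans (Abelian.Ext.comp_zero _ _ _ _ _))

theorem subsingleton_ext_congr_right (e : Y ≃ₗ[A] Z) {n : ℕ}
    (h : Subsingleton (ExtGroup A X Z n)) : Subsingleton (ExtGroup A X Y n) := by
  refine subsingleton_of_forall_eq 0 fun x => ?_
  have h1 : x.comp (Abelian.Ext.mk₀ e.toModuleIso.hom) (add_zero n) = 0 :=
    Subsingleton.elim (α := ExtGroup A X Z n) _ _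
  have h2 := congrArg (fun y => y.comp (Abelian.Ext.mk₀ e.toModuleIso.inv) (add_zero n)) h1
  rw [Abelian.Ext.comp_assoc_of_third_deg_zero, Abelian.Ext.mk₀_comp_mk₀, Iso.hom_inv_id] at h2
  exact (Abelian.Ext.comp_mk₀_id x).symm.trans (h2.trans (Abelian.Ext.zero_comp _ _ _ _ _))

/-- The identity of `Y^k` is a finite sum of endomorphisms factoring through `Y`, so every class is
a sum of classes that pass through the zero group `Ext^n(X, Y)`. -/
theorem subsingleton_ext_pi (k : ℕ) {n : ℕ} (h : Subsingleton (ExtGroup A X Y n)) :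
    Subsingleton (ExtGroup A X (Fin k → Y) n) := by
  refine subsingleton_of_forall_eq 0 fun x => ?_
  have hid : 𝟙 (ModuleCat.of A (Fin k → Y)) = ∑ i : Fin k,
      ModuleCat.ofHom (LinearMap.proj (φ := fun _ : Fin k => Y) i) ≫
        ModuleCat.ofHom (LinearMap.single A (fun _ : Fin k => Y) i) := by
    ext1
    rw [ModuleCat.hom_sum]
    refine LinearMap.ext fun y => ?_
    simp [LinearMap.sum_apply, Finset.univ_sum_single]
  rw [← Abelian.Ext.comp_mk₀_id x, hid, Abelian.Ext.mk₀_sum, Abelian.Ext.comp_sum]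
  refine Finset.sum_eq_zero fun i _ => ?_
  rw [← Abelian.Ext.mk₀_comp_mk₀, ← Abelian.Ext.comp_assoc_of_third_deg_zero,
    Subsingleton.elim (α := ExtGroup A X Y n) (x.comp _ (add_zero n)) 0, Abelian.Ext.zero_comp]

end ExtVanishing

theorem natCast_le_iInf_nontrivial_iff {F : ℕ → Type u} {n : ℕ} :
    (n : ℕ∞) ≤ ⨅ (i : ℕ) (_ : Nontrivial (F i)), (i : ℕ∞) ↔ ∀ j < n, Subsingleton (F j) := by
  rw [le_iInf₂_iff]
  constructor
  · intro h j hj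
    by_contra hc
    exact absurd (Nat.cast_le.1 (h j (not_subsingleton_iff_nontrivial.1 hc))) (by omega)
  · intro h i hi
    by_contra hc
    have hlt : i < n := Nat.cast_lt.1 (not_le.1 hc)
    exact not_subsingleton_iff_nontrivial.2 hi (h i hlt)

/-! ### Linear structure on the long exact sequences of Ext -/

section ExtTo

variable {S T : Type u} [Ring S] [Ring T] (B : Type u) [AddCommGroup B] [Module S B]
  [Module T B] [SMulCommClass S T B]

variable (T) in
/-- Composition with a fixed class on the left, as a `T`-linear map. -/
def extToPrecomp {X Y : ModuleCat.{u} S} {k i j : ℕ} (α : Abelian.Ext X Y k) (h : k + i = j) :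
    extToBimodule S T B Y i →ₗ[T] extToBimodule S T B X j where
  toFun x := α.comp (show Abelian.Ext Y (ModuleCat.of S B) i from x) h
  map_add' _ _ := Abelian.Ext.comp_add _ _ _ _
  map_smul' t x := (Abelian.Ext.comp_assoc_of_third_deg_zero α
    (show Abelian.Ext Y (ModuleCat.of S B) i from x)
    (Abelian.Ext.mk₀ (actionHom S T B t)) h).symm

variable {X Y Z : Type u} [AddCommGroup X] [Module S X]
  [AddCommGroup Y] [Module S Y] [AddCommGroup Z] [Module S Z]

variable (S T X) in
/-- `Hom_S(X, B) ≅ Ext^0_S(X, B)` as `T`-modules. -/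
def homEquivExtTo : (X →ₗ[S] B) ≃ₗ[T] extToBimodule S T B (ModuleCat.of S X) 0 :=
  LinearEquiv.ofBijective
    (show (X →ₗ[S] B) →ₗ[T]
        extToBimodule S T B (ModuleCat.of S X) 0 from
    { toFun := fun f => Abelian.Ext.mk₀ (ModuleCat.ofHom f)
      map_add' := fun f g => by
        exact (congrArg Abelian.Ext.mk₀ (ModuleCat.ofHom_add f g)).trans (Abelian.Ext.mk₀_add _ _)
      map_smul' := fun t f => by
        have h : ModuleCat.ofHom (t • f) = ModuleCat.ofHom f ≫ actionHom S T B t := rfl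
        rw [h, ← Abelian.Ext.mk₀_comp_mk₀]
        rfl })
    ((Abelian.Ext.mk₀_bijective (ModuleCat.of S X) (ModuleCat.of S B)).comp
      (ModuleCat.homEquiv (M := ModuleCat.of S X) (N := ModuleCat.of S B)).symm.bijective)

theorem homEquivExtTo_apply (φ : X →ₗ[S] B) :
    homEquivExtTo S T B X φ = Abelian.Ext.mk₀ (ModuleCat.ofHom φ) := rfl

variable (T) in
/-- Isomorphic modules have isomorphic Ext modules. -/
def extToCongr (e : X ≃ₗ[S] Y) (i : ℕ) :
    extToBimodule S T B (ModuleCat.of S X) i ≃ₗ[T] extToBimodule S T B (ModuleCat.of S Y) i :=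
  LinearEquiv.ofLinearMap
    (extToPrecomp T B (Abelian.Ext.mk₀ e.toModuleIso.inv) (zero_add i))
    (extToPrecomp T B (Abelian.Ext.mk₀ e.toModuleIso.hom) (zero_add i))
    (LinearMap.ext fun x => by
      refine (Abelian.Ext.mk₀_comp_mk₀_assoc _ _ _).trans ?_
      rw [Iso.inv_hom_id]
      exact Abelian.Ext.mk₀_id_comp _)
    (LinearMap.ext fun x => by
      refine (Abelian.Ext.mk₀_comp_mk₀_assoc _ _ _).trans ?_
      rw [Iso.hom_inv_id]
      exact Abelian.Ext.mk₀_id_comp _)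

namespace IsShortExact

variable {f : X →ₗ[S] Y} {g : Y →ₗ[S] Z}

variable (T) in
/-- The connecting map `Ext^n_S(X, B) → Ext^{n+1}_S(Z, B)`. -/
def connectingTo (h : IsShortExact f g) (n : ℕ) :
    extToBimodule S T B (ModuleCat.of S X) n →ₗ[T]
      extToBimodule S T B (ModuleCat.of S Z) (n + 1) :=
  extToPrecomp T B h.shortExact.extClass (add_comm 1 n)

theorem connectingTo_surjective (h : IsShortExact f g) (n : ℕ)
    (hY : Subsingleton (ExtGroup S Y B (n + 1))) :
    Function.Surjective (h.connectingTo T B n) := fun x =>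
  Abelian.Ext.contravariant_sequence_exact₃ h.shortExact _ x
    (Subsingleton.elim (α := ExtGroup S Y B (n + 1)) _ _) (add_comm 1 n)

/-- Only the restriction along `f` has to vanish, not the Ext group of the middle term: in degree
zero of the symmetry argument `Hom(Y, B)` may be nonzero. -/
theorem connectingTo_injective (h : IsShortExact f g) (n : ℕ)
    (hY : ∀ x : ExtGroup S Y B n, (Abelian.Ext.mk₀ (ModuleCat.ofHom f)).comp x (zero_add n) = 0) :
    Function.Injective (h.connectingTo T B n) := by
  refine (injective_iff_map_eq_zero _).2 fun x hx => ?_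
  obtain ⟨y, rfl⟩ := Abelian.Ext.contravariant_sequence_exact₁ h.shortExact _
    (show ExtGroup S X B n from x) (add_comm 1 n) hx
  exact hY y

variable (T) in
/-- `Ext^{n+2}_S(Z, B) ≅ Ext^{n+1}_S(X, B)` if the middle term is projective. -/
def extToShift (h : IsShortExact f g) [Module.Projective S Y] (n : ℕ) :
    extToBimodule S T B (ModuleCat.of S X) (n + 1) ≃ₗ[T]
      extToBimodule S T B (ModuleCat.of S Z) (n + 2) :=
  LinearEquiv.ofBijective (h.connectingTo T B (n + 1))
    ⟨h.connectingTo_injective B _ fun x => by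
      have : Subsingleton (ExtGroup S Y B (n + 1)) := subsingleton_ext_of_projective n
      rw [Subsingleton.elim x 0, Abelian.Ext.comp_zero],
    h.connectingTo_surjective B _ (subsingleton_ext_of_projective _)⟩

variable (T) in
/-- `Ext^1_S(Z, B)` is the cokernel of `Hom_S(Y, B) → Hom_S(X, B)` if the middle term is
projective. -/
def extToOne (h : IsShortExact f g) [Module.Projective S Y] :
    ((X →ₗ[S] B) ⧸ LinearMap.range (LinearMap.lcomp T B f)) ≃ₗ[T]
      extToBimodule S T B (ModuleCat.of S Z) 1 :=
  (Submodule.quotEquivOfEq _ _ (by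
    ext φ
    rw [LinearMap.mem_ker]
    constructor
    · rintro ⟨ψ, rfl⟩
      have hc : (ModuleCat.ofHom (LinearMap.lcomp T B f ψ)) =
          ModuleCat.ofHom f ≫ ModuleCat.ofHom ψ := rfl
      change h.connectingTo T B 0 (homEquivExtTo S T B X _) = 0
      rw [homEquivExtTo_apply, hc, ← Abelian.Ext.mk₀_comp_mk₀]
      exact h.shortExact.extClass_comp_assoc (h := add_comm 1 0) _
    · intro hφ
      obtain ⟨x, hx⟩ := Abelian.Ext.contravariant_sequence_exact₁ h.shortExact _ _ (add_comm 1 0) hφ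
      obtain ⟨ψ, rfl⟩ := (homEquivExtTo S T B Y).surjective x
      refine ⟨ψ, (homEquivExtTo S T B X).injective ?_⟩
      exact (Abelian.Ext.mk₀_comp_mk₀ _ _).symm.trans hx)).trans
  (LinearMap.quotKerEquivOfSurjective
    (h.connectingTo T B 0 ∘ₗ (homEquivExtTo S T B X).toLinearMap)
    ((h.connectingTo_surjective B 0 (subsingleton_ext_of_projective 0)).comp
      (homEquivExtTo S T B X).surjective))

end IsShortExact

end ExtTo

section ExtFrom

variable {S T : Type u} [Ring S] [Ring T] (B : Type u) [AddCommGroup B] [Module S B]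
  [Module Tᵐᵒᵖ B] [SMulCommClass S Tᵐᵒᵖ B]

variable (T) in
/-- Composition with a fixed class on the right, as a `T`-linear map. -/
def extFromPostcomp {X Y : ModuleCat.{u} S} {k i j : ℕ} (α : Abelian.Ext X Y k) (h : i + k = j) :
    extFromBimodule S T B X i →ₗ[T] extFromBimodule S T B Y j where
  toFun x := Abelian.Ext.comp (show Abelian.Ext (ModuleCat.of S B) X i from x) α h
  map_add' _ _ := Abelian.Ext.add_comp _ _ _ _
  map_smul' t x := Abelian.Ext.comp_assoc (Abelian.Ext.mk₀ (actionHom S Tᵐᵒᵖ B (op t)))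
    (show Abelian.Ext (ModuleCat.of S B) X i from x) α (zero_add i) h (by omega)

variable {X Y Z : Type u} [AddCommGroup X] [Module S X]
  [AddCommGroup Y] [Module S Y] [AddCommGroup Z] [Module S Z]

variable (S T) in
/-- The left `T`-module structure on `Hom_S(B, X)`, for an `S`-`T`-bimodule `B`. -/
abbrev homFromModule (X : Type u) [AddCommGroup X] [Module S X] : Module T (B →ₗ[S] X) where
  smul t φ := φ ∘ₗ (actionHom S Tᵐᵒᵖ B (op t)).hom
  one_smul φ := LinearMap.ext fun b => congrArg φ (one_smul Tᵐᵒᵖ b)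
  mul_smul t t' φ := LinearMap.ext fun b => congrArg φ (mul_smul (op t') (op t) b)
  smul_zero _ := LinearMap.zero_comp _
  smul_add _ _ _ := LinearMap.add_comp _ _ _
  add_smul t t' φ := LinearMap.ext fun b =>
    (congrArg φ (add_smul (op t) (op t') b)).trans (map_add φ _ _)
  zero_smul φ := LinearMap.ext fun b =>
    (congrArg φ (zero_smul Tᵐᵒᵖ b)).trans (map_zero φ)

variable (S T X) in
/-- `Hom_S(B, X) ≅ Ext^0_S(B, X)` as `T`-modules. -/
def homEquivExtFrom :
    letI := homFromModule S T B X
    (B →ₗ[S] X) ≃ₗ[T] extFromBimodule S T B (ModuleCat.of S X) 0 :=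
  letI := homFromModule S T B X
  LinearEquiv.ofBijective
    (show (B →ₗ[S] X) →ₗ[T]
        extFromBimodule S T B (ModuleCat.of S X) 0 from
    { toFun := fun f => Abelian.Ext.mk₀ (ModuleCat.ofHom f)
      map_add' := fun f g => by
        exact (congrArg Abelian.Ext.mk₀ (ModuleCat.ofHom_add f g)).trans (Abelian.Ext.mk₀_add _ _)
      map_smul' := fun t f => by
        have h : ModuleCat.ofHom (t • f) = actionHom S Tᵐᵒᵖ B (op t) ≫ ModuleCat.ofHom f := rfl
        rw [h, ← Abelian.Ext.mk₀_comp_mk₀]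
        rfl })
    ((Abelian.Ext.mk₀_bijective (ModuleCat.of S B) (ModuleCat.of S X)).comp
      (ModuleCat.homEquiv (M := ModuleCat.of S B) (N := ModuleCat.of S X)).symm.bijective)

variable (T) in
/-- Isomorphic modules have isomorphic Ext modules. -/
def extFromCongr (e : X ≃ₗ[S] Y) (i : ℕ) :
    extFromBimodule S T B (ModuleCat.of S X) i ≃ₗ[T]
      extFromBimodule S T B (ModuleCat.of S Y) i :=
  LinearEquiv.ofLinearMap
    (extFromPostcomp T B (Abelian.Ext.mk₀ e.toModuleIso.hom) (add_zero i))
    (extFromPostcomp T B (Abelian.Ext.mk₀ e.toModuleIso.inv) (add_zero i))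
    (LinearMap.ext fun x => by
      refine (Abelian.Ext.comp_assoc_of_third_deg_zero _ _ _ (add_zero i)).trans ?_
      rw [Abelian.Ext.mk₀_comp_mk₀, Iso.inv_hom_id]
      exact Abelian.Ext.comp_mk₀_id _)
    (LinearMap.ext fun x => by
      refine (Abelian.Ext.comp_assoc_of_third_deg_zero _ _ _ (add_zero i)).trans ?_
      rw [Abelian.Ext.mk₀_comp_mk₀, Iso.hom_inv_id]
      exact Abelian.Ext.comp_mk₀_id _)

namespace IsShortExact

variable {f : X →ₗ[S] Y} {g : Y →ₗ[S] Z}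

variable (T) in
/-- The connecting map `Ext^n_S(B, Z) → Ext^{n+1}_S(B, X)`. -/
def connectingFrom (h : IsShortExact f g) (n : ℕ) :
    extFromBimodule S T B (ModuleCat.of S Z) n →ₗ[T]
      extFromBimodule S T B (ModuleCat.of S X) (n + 1) :=
  extFromPostcomp T B h.shortExact.extClass rfl

theorem connectingFrom_surjective (h : IsShortExact f g) (n : ℕ)
    (hY : Subsingleton (ExtGroup S B Y (n + 1))) :
    Function.Surjective (h.connectingFrom T B n) := fun x =>
  Abelian.Ext.covariant_sequence_exact₁ _ h.shortExact x
    (Subsingleton.elim (α := ExtGroup S B Y (n + 1)) _ _) rfl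

variable (T) in
/-- `Ext^{n+1}_S(B, Z) ≅ Ext^{n+2}_S(B, X)` if the middle term is injective. -/
def extFromShift (h : IsShortExact f g) [Module.Injective S Y] (n : ℕ) :
    extFromBimodule S T B (ModuleCat.of S Z) (n + 1) ≃ₗ[T]
      extFromBimodule S T B (ModuleCat.of S X) (n + 2) :=
  LinearEquiv.ofBijective (h.connectingFrom T B (n + 1))
    ⟨(injective_iff_map_eq_zero _).2 fun x hx => by
      obtain ⟨y, rfl⟩ := Abelian.Ext.covariant_sequence_exact₃ _ h.shortExact
        (show ExtGroup S B Z (n + 1) from x) rfl hx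
      have : Subsingleton (ExtGroup S B Y (n + 1)) := subsingleton_ext_of_injective n
      rw [Subsingleton.elim (α := ExtGroup S B Y (n + 1)) y 0]
      exact Abelian.Ext.zero_comp _ _ _ _ _,
    h.connectingFrom_surjective B _ (subsingleton_ext_of_injective _)⟩

theorem connectingFrom_zero_eq_zero_iff (h : IsShortExact f g) (φ : B →ₗ[S] Z) :
    h.connectingFrom T B 0 (homEquivExtFrom S T B Z φ) = 0 ↔ ∃ ψ : B →ₗ[S] Y, g ∘ₗ ψ = φ := by
  constructor
  · intro hφ
    obtain ⟨x, hx⟩ := Abelian.Ext.covariant_sequence_exact₃ _ h.shortExact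
        (show ExtGroup S B Z 0 from _) rfl hφ
    obtain ⟨ψ, rfl⟩ := (homEquivExtFrom S T B Y).surjective x
    refine ⟨ψ, (homEquivExtFrom S T B Z).injective ?_⟩
    exact (Abelian.Ext.mk₀_comp_mk₀ _ _).symm.trans hx
  · rintro ⟨ψ, rfl⟩
    change Abelian.Ext.comp (Abelian.Ext.mk₀ (ModuleCat.ofHom ψ ≫ ModuleCat.ofHom g)) _
      (zero_add 1) = 0
    rw [← Abelian.Ext.mk₀_comp_mk₀, Abelian.Ext.comp_assoc_of_second_deg_zero,
      h.shortExact.comp_extClass, Abelian.Ext.comp_zero]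

end IsShortExact

end ExtFrom

/-! ### Regular bimodules and the transpose -/

/-- `B` is a regular bimodule: it is free of rank one on the basis `b` on both sides. -/
structure IsRegularBimodule (A A' : Type u) [Ring A] [Ring A'] {B : Type u} [AddCommGroup B]
    [Module A B] [Module A' B] (b : B) : Prop where
  left : Function.Bijective fun a : A => a • b
  right : Function.Bijective fun a : A' => a • b

namespace IsRegularBimodule

variable {A A' : Type u} [Ring A] [Ring A'] {B : Type u} [AddCommGroup B]
    [Module A B] [Module A' B] {b : B}

theorem symm (h : IsRegularBimodule A A' b) : IsRegularBimodule A' A b := ⟨h.right, h.left⟩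

/-- `A ≅ B` as left modules. -/
def leftEquiv (h : IsRegularBimodule A A' b) : A ≃ₗ[A] B :=
  LinearEquiv.ofBijective (LinearMap.toSpanSingleton A B b) h.left

/-- The coordinate functionals on a finite free module. -/
def coord (b : B) {n : ℕ} (i : Fin n) : (Fin n → A) →ₗ[A] B :=
  LinearMap.toSpanSingleton A B b ∘ₗ LinearMap.proj i

@[simp]
theorem coord_apply {n : ℕ} (i : Fin n) (x : Fin n → A) : coord b i x = x i • b := rfl

theorem eq_zero_of_dual_eq_zero (h : IsRegularBimodule A A' b) {n : ℕ} (x : Fin n → A)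
    (hx : ∀ φ : (Fin n → A) →ₗ[A] B, φ x = 0) : x = 0 := by
  ext i
  exact h.left.1 ((hx (coord b i)).trans (zero_smul A b).symm)

variable [SMulCommClass A A' B]

/-- The dual of a finite free module is finite free. -/
def dualPi (h : IsRegularBimodule A A' b) (n : ℕ) :
    ((Fin n → A) →ₗ[A] B) ≃ₗ[A'] (Fin n → A') :=
  ((Pi.basisFun A (Fin n)).constr A').symm.trans
    (LinearEquiv.piCongrRight fun _ => h.symm.leftEquiv.symm)

theorem finite_dual_pi (h : IsRegularBimodule A A' b) (n : ℕ) :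
    Module.Finite A' ((Fin n → A) →ₗ[A] B) := Module.Finite.equiv (h.dualPi n).symm

theorem projective_dual_pi (h : IsRegularBimodule A A' b) (n : ℕ) :
    Module.Projective A' ((Fin n → A) →ₗ[A] B) := Module.Projective.of_equiv (h.dualPi n).symm

/-- Surjectivity half of the reflexivity of finite free modules: the coordinates of `x` are the
values of `θ` on the coordinate functionals, which generate the dual over `A'`. -/
theorem exists_eval_eq (h : IsRegularBimodule A A' b) {n : ℕ}
    (θ : ((Fin n → A) →ₗ[A] B) →ₗ[A'] B) :
    ∃ x : Fin n → A, ∀ φ, θ φ = φ x := by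
  choose x hx using fun i => h.left.2 (θ (coord b i))
  refine ⟨x, fun φ => ?_⟩
  choose c hc using fun i => h.right.2 (φ (Pi.single i 1))
  have key : ∀ y : Fin n → A, φ y = ∑ i, y i • c i • b := by
    intro y
    rw [LinearMap.pi_apply_eq_sum_univ φ y]
    refine Finset.sum_congr rfl fun i _ => ?_
    have : (fun j => if i = j then (1 : A) else 0) = Pi.single i 1 := by
      ext j; simp [Pi.single_apply, eq_comm]
    rw [this, ← hc]
  have hφ : φ = ∑ i, c i • coord b i := by
    refine LinearMap.ext fun y => ?_
    rw [key, LinearMap.sum_apply]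
    exact Finset.sum_congr rfl fun i _ => smul_comm _ _ _
  rw [key]
  conv_lhs => rw [hφ]
  rw [map_sum]
  refine Finset.sum_congr rfl fun i _ => ?_
  rw [map_smul, ← hx]
  exact (smul_comm _ _ _).symm

end IsRegularBimodule

section Transpose

variable {A A' : Type u} [Ring A] [Ring A'] {B : Type u} [AddCommGroup B]
    [Module A B] [Module A' B] [SMulCommClass A A' B]

variable (A' B) in
/-- The transpose of a map `d : F₁ → F₀`: the cokernel of `Hom(F₀, B) → Hom(F₁, B)`. -/
abbrev Transpose {F₁ F₀ : Type u} [AddCommGroup F₁] [Module A F₁] [AddCommGroup F₀] [Module A F₀]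
    (d : F₁ →ₗ[A] F₀) : Type u :=
  (F₁ →ₗ[A] B) ⧸ LinearMap.range (LinearMap.lcomp A' B d)

variable (A' B) in
/-- `Ext^1(Coker d, B)` embeds into the transpose of `d`. -/
theorem exists_extOne_to_transpose {F₁ F₀ : Type u} [AddCommGroup F₁] [Module A F₁]
    [AddCommGroup F₀] [Module A F₀] [Module.Projective A F₀] (d : F₁ →ₗ[A] F₀) :
    ∃ ι : extToBimodule A A' B (ModuleCat.of A (F₀ ⧸ LinearMap.range d)) 1 →ₗ[A']
      Transpose A' B d, Function.Injective ι ∧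
      -- The image consists of the classes of functionals killing the kernel of `d`; these are the
      -- functionals that factor through its image.
      ∀ φ : F₁ →ₗ[A] B, Submodule.Quotient.mk φ ∈ LinearMap.range ι ↔
        ∀ y, d y = 0 → φ y = 0 := by
  let K := LinearMap.range d
  have hK := IsShortExact.ker_subtype_mkQ K
  let p : (K →ₗ[A] B) →ₗ[A'] (F₁ →ₗ[A] B) := LinearMap.lcomp A' B d.rangeRestrict
  let q : ((K →ₗ[A] B) ⧸ LinearMap.range (LinearMap.lcomp A' B K.subtype)) →ₗ[A']
      Transpose A' B d := Submodule.mapQ _ _ p (by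
    rintro _ ⟨ψ, rfl⟩
    exact ⟨ψ, rfl⟩)
  have hq : ∀ φ, q (Submodule.Quotient.mk φ) = Submodule.Quotient.mk (φ ∘ₗ d.rangeRestrict) :=
    fun φ => rfl
  refine ⟨q ∘ₗ (hK.extToOne A' B).symm.toLinearMap, ?_, ?_⟩
  · suffices hqi : Function.Injective q from hqi.comp (hK.extToOne A' B).symm.injective
    refine (injective_iff_map_eq_zero _).2 fun x hx => ?_
    obtain ⟨φ, rfl⟩ := Submodule.Quotient.mk_surjective _ x
    rw [hq, Submodule.Quotient.mk_eq_zero] at hx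
    obtain ⟨ψ, hψ⟩ := hx
    rw [Submodule.Quotient.mk_eq_zero]
    refine ⟨ψ, LinearMap.ext ?_⟩
    rintro ⟨_, y, rfl⟩
    exact LinearMap.congr_fun hψ y
  · intro φ
    rw [LinearMap.range_comp_of_range_eq_top _ (LinearEquiv.range _)]
    constructor
    · rintro ⟨x, hx⟩ y hy
      obtain ⟨ψ, rfl⟩ := Submodule.Quotient.mk_surjective _ x
      rw [hq, Submodule.Quotient.eq] at hx
      obtain ⟨χ, hχ⟩ := hx
      have h1 := LinearMap.congr_fun hχ y
      have h2 : d.rangeRestrict y = 0 := Subtype.ext hy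
      have h3 : χ (d y) = ψ (d.rangeRestrict y) - φ y := h1
      rw [hy, h2, map_zero, map_zero, zero_sub] at h3
      exact neg_eq_zero.1 h3.symm
    · intro hφ
      let e := d.quotKerEquivRange
      refine ⟨Submodule.Quotient.mk ((Submodule.liftQ _ φ hφ) ∘ₗ e.symm.toLinearMap), ?_⟩
      rw [hq]
      congr 1
      refine LinearMap.ext fun y => ?_
      have : e.symm (d.rangeRestrict y) = Submodule.Quotient.mk y := by
        rw [LinearEquiv.symm_apply_eq]
        rfl
      simp only [LinearMap.comp_apply, LinearEquiv.coe_coe, this]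
      rfl

/-- `Ext^1` of the transpose measures the failure of `Coker d` to be torsionless, and here `Coker d`
embeds in a free module. Concretely, a functional on the image of the dual of `d` is, by
reflexivity, evaluation at some `x`. It kills everything pulled back along `d'`, so `d' x = 0`, and
any preimage of `x` under `d` gives the required extension. -/
theorem subsingleton_ext_one_transpose [SMulCommClass A' A B] {b : B}
    (h : IsRegularBimodule A A' b) {n₂ n₁ n₀ : ℕ}
    (d : (Fin n₂ → A) →ₗ[A] (Fin n₁ → A)) (d' : (Fin n₁ → A) →ₗ[A] (Fin n₀ → A))
    (hd : Function.Exact d d') : Subsingleton (ExtGroup A' (Transpose A' B d) B 1) := by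
  have := h.projective_dual_pi n₂
  have hK := IsShortExact.ker_subtype_mkQ (LinearMap.range (LinearMap.lcomp A' B d))
  refine (hK.extToOne A B).symm.toEquiv.subsingleton_congr.2 ?_
  refine (Submodule.Quotient.subsingleton_iff).2 (eq_top_iff.2 fun θ _ => ?_)
  obtain ⟨x, hx⟩ := h.exists_eval_eq (θ ∘ₗ (LinearMap.lcomp A' B d).rangeRestrict)
  have hx0 : d' x = 0 := h.eq_zero_of_dual_eq_zero _ fun φ => by
    have h1 := hx (φ ∘ₗ d')
    have h2 : (LinearMap.lcomp A' B d).rangeRestrict (φ ∘ₗ d') = 0 :=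
      Subtype.ext (LinearMap.ext fun z => by
        change φ (d' (d z)) = 0
        rw [hd.apply_apply_eq_zero, map_zero])
    rw [LinearMap.comp_apply, h2, map_zero] at h1
    exact h1.symm
  obtain ⟨y, rfl⟩ := (hd x).1 hx0
  refine ⟨LinearMap.applyₗ' A' y |>.comp LinearMap.id, LinearMap.ext ?_⟩
  rintro ⟨_, φ, rfl⟩
  exact (hx φ).symm

end Transpose

/-! ### Left-right symmetry of the strong grade condition -/

section Symmetry

variable {A A' : Type u} [Ring A] [Ring A'] {B : Type u} [AddCommGroup B]
    [Module A B] [Module A' B] {b : B}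

theorem injective_lcomp {S M F B : Type*} [Ring S] [AddCommGroup M] [Module A M] [AddCommGroup F]
    [Module A F] [AddCommGroup B] [Module A B] [Module S B] [SMulCommClass A S B] {f : F →ₗ[A] M}
    (hf : Function.Surjective f) : Function.Injective (LinearMap.lcomp S B f) := fun φ ψ hφ =>
  LinearMap.ext fun m => by
    obtain ⟨x, rfl⟩ := hf m
    exact LinearMap.congr_fun hφ x

theorem exact_lcomp {S K M F B : Type*} [Ring S] [AddCommGroup K] [Module A K] [AddCommGroup M]
    [Module A M] [AddCommGroup F] [Module A F] [AddCommGroup B] [Module A B] [Module S B]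
    [SMulCommClass A S B] {g : K →ₗ[A] F} {f : F →ₗ[A] M}
    (hgf : Function.Exact g f) (hf : Function.Surjective f) :
    Function.Exact (LinearMap.lcomp S B f) (LinearMap.lcomp S B g) := by
  intro φ
  constructor
  · intro hφ
    refine ⟨Submodule.liftQ _ φ ?_ ∘ₗ (f.quotKerEquivOfSurjective hf).symm.toLinearMap,
      LinearMap.ext fun x => ?_⟩
    · intro x hx
      obtain ⟨k, rfl⟩ := (hgf x).1 hx
      exact LinearMap.congr_fun hφ k
    · have : (f.quotKerEquivOfSurjective hf).symm (f x) = Submodule.Quotient.mk x := by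
        rw [LinearEquiv.symm_apply_eq]; rfl
      simp only [LinearMap.lcomp_apply', LinearMap.comp_apply, LinearEquiv.coe_coe, this]
      rfl
  · rintro ⟨ψ, rfl⟩
    refine LinearMap.ext fun k => ?_
    change ψ (f (g k)) = 0
    rw [hgf.apply_apply_eq_zero, map_zero]

theorem subsingleton_ext_of_subsingleton {X Y : Type u} [AddCommGroup X] [Module A X]
    [AddCommGroup Y] [Module A Y] [Subsingleton Y] (n : ℕ) : Subsingleton (ExtGroup A X Y n) := by
  refine subsingleton_of_forall_eq 0 fun x => ?_
  have h : 𝟙 (ModuleCat.of A Y) = 0 := by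
    ext y
    exact Subsingleton.elim (α := Y) _ _
  rw [← Abelian.Ext.comp_mk₀_id x, h, Abelian.Ext.mk₀_zero, Abelian.Ext.comp_zero]

theorem finite_dual [SMulCommClass A A' B] [IsNoetherianRing A'] (h : IsRegularBimodule A A' b)
    (M : Type u) [AddCommGroup M] [Module A M] [Module.Finite A M] :
    Module.Finite A' (M →ₗ[A] B) := by
  obtain ⟨n, f, hf⟩ := Module.Finite.exists_fin' A M
  have := h.finite_dual_pi n
  exact Module.Finite.of_injective (LinearMap.lcomp A' B f) (injective_lcomp hf)

/-- Here `d` is the differential out of degree `p + 1` of a free resolution of `M`. Passing from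
`d'` to the next differential `d`, there are exact sequences `0 → Ext^1(Coker d', B) → Tr d' → im d*
→ 0` and `0 → im d* → F₂* → Tr d → 0`. The first term is `Ext^{p+1}(M, B)`, so its grade bound and
the vanishing already known for `Tr d'` yield the vanishing for `Tr d` one degree higher. -/
theorem exists_transpose [SMulCommClass A A' B] [SMulCommClass A' A B] [IsNoetherianRing A]
    (h : IsRegularBimodule A A' b) (M : Type u) [AddCommGroup M] [Module A M] [Module.Finite A M]
    (p : ℕ) (hM : ∀ q, 1 ≤ q → q ≤ p → ∀ j < q,
      Subsingleton (ExtGroup A' (extToBimodule A A' B (ModuleCat.of A M) q) B j)) :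
    ∃ (n₁ n₀ : ℕ) (d : (Fin n₁ → A) →ₗ[A] (Fin n₀ → A)),
      (∀ k, Nonempty (extToBimodule A A' B (ModuleCat.of A M) (p + k + 1) ≃ₗ[A']
        extToBimodule A A' B (ModuleCat.of A ((Fin n₀ → A) ⧸ LinearMap.range d)) (k + 1))) ∧
      (1 ≤ p → Subsingleton (ExtGroup A' (Transpose A' B d) B p)) := by
  induction p with
  | zero =>
    obtain ⟨n₀, f, hf⟩ := Module.Finite.exists_fin' A M
    obtain ⟨n₁, g, hg⟩ := Module.Finite.exists_fin' A (LinearMap.ker f)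
    refine ⟨n₁, n₀, (LinearMap.ker f).subtype ∘ₗ g, fun k => ?_, fun h0 => absurd h0 (by omega)⟩
    have hr : LinearMap.range ((LinearMap.ker f).subtype ∘ₗ g) = LinearMap.ker f := by
      rw [LinearMap.range_comp, LinearMap.range_eq_top.2 hg, Submodule.map_top,
        Submodule.range_subtype]
    rw [zero_add]
    exact ⟨extToCongr A' B ((f.quotKerEquivOfSurjective hf).symm.trans
      (Submodule.quotEquivOfEq _ _ hr.symm)) (k + 1)⟩
  | succ p ih =>
    obtain ⟨n₁, n₀, d', he, hv⟩ := ih fun q h1 hq => hM q h1 (by omega)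
    obtain ⟨n₂, g, hg⟩ := Module.Finite.exists_fin' A (LinearMap.ker d')
    have hr : LinearMap.range ((LinearMap.ker d').subtype ∘ₗ g) = LinearMap.ker d' := by
      rw [LinearMap.range_comp, LinearMap.range_eq_top.2 hg, Submodule.map_top,
        Submodule.range_subtype]
    have hex : Function.Exact ((LinearMap.ker d').subtype ∘ₗ g) d' :=
      LinearMap.exact_iff.2 hr.symm
    generalize (LinearMap.ker d').subtype ∘ₗ g = d at hr hex
    refine ⟨n₂, n₁, d, fun k => ?_, fun _ => ?_⟩
    · obtain ⟨e⟩ := he (k + 1)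
      rw [show p + 1 + k + 1 = p + (k + 1) + 1 by omega]
      have hK := IsShortExact.ker_subtype_mkQ (LinearMap.range d')
      exact ⟨(e.trans (hK.extToShift A' B k).symm).trans (extToCongr A' B
        (d'.quotKerEquivRange.symm.trans (Submodule.quotEquivOfEq _ _ hr.symm)) (k + 1))⟩
    · rcases p with _ | p
      · exact subsingleton_ext_one_transpose h d d' hex
      have := h.projective_dual_pi n₂
      have hR := IsShortExact.ker_subtype_mkQ (LinearMap.range (LinearMap.lcomp A' B d))
      refine hR.subsingleton_ext_from_right ?_ (subsingleton_ext_of_projective _)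
      obtain ⟨ι, hι, hι'⟩ := exists_extOne_to_transpose A' B d'
      let r : Transpose A' B d' →ₗ[A'] LinearMap.range (LinearMap.lcomp A' B d) :=
        Submodule.liftQ _ (LinearMap.lcomp A' B d).rangeRestrict (by
          rintro _ ⟨ψ, rfl⟩
          refine Subtype.ext (LinearMap.ext fun z => ?_)
          change ψ (d' (d z)) = 0
          rw [hex.apply_apply_eq_zero, map_zero])
      have hS : IsShortExact ι r := by
        refine ⟨hι, fun x => ?_, fun y => ?_⟩
        · obtain ⟨φ, rfl⟩ := Submodule.Quotient.mk_surjective _ x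
          change _ ↔ Submodule.Quotient.mk φ ∈ LinearMap.range ι
          rw [hι']
          constructor
          · intro hφ y hy
            obtain ⟨z, rfl⟩ := (hex y).1 hy
            exact LinearMap.congr_fun (congrArg Subtype.val hφ) z
          · intro hφ
            exact Subtype.ext (LinearMap.ext fun z => hφ _ (hex.apply_apply_eq_zero z))
        · obtain ⟨φ, rfl⟩ := (LinearMap.lcomp A' B d).surjective_rangeRestrict y
          exact ⟨Submodule.Quotient.mk φ, rfl⟩
      refine hS.subsingleton_ext_from_right ?_ (hv (by omega))
      obtain ⟨e⟩ := he 0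
      exact subsingleton_ext_congr_left e.symm (hM (p + 1 + 1) (by omega) le_rfl p (by omega))

theorem subsingleton_ext_dual_pi [SMulCommClass A A' B] {W : Type u} [AddCommGroup W]
    [Module A' W] {j : ℕ} (hW : Subsingleton (ExtGroup A' W B j)) (n : ℕ) :
    Subsingleton (ExtGroup A' W ((Fin n → A) →ₗ[A] B) j) :=
  subsingleton_ext_congr_right ((Pi.basisFun A (Fin n)).constr A').symm (subsingleton_ext_pi n hW)

/-- Dualizing `0 → K → P → Z → 0`, with `P` finite free, gives `0 → Z* → P* → K* → Ext^1(Z, B) → 0`.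
For `m = 0`, the groups `Hom(W, K*)`, `Ext^1(W, P*)` and `Ext^2(W, Z*)` vanish, which forces `Hom(W,
Ext^1(Z, B)) = 0`. For larger `m` the last term is zero, so `K*` inherits the vanishing of `Ext(W,
-)` from `Z*` with one degree lost, and `K` replaces `Z`. -/
theorem hom_to_ext_eq_zero [SMulCommClass A A' B] [IsNoetherianRing A]
    {W : Type u} [AddCommGroup W] [Module A' W] (m : ℕ)
    (hW : ∀ j ≤ m + 1, Subsingleton (ExtGroup A' W B j))
    (Z : Type u) [AddCommGroup Z] [Module A Z] [Module.Finite A Z]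
    (hZ : ∀ j ≤ m + 2, Subsingleton (ExtGroup A' W (Z →ₗ[A] B) j))
    (hZB : ∀ i, 1 ≤ i → i ≤ m → Subsingleton (ExtGroup A Z B i))
    (θ : W →ₗ[A'] extToBimodule A A' B (ModuleCat.of A Z) (m + 1)) : θ = 0 := by
  induction m generalizing Z with
  | zero =>
    obtain ⟨n, f, hf⟩ := Module.Finite.exists_fin' A Z
    have hK := IsShortExact.of_surjective hf
    let K := LinearMap.ker f
    -- Evaluation at each `k` turns a map `W → K*` into a map `W → B`, and these vanish.
    have h1 : Subsingleton (ExtGroup A' W (K →ₗ[A] B) 0) := by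
      rw [subsingleton_ext_zero_iff]
      intro φ
      refine LinearMap.ext fun w => LinearMap.ext fun k => ?_
      exact LinearMap.congr_fun (subsingleton_ext_zero_iff.1 (hW 0 (by omega))
        ((LinearMap.applyₗ' A' k) ∘ₗ φ)) w
    have hG := IsShortExact.ker_subtype_mkQ (LinearMap.range (LinearMap.lcomp A' B K.subtype))
    have hF : IsShortExact (LinearMap.lcomp A' B f)
        (LinearMap.lcomp A' B K.subtype).rangeRestrict := by
      refine ⟨injective_lcomp hf, fun φ => ?_, LinearMap.surjective_rangeRestrict _⟩
      rw [← exact_lcomp hK.exact hf φ]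
      exact Subtype.ext_iff
    have h2 : Subsingleton (ExtGroup A' W (LinearMap.range (LinearMap.lcomp A' B K.subtype)) 1) :=
      hF.subsingleton_ext_right (subsingleton_ext_dual_pi (hW 1 le_rfl) n) (hZ 2 le_rfl)
    have h3 := subsingleton_ext_zero_iff.1 (hG.subsingleton_ext_right h1 h2)
    have h4 := h3 ((hK.extToOne A' B).symm.toLinearMap ∘ₗ θ)
    exact LinearMap.ext fun w => (hK.extToOne A' B).symm.map_eq_zero_iff.1
      (LinearMap.congr_fun h4 w)
  | succ m ih =>
    obtain ⟨n, f, hf⟩ := Module.Finite.exists_fin' A Z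
    have hK := IsShortExact.of_surjective hf
    let K := LinearMap.ker f
    have hs : Function.Surjective (LinearMap.lcomp A' B K.subtype) := by
      have := hZB 1 le_rfl (by omega)
      have h1 := (hK.extToOne A' B).toEquiv.subsingleton_congr.2 this
      rw [Submodule.Quotient.subsingleton_iff] at h1
      exact LinearMap.range_eq_top.1 h1
    have hF : IsShortExact (LinearMap.lcomp A' B f) (LinearMap.lcomp A' B K.subtype) := 
      ⟨injective_lcomp hf, exact_lcomp hK.exact hf, hs⟩
    have h1 := ih (fun j hj => hW j (by omega)) K
      (fun j hj => hF.subsingleton_ext_right (subsingleton_ext_dual_pi (hW j (by omega)) n)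
        (hZ (j + 1) (by omega)))
      (fun i h1 hi => by
        obtain ⟨i, rfl⟩ : ∃ i', i = i' + 1 := ⟨i - 1, by omega⟩
        exact hK.subsingleton_ext_from_left (subsingleton_ext_of_projective _)
          (hZB (i + 2) (by omega) (by omega)))
      ((hK.extToShift A' B m).symm.toLinearMap ∘ₗ θ)
    exact LinearMap.ext fun w => (hK.extToShift A' B m).symm.map_eq_zero_iff.1
      (LinearMap.congr_fun h1 w)

variable (A A' B) in
/-- For every finitely generated `A'`-module `N` and `1 ≤ i ≤ n`, every `A`-submodule of
`Ext^i(N, B)` has grade at least `i` with respect to `B`. -/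
def StrongGradeCondition [SMulCommClass A' A B] (n : ℕ) : Prop :=
  ∀ (N : Type u) [AddCommGroup N] [Module A' N] [Module.Finite A' N] (i : ℕ), 1 ≤ i → i ≤ n →
    ∀ (Y : Type u) [AddCommGroup Y] [Module A Y]
      (ι : Y →ₗ[A] extToBimodule A' A B (ModuleCat.of A' N) i), Function.Injective ι →
      ∀ j < i, Subsingleton (ExtGroup A Y B j)

/-- Strong induction on the degree: once the bound holds in lower degrees, `Ext^m(Y, B)` is the only
group left to kill for a submodule `Y` of `Ext^{m+1}(M, B)`. It embeds in `Ext^{m+1}(Tr d / Y, B)`,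
where the hypothesis on the other side bounds its grade, and this makes its identity map zero. -/
theorem StrongGradeCondition.symm [SMulCommClass A A' B] [SMulCommClass A' A B]
    [IsNoetherianRing A] [IsNoetherianRing A'] (h : IsRegularBimodule A A' b) {n : ℕ}
    (hn : StrongGradeCondition A A' B n) : StrongGradeCondition A' A B n := by
  suffices H : ∀ m < n, ∀ (M : Type u) [AddCommGroup M] [Module A M] [Module.Finite A M]
      (Y : Type u) [AddCommGroup Y] [Module A' Y]
      (ι : Y →ₗ[A'] extToBimodule A A' B (ModuleCat.of A M) (m + 1)), Function.Injective ι →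
      ∀ j < m + 1, Subsingleton (ExtGroup A' Y B j) by
    intro M _ _ _ i h1 hi Y _ _ ι hι j hj
    obtain ⟨m, rfl⟩ : ∃ m, i = m + 1 := ⟨i - 1, by omega⟩
    exact H m (by omega) M Y ι hι j hj
  intro m
  induction m using Nat.strong_induction_on with
  | _ m ih =>
  intro hm M _ _ _ Y _ _ ι hι
  -- For `m > 0`, `Y` is also a submodule of `Ext^m` of the first syzygy of `M`, to which the
  -- inductive hypothesis applies.
  have hlow : ∀ j < m, Subsingleton (ExtGroup A' Y B j) := by
    rcases m with _ | m
    · intro j hj; omega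
    obtain ⟨k, f, hf⟩ := Module.Finite.exists_fin' A M
    have hK := IsShortExact.of_surjective hf
    exact ih m (by omega) (by omega) (LinearMap.ker f) Y
      ((hK.extToShift A' B m).symm.toLinearMap ∘ₗ ι)
      ((hK.extToShift A' B m).symm.injective.comp hι)
  obtain ⟨n₁, n₀, d, he, hv⟩ := exists_transpose h M m (by
    intro q h1 hq
    obtain ⟨q, rfl⟩ : ∃ q', q = q' + 1 := ⟨q - 1, by omega⟩
    exact ih q (by omega) (by omega) M _ LinearMap.id Function.injective_id)
  obtain ⟨e⟩ := he 0
  obtain ⟨κ, hκ, hκ'⟩ := exists_extOne_to_transpose A' B d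
  let μ : Y →ₗ[A'] Transpose A' B d := κ ∘ₗ e.toLinearMap ∘ₗ ι
  have hμ : Function.Injective μ := hκ.comp (e.injective.comp hι)
  have hfin := h.finite_dual_pi n₁
  have hYfin : Module.Finite A' Y := Module.Finite.of_injective μ hμ
  have hV := IsShortExact.of_injective hμ
  have hδ : Function.Injective (hV.connectingTo A B m) := by
    refine hV.connectingTo_injective B m fun x => ?_
    -- For `m = 0`, a map `Tr d → B` is evaluation at some `z` in the kernel of `d`, while `Y` lies
    -- in `Ext^1(Coker d, B)`, whose elements are represented by functionals killing that kernel.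
    -- For `m > 0`, `Ext^m(Tr d, B)` is itself zero.
    rcases m with _ | m
    · obtain ⟨θ, rfl⟩ := (homEquivExtTo A' A B (Transpose A' B d)).surjective x
      rw [homEquivExtTo_apply, Abelian.Ext.mk₀_comp_mk₀, Abelian.Ext.mk₀_eq_zero_iff]
      ext y
      change θ (μ y) = 0
      obtain ⟨z, hz⟩ := h.exists_eval_eq (θ ∘ₗ Submodule.mkQ _)
      have hz0 : d z = 0 := h.eq_zero_of_dual_eq_zero _ fun φ => by
        have h1 := hz (φ ∘ₗ d)
        have h2 : Submodule.mkQ (LinearMap.range (LinearMap.lcomp A' B d)) (φ ∘ₗ d) = 0 :=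
          (Submodule.Quotient.mk_eq_zero _).2 ⟨φ, rfl⟩
        rw [LinearMap.comp_apply, h2, map_zero] at h1
        exact h1.symm
      have hy : μ y ∈ LinearMap.range κ := ⟨_, rfl⟩
      generalize μ y = t at hy
      obtain ⟨φ, rfl⟩ := Submodule.Quotient.mk_surjective _ t
      rw [hκ'] at hy
      exact (hz φ).trans (hy z hz0)
    · have := hv (by omega)
      rw [Subsingleton.elim x 0, Abelian.Ext.comp_zero]
  have hW := hn (Transpose A' B d ⧸ LinearMap.range μ) (m + 1) (by omega) hm _
    (hV.connectingTo A B m) hδ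
  have hzero : Subsingleton (ExtGroup A' Y B m) := by
    suffices hid : (LinearMap.id : extToBimodule A' A B (ModuleCat.of A' Y) m →ₗ[A]
        extToBimodule A' A B (ModuleCat.of A' Y) m) = 0 from
      subsingleton_of_forall_eq (0 : ExtGroup A' Y B m) fun x => LinearMap.congr_fun hid x
    rcases m with _ | m
    -- For `m = 0`, evaluation at `y` is a map from `Hom(Y, B)` to `B`, hence zero by the grade
    -- bound.
    · refine LinearMap.ext fun x => ?_
      obtain ⟨θ, rfl⟩ := (homEquivExtTo A' A B Y).surjective x
      have hθ : θ = 0 := by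
        refine LinearMap.ext fun y => ?_
        exact LinearMap.congr_fun (subsingleton_ext_zero_iff.1 (hW 0 (by omega))
          (LinearMap.applyₗ' A y ∘ₗ (homEquivExtTo A' A B Y).symm.toLinearMap))
          (homEquivExtTo A' A B Y θ) |> fun h5 => by simpa using h5
      rw [hθ, map_zero]
      rfl
    -- Both roles come from `Y`: the source is `Ext^{m+1}(Y, B)` and the resolved module is `Y`,
    -- whose dual is zero because the case `j = 0` is already known.
    · refine hom_to_ext_eq_zero m (fun j hj => hW j (by omega)) Y (fun j _ => ?_)
        (fun i h1 hi => hlow i (by omega)) _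
      have h0 : ∀ φ : Y →ₗ[A'] B, φ = 0 := subsingleton_ext_zero_iff.1 (hlow 0 (by omega))
      have : Subsingleton (Y →ₗ[A'] B) := subsingleton_of_forall_eq 0 h0
      exact subsingleton_ext_of_subsingleton _
  intro j hj
  rcases Nat.lt_succ_iff_lt_or_eq.1 hj with h1 | rfl
  · exact hlow j h1
  · exact hzero

end Symmetry

/-! ### Character modules and flat dimension -/

section CharDual

variable {A A' : Type u} [Ring A] [Ring A']

/-- The character module `Hom_ℤ(M, ℚ/ℤ)` of a left `A`-module, as a module over a ring `A'`
identified with `Aᵐᵒᵖ`. -/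
def CharDual (_ : A' ≃+* Aᵐᵒᵖ) (M : Type u) [AddCommGroup M] : Type u :=
  M →+ AddCircle (1 : ℚ)

namespace CharDual

variable (ρ : A' ≃+* Aᵐᵒᵖ) (M : Type u) [AddCommGroup M]

instance : AddCommGroup (CharDual ρ M) :=
  inferInstanceAs (AddCommGroup (M →+ AddCircle (1 : ℚ)))

variable {ρ M} in
/-- An element of the character module as an additive map. -/
def toHom (c : CharDual ρ M) : M →+ AddCircle (1 : ℚ) := c

variable {ρ M} in
theorem hom_ext {c c' : CharDual ρ M} (h : ∀ m, toHom c m = toHom c' m) : c = c' :=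
  AddMonoidHom.ext h

variable {M}

theorem add_apply (c c' : CharDual ρ M) (m : M) :
    toHom (c + c') m = toHom c m + toHom c' m := rfl

theorem sum_apply {ι : Type*} (s : Finset ι) (c : ι → CharDual ρ M) (m : M) :
    toHom (∑ i ∈ s, c i) m = ∑ i ∈ s, toHom (c i) m :=
  AddMonoidHom.finsetSum_apply c s m

variable [Module A M]

variable (M) in
instance : Module A' (CharDual ρ M) where
  smul a c := (toHom c).comp (DistribSMul.toAddMonoidHom M (unop (ρ a)))
  one_smul c := hom_ext fun m => by
    change toHom c (unop (ρ 1) • m) = toHom c m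
    rw [map_one, unop_one, one_smul]
  mul_smul a a' c := hom_ext fun m => by
    change toHom c (unop (ρ (a * a')) • m) = toHom c (unop (ρ a') • unop (ρ a) • m)
    rw [map_mul, unop_mul, mul_smul]
  smul_zero _ := rfl
  smul_add _ _ _ := rfl
  add_smul a a' c := hom_ext fun m => by
    change toHom c (unop (ρ (a + a')) • m) = toHom c (unop (ρ a) • m) + toHom c (unop (ρ a') • m)
    rw [map_add, MulOpposite.unop_add, add_smul, map_add]
  zero_smul c := hom_ext fun m => by
    change toHom c (unop (ρ 0) • m) = 0
    rw [map_zero, unop_zero, zero_smul, map_zero]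

theorem smul_apply (a : A') (c : CharDual ρ M) (m : M) :
    toHom (a • c) m = toHom c (unop (ρ a) • m) := rfl

variable {N : Type u} [AddCommGroup N] [Module A N]

/-- The map of character modules induced by a linear map. -/
def map (f : M →ₗ[A] N) : CharDual ρ N →ₗ[A'] CharDual ρ M where
  toFun c := (toHom c).comp f.toAddMonoidHom
  map_add' _ _ := rfl
  map_smul' a c := hom_ext fun m => by
    change toHom c (unop (ρ a) • f m) = toHom c (f (unop (ρ a) • m))
    rw [map_smul f]

theorem map_apply (f : M →ₗ[A] N) (c : CharDual ρ N) (m : M) :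
    toHom (map ρ f c) m = toHom c (f m) := rfl

end CharDual

theorem exists_addHom_extension {X Y : Type u} [AddCommGroup X] [AddCommGroup Y] (f : X →+ Y)
    (hf : Function.Injective f) (c : X →+ AddCircle (1 : ℚ)) :
    ∃ c' : Y →+ AddCircle (1 : ℚ), ∀ x, c' (f x) = c x := by
  obtain ⟨c', hc'⟩ := (Module.Baer.of_divisible (AddCircle (1 : ℚ))).extension_property_addMonoidHom
    f hf c
  exact ⟨c', fun x => DFunLike.congr_fun hc' x⟩

theorem exists_character_ne_zero {X : Type u} [AddCommGroup X] {x : X} (hx : x ≠ 0) :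
    ∃ c : X →+ AddCircle (1 : ℚ), c x ≠ 0 :=
  CharacterModule.exists_character_apply_ne_zero_of_ne_zero hx

theorem IsShortExact.charDual (ρ : A' ≃+* Aᵐᵒᵖ) {X Y Z : Type u} [AddCommGroup X] [Module A X]
    [AddCommGroup Y] [Module A Y] [AddCommGroup Z] [Module A Z] {f : X →ₗ[A] Y} {g : Y →ₗ[A] Z}
    (h : IsShortExact f g) : IsShortExact (CharDual.map ρ g) (CharDual.map ρ f) where
  injective c c' hc := CharDual.hom_ext fun z => by
    obtain ⟨y, rfl⟩ := h.surjective z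
    exact congrArg (fun d => CharDual.toHom d y) hc
  exact c := by
    constructor
    · intro hc
      let e := AddMonoidHom.liftOfSurjective g.toAddMonoidHom h.surjective
        ⟨CharDual.toHom c, fun y hy => by
          obtain ⟨x, rfl⟩ := (h.exact y).1 hy
          exact congrArg (fun d => CharDual.toHom d x) hc⟩
      exact ⟨e, CharDual.hom_ext fun y =>
        AddMonoidHom.liftOfRightInverse_comp_apply g.toAddMonoidHom _
          (Function.rightInverse_surjInv h.surjective) _ y⟩
    · rintro ⟨c, rfl⟩
      exact CharDual.hom_ext fun x => by
        rw [CharDual.map_apply, CharDual.map_apply, h.exact.apply_apply_eq_zero, map_zero]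
        rfl
  surjective c := by
    obtain ⟨c', hc'⟩ := exists_addHom_extension f.toAddMonoidHom h.injective (CharDual.toHom c)
    exact ⟨c', CharDual.hom_ext hc'⟩

/-- The character module of a flat module is injective. -/
theorem IsFlatModule.injective_charDual (ρ : A' ≃+* Aᵐᵒᵖ) {M : ModuleCat.{u} A}
    (hM : IsFlatModule M) : Module.Injective A' (CharDual ρ M) := by
  refine ⟨fun X Y _ _ _ _ f hf g => ?_⟩
  let : Module Aᵐᵒᵖ X := Module.compHom X (ρ.symm : Aᵐᵒᵖ →+* A')
  let : Module Aᵐᵒᵖ Y := Module.compHom Y (ρ.symm : Aᵐᵒᵖ →+* A')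
  have hX : ∀ (a : Aᵐᵒᵖ) (x : X), a • x = ρ.symm a • x := fun _ _ => rfl
  have hY : ∀ (a : Aᵐᵒᵖ) (y : Y), a • y = ρ.symm a • y := fun _ _ => rfl
  let f' : X →ₗ[Aᵐᵒᵖ] Y :=
    { toFun := f, map_add' := map_add f, map_smul' := fun a x => map_smul f (ρ.symm a) x }
  let φ : X →+ M →+ AddCircle (1 : ℚ) :=
    { toFun := fun x => CharDual.toHom (g x)
      map_zero' := by rw [map_zero]; rfl
      map_add' := fun x y => by rw [map_add]; rfl }
  obtain ⟨c, hc⟩ := exists_addHom_extension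
    (BalancedTensor.map f' (LinearMap.id : M →ₗ[A] M)) (hM X Y f' hf)
    (BalancedTensor.lift φ fun a x m => by
      change CharDual.toHom (g (ρ.symm (op a) • x)) m = CharDual.toHom (g x) (a • m)
      rw [map_smul, CharDual.smul_apply, RingEquiv.apply_symm_apply, unop_op])
  refine ⟨
    { toFun := fun y => AddMonoidHom.mk' (fun m => c (BalancedTensor.tmul A y m)) fun m m' => by
        rw [BalancedTensor.tmul_add, map_add]
      map_add' := fun y y' => CharDual.hom_ext fun m => by
        change c _ = c _ + c _
        rw [BalancedTensor.add_tmul, map_add]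
      map_smul' := fun a y => CharDual.hom_ext fun m => by
        change c (BalancedTensor.tmul A (a • y) m) = c (BalancedTensor.tmul A y (unop (ρ a) • m))
        rw [← BalancedTensor.op_smul_tmul, hY, op_unop, RingEquiv.symm_apply_apply] },
    fun x => CharDual.hom_ext fun m => hc (BalancedTensor.tmul A x m)⟩

/-- The converse half of Lambek's theorem. A character that does not vanish on a kernel element of
`X ⊗ M → Y ⊗ M` is adjoint to a map `X → M⁺`; an extension of that map to `Y` makes the character
factor through `Y ⊗ M`, a contradiction. -/
theorem isFlatModule_of_injective_charDual (ρ : A' ≃+* Aᵐᵒᵖ) {M : ModuleCat.{u} A}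
    (hM : Module.Injective A' (CharDual ρ M)) : IsFlatModule M := by
  intro X Y _ _ _ _ f hf
  let : Module A' X := Module.compHom X (ρ : A' →+* Aᵐᵒᵖ)
  let : Module A' Y := Module.compHom Y (ρ : A' →+* Aᵐᵒᵖ)
  have hY : ∀ (a : A') (y : Y), a • y = ρ a • y := fun _ _ => rfl
  let f' : X →ₗ[A'] Y :=
    { toFun := f, map_add' := map_add f, map_smul' := fun a x => map_smul f (ρ a) x }
  refine (injective_iff_map_eq_zero _).2 fun z hz => ?_
  by_contra hne
  obtain ⟨c, hc⟩ := exists_character_ne_zero hne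
  let g : X →ₗ[A'] CharDual ρ M :=
    { toFun := fun x => AddMonoidHom.mk' (fun m => c (BalancedTensor.tmul A x m)) fun m m' => by
        rw [BalancedTensor.tmul_add, map_add]
      map_add' := fun y y' => CharDual.hom_ext fun m => by
        change c _ = c _ + c _
        rw [BalancedTensor.add_tmul, map_add]
      map_smul' := fun a y => CharDual.hom_ext fun m => by
        change c (BalancedTensor.tmul A (ρ a • y) m) = c (BalancedTensor.tmul A y (unop (ρ a) • m))
        rw [← BalancedTensor.op_smul_tmul, op_unop] }
  obtain ⟨h, hh⟩ := hM.out f' hf g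
  let φ : Y →+ M →+ AddCircle (1 : ℚ) :=
    { toFun := fun x => CharDual.toHom (h x)
      map_zero' := by rw [map_zero]; rfl
      map_add' := fun x y => by rw [map_add]; rfl }
  let c' : BalancedTensor A Y M →+ AddCircle (1 : ℚ) := BalancedTensor.lift φ fun a y m => by
    change CharDual.toHom (h (op a • y)) m = CharDual.toHom (h y) (a • m)
    have h1 : op a • y = ρ.symm (op a) • y := by rw [hY, RingEquiv.apply_symm_apply]
    rw [h1, map_smul, CharDual.smul_apply, RingEquiv.apply_symm_apply, unop_op]
  have hcc : c'.comp (BalancedTensor.map f LinearMap.id) = c :=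
    BalancedTensor.addHom_ext fun x m => by
      change CharDual.toHom (h (f' x)) m = _
      rw [hh x]
      rfl
  apply hc
  rw [← hcc, AddMonoidHom.comp_apply, hz, map_zero]

/-- The character module of a free module is a product of coinduced modules. A map into it is
determined by the characters `x ↦ g(x)(e_i)`, and these extend because `ℚ/ℤ` is divisible. -/
theorem injective_charDual_finsupp (ρ : A' ≃+* Aᵐᵒᵖ) (s : Type u) :
    Module.Injective A' (CharDual ρ (s →₀ A)) := by
  refine ⟨fun X Y _ _ _ _ f hf g => ?_⟩
  choose h hh using fun i : s => exists_addHom_extension f.toAddMonoidHom hf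
    (AddMonoidHom.mk' (fun x => CharDual.toHom (g x) (Finsupp.single i 1)) fun x y => by
      rw [map_add]; rfl)
  let G : Y → CharDual ρ (s →₀ A) := fun y => Finsupp.liftAddHom fun i =>
    AddMonoidHom.mk' (fun a => h i (ρ.symm (op a) • y)) fun a a' => by
      rw [MulOpposite.op_add, map_add, add_smul, map_add]
  have hG : ∀ y i a, CharDual.toHom (G y) (Finsupp.single i a) = h i (ρ.symm (op a) • y) :=
    fun y i a => by
      refine (Finsupp.liftAddHom_apply_single _ _ _).trans rfl
  have hext : ∀ c c' : CharDual ρ (s →₀ A), (∀ i a, CharDual.toHom c (Finsupp.single i a) =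
      CharDual.toHom c' (Finsupp.single i a)) → c = c' := fun c c' hc =>
    Finsupp.addHom_ext hc
  refine ⟨{ toFun := G, map_add' := fun y y' => ?_, map_smul' := fun a y => ?_ }, fun x => ?_⟩
  · refine hext _ _ fun i a => ?_
    rw [CharDual.add_apply, hG, hG, hG, smul_add, map_add]
  · refine hext _ _ fun i a' => ?_
    rw [RingHom.id_apply, CharDual.smul_apply, Finsupp.smul_single, hG, hG, smul_smul, smul_eq_mul,
      op_mul, map_mul, op_unop, RingEquiv.symm_apply_apply]
  · refine hext _ _ fun i a => ?_
    change CharDual.toHom (G (f x)) _ = _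
    rw [hG, ← map_smul]
    refine (hh i _).trans ?_
    change CharDual.toHom (g (ρ.symm (op a) • x)) _ = _
    rw [map_smul, CharDual.smul_apply, RingEquiv.apply_symm_apply, unop_op, Finsupp.smul_single,
      smul_eq_mul, mul_one]

theorem exists_extension_iff_subsingleton_ext_one {X Y Z W : Type u} [AddCommGroup X] [Module A X]
    [AddCommGroup Y] [Module A Y] [AddCommGroup Z] [Module A Z] [AddCommGroup W] [Module A W]
    [Module.Projective A Y] {f : X →ₗ[A] Y} {g : Y →ₗ[A] Z} (h : IsShortExact f g) :
    Subsingleton (ExtGroup A Z W 1) ↔ ∀ φ : X →ₗ[A] W, ∃ ψ : Y →ₗ[A] W, ψ ∘ₗ f = φ := by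
  constructor
  · intro hZ φ
    obtain ⟨y, hy⟩ := Abelian.Ext.contravariant_sequence_exact₁ h.shortExact _
      (Abelian.Ext.mk₀ (ModuleCat.ofHom φ)) (add_comm 1 0)
      (Subsingleton.elim (α := ExtGroup A Z W 1) _ _)
    obtain ⟨ψ, rfl⟩ := (Abelian.Ext.mk₀_bijective (ModuleCat.of A Y) (ModuleCat.of A W)).2 y
    refine ⟨ψ.hom, ?_⟩
    erw [Abelian.Ext.mk₀_comp_mk₀] at hy
    exact congrArg ModuleCat.Hom.hom
      ((Abelian.Ext.mk₀_bijective (ModuleCat.of A X) (ModuleCat.of A W)).1 hy)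
  · intro hφ
    refine subsingleton_of_forall_eq 0 fun x => ?_
    obtain ⟨y, rfl⟩ := Abelian.Ext.contravariant_sequence_exact₃ h.shortExact _ x
      ((subsingleton_ext_of_projective (X := Y) (Y := W) 0).elim _ _) (add_comm 1 0)
    obtain ⟨φ, rfl⟩ := (Abelian.Ext.mk₀_bijective (ModuleCat.of A X) (ModuleCat.of A W)).2 y
    obtain ⟨ψ, hψ⟩ := hφ φ.hom
    have h1 : φ = ModuleCat.ofHom f ≫ ModuleCat.ofHom ψ := by
      ext1; exact hψ.symm
    rw [h1, ← Abelian.Ext.mk₀_comp_mk₀]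
    exact h.shortExact.extClass_comp_assoc (h := add_comm 1 0) _

/-- Finitely generated test modules suffice by Baer's criterion, which only needs the cyclic modules
`A' ⧸ I`. -/
theorem isFlatModule_iff (ρ : A' ≃+* Aᵐᵒᵖ) {M : ModuleCat.{u} A} :
    IsFlatModule M ↔ ∀ (N : Type u) [AddCommGroup N] [Module A' N] [Module.Finite A' N],
      Subsingleton (ExtGroup A' N (CharDual ρ M) 1) := by
  constructor
  · intro hM N _ _ _
    have := hM.injective_charDual ρ
    exact subsingleton_ext_of_injective 0
  · intro hN
    refine isFlatModule_of_injective_charDual ρ (Module.Baer.injective fun I φ => ?_)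
    obtain ⟨ψ, hψ⟩ := (exists_extension_iff_subsingleton_ext_one
      (IsShortExact.ker_subtype_mkQ I)).1 (hN (A' ⧸ I)) φ
    exact ⟨ψ, fun x hx => LinearMap.congr_fun hψ ⟨x, hx⟩⟩

/-- Characters turn a flat presentation of `M` into an injective copresentation of `M⁺`, so each
syzygy step lowers the Ext degree by one. For the converse, the presentation is the free one on the
underlying set of `M`. -/
theorem flatDimLE_iff (ρ : A' ≃+* Aᵐᵒᵖ) (k : ℕ) (M : ModuleCat.{u} A) :
    FlatDimLE k M ↔ ∀ (N : Type u) [AddCommGroup N] [Module A' N] [Module.Finite A' N],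
      Subsingleton (ExtGroup A' N (CharDual ρ M) (k + 1)) := by
  induction k generalizing M with
  | zero => exact isFlatModule_iff ρ
  | succ k ih =>
    constructor
    · rintro ⟨K, F, f, g, hf, hfg, hg, hF, hK⟩ N _ _ _
      have hS := IsShortExact.charDual ρ (IsShortExact.mk hf hfg hg)
      have := hF.injective_charDual ρ
      exact hS.subsingleton_ext_left (subsingleton_ext_of_injective _) ((ih K).1 hK N)
    · intro hN
      let g : (M →₀ A) →ₗ[A] M := Finsupp.linearCombination A id
      have hg : Function.Surjective g := Finsupp.linearCombination_id_surjective A M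
      have hS := IsShortExact.of_surjective hg
      have hinj := injective_charDual_finsupp ρ (A := A) M
      refine ⟨ModuleCat.of A (LinearMap.ker g), ModuleCat.of A (M →₀ A), _, g, hS.injective,
        hS.exact, hg, isFlatModule_of_injective_charDual ρ hinj, (ih _).2 fun N _ _ _ => ?_⟩
      exact (hS.charDual ρ).subsingleton_ext_right (subsingleton_ext_of_injective _) (hN N)

end CharDual

/-! ### Flat dimension of injective modules -/

section CharDualEval

variable {A A' : Type u} [Ring A] [Ring A'] {B : Type u} [AddCommGroup B]
    [Module A B] [Module A' B] [SMulCommClass A' A B] {b : B}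

namespace IsRegularBimodule

variable (h : IsRegularBimodule A A' b) {K : Type u} [AddCommGroup K] [Module A' K]
  {I : Type u} [AddCommGroup I] [Module A I]

/-- The map `φ ↦ φ(x) y` from `Hom(K, B)` to `I`. -/
def evalSMul (x : K) (y : I) : (K →ₗ[A'] B) →ₗ[A] I :=
  LinearMap.toSpanSingleton A I y ∘ₗ h.leftEquiv.symm.toLinearMap ∘ₗ LinearMap.applyₗ' A x

theorem evalSMul_apply (x : K) (y : I) (φ : K →ₗ[A'] B) :
    h.evalSMul x y φ = h.leftEquiv.symm (φ x) • y := rfl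

/-- The hypothesis `hρ` says that on the generator `b` the action of `A'` agrees with that of `A`
through `ρ`; in coordinates, `A'` then acts on `B` by right multiplication. -/
theorem leftEquiv_symm_smul {ρ : A' ≃+* Aᵐᵒᵖ} (hρ : ∀ a : A', a • b = unop (ρ a) • b) (a : A')
    (c : B) : h.leftEquiv.symm (a • c) = h.leftEquiv.symm c * unop (ρ a) := by
  obtain ⟨x, rfl⟩ := h.leftEquiv.surjective c
  rw [LinearEquiv.symm_apply_apply, LinearEquiv.symm_apply_eq]
  change a • x • b = (x * unop (ρ a)) • b
  rw [smul_comm, hρ, mul_smul]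

variable {ρ : A' ≃+* Aᵐᵒᵖ} (hρ : ∀ a : A', a • b = unop (ρ a) • b)

/-- The natural map from the characters of `Hom_A(Hom_{A'}(K, B), I)` to `Hom_{A'}(K, I⁺)`. -/
def charEval (c : ((K →ₗ[A'] B) →ₗ[A] I) →+ AddCircle (1 : ℚ)) : K →ₗ[A'] CharDual ρ I where
  toFun x := AddMonoidHom.mk' (fun y => c (h.evalSMul x y)) fun y y' => by
    rw [← map_add]
    congr 1
    refine LinearMap.ext fun φ => ?_
    rw [LinearMap.add_apply, evalSMul_apply, evalSMul_apply, evalSMul_apply, smul_add]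
  map_add' x x' := CharDual.hom_ext fun y => by
    change c _ = c _ + c _
    rw [← map_add]
    congr 1
    refine LinearMap.ext fun φ => ?_
    rw [LinearMap.add_apply, evalSMul_apply, evalSMul_apply, evalSMul_apply, map_add, map_add,
      add_smul]
  map_smul' a x := CharDual.hom_ext fun y => by
    change c _ = c _
    congr 1
    refine LinearMap.ext fun φ => ?_
    rw [evalSMul_apply, evalSMul_apply, map_smul, h.leftEquiv_symm_smul hρ, mul_smul]
    rfl

theorem charEval_apply (c : ((K →ₗ[A'] B) →ₗ[A] I) →+ AddCircle (1 : ℚ)) (x : K) (y : I) :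
    CharDual.toHom (h.charEval hρ c x) y = c (h.evalSMul x y) := rfl

/-- The double dual of a map. -/
def bidualHom (I : Type u) [AddCommGroup I] [Module A I] {F : Type u} [AddCommGroup F]
    [Module A' F] (f : F →ₗ[A'] K) : ((F →ₗ[A'] B) →ₗ[A] I) →+ ((K →ₗ[A'] B) →ₗ[A] I) where
  toFun θ := θ ∘ₗ LinearMap.lcomp A B f
  map_zero' := LinearMap.zero_comp _
  map_add' _ _ := LinearMap.add_comp _ _ _

theorem charEval_comp {F : Type u} [AddCommGroup F] [Module A' F] (f : F →ₗ[A'] K)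
    (c : ((K →ₗ[A'] B) →ₗ[A] I) →+ AddCircle (1 : ℚ)) :
    h.charEval hρ c ∘ₗ f = h.charEval hρ (c.comp (bidualHom I f)) := rfl

theorem charEval_pi_injective (n : ℕ) :
    Function.Injective (h.charEval hρ (K := Fin n → A') (I := I)) := by
  intro c c' hc
  ext θ
  -- For a free module, every `θ` is a sum of the maps `evalSMul`, on which `charEval` records the
  -- value of the character.
  have hθ : θ = ∑ i, h.evalSMul (Pi.single i 1) (θ (coord b i)) := by
    refine LinearMap.ext fun φ => ?_
    have hφ : φ = ∑ i, h.leftEquiv.symm (φ (Pi.single i 1)) • coord b i := by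
      refine (Pi.basisFun A' (Fin n)).ext fun j => ?_
      rw [LinearMap.sum_apply, Finset.sum_eq_single j]
      · simp only [Pi.basisFun_apply, LinearMap.smul_apply, coord_apply, Pi.single_eq_same,
          one_smul]
        exact (h.leftEquiv.apply_symm_apply _).symm
      · intro i _ hij
        simp [Pi.single_eq_of_ne hij]
      · simp
    conv_lhs => rw [hφ]
    rw [map_sum, LinearMap.sum_apply]
    exact Finset.sum_congr rfl fun i _ => map_smul _ _ _
  rw [hθ, map_sum, map_sum]
  refine Finset.sum_congr rfl fun i _ => ?_
  rw [← h.charEval_apply hρ, ← h.charEval_apply hρ, hc]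

theorem charEval_pi_surjective (n : ℕ) :
    Function.Surjective (h.charEval hρ (K := Fin n → A') (I := I)) := by
  intro φ
  refine ⟨AddMonoidHom.mk' (fun θ => ∑ i, CharDual.toHom (φ (Pi.single i 1)) (θ (coord b i)))
    fun θ θ' => ?_, ?_⟩
  · rw [← Finset.sum_add_distrib]
    exact Finset.sum_congr rfl fun i _ => by rw [LinearMap.add_apply, map_add]
  · refine LinearMap.ext fun x => CharDual.hom_ext fun y => ?_
    rw [charEval_apply]
    change ∑ i, CharDual.toHom (φ (Pi.single i 1)) (h.evalSMul x y (coord b i)) = _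
    conv_rhs => rw [LinearMap.pi_apply_eq_sum_univ φ x, CharDual.sum_apply]
    refine Finset.sum_congr rfl fun i _ => ?_
    have h1 : (fun j => if i = j then (1 : A') else 0) = Pi.single i 1 := by
      ext j; simp [Pi.single_apply, eq_comm]
    rw [h1, CharDual.smul_apply, evalSMul_apply, coord_apply, h.leftEquiv_symm_smul hρ]
    congr 2
    have h2 : h.leftEquiv.symm b = 1 := by
      rw [LinearEquiv.symm_apply_eq]
      exact (one_smul A b).symm
    rw [h2, one_mul]

theorem bidualHom_surjective [Module.Injective A I] {F : Type u} [AddCommGroup F]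
    [Module A' F] {f : F →ₗ[A'] K} (hf : Function.Surjective f) :
    Function.Surjective (bidualHom (A := A) (B := B) I f) := fun θ => by
  obtain ⟨θ', hθ'⟩ := Module.Injective.out (LinearMap.lcomp A B f) (injective_lcomp hf) θ
  exact ⟨θ', LinearMap.ext hθ'⟩

theorem bidualHom_exact [Module.Injective A I] {F₁ F : Type u} [AddCommGroup F₁] [Module A' F₁]
    [AddCommGroup F] [Module A' F] {d : F₁ →ₗ[A'] F} {f : F →ₗ[A'] K} (hdf : Function.Exact d f)
    (hf : Function.Surjective f) {θ : (F →ₗ[A'] B) →ₗ[A] I} (hθ : bidualHom I f θ = 0) :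
    ∃ θ', bidualHom I d θ' = θ := by
  let e := LinearMap.quotKerEquivRange (LinearMap.lcomp A B d)
  let θ₁ : LinearMap.range (LinearMap.lcomp A B d) →ₗ[A] I :=
    Submodule.liftQ _ θ (fun φ hφ => by
      obtain ⟨ψ, rfl⟩ := (exact_lcomp hdf hf φ).1 hφ
      exact LinearMap.congr_fun hθ ψ) ∘ₗ e.symm.toLinearMap
  obtain ⟨θ', hθ'⟩ := Module.Injective.out (Submodule.subtype _) (Submodule.injective_subtype _) θ₁
  refine ⟨θ', LinearMap.ext fun φ => ?_⟩
  refine (hθ' ((LinearMap.lcomp A B d).rangeRestrict φ)).trans ?_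
  have : e.symm ((LinearMap.lcomp A B d).rangeRestrict φ) = Submodule.Quotient.mk φ := by
    rw [LinearEquiv.symm_apply_eq]; rfl
  simp only [θ₁, LinearMap.comp_apply, LinearEquiv.coe_coe, this]
  rfl

/-- A five-lemma argument on a finite presentation of `K`: the free case is explicit, and both
functors of `K` are left exact, since `I` injective makes the double dual `Hom(Hom(-, B), I)` right
exact before characters are taken. -/
theorem charEval_bijective [IsNoetherianRing A'] [Module.Finite A' K] [Module.Injective A I] :
    Function.Bijective (h.charEval hρ (K := K) (I := I)) := by
  obtain ⟨n₀, f, hf⟩ := Module.Finite.exists_fin' A' K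
  obtain ⟨n₁, g, hg⟩ := Module.Finite.exists_fin' A' (LinearMap.ker f)
  have hex : Function.Exact ((LinearMap.ker f).subtype ∘ₗ g) f := by
    refine LinearMap.exact_iff.2 ?_
    rw [LinearMap.range_comp, LinearMap.range_eq_top.2 hg, Submodule.map_top,
      Submodule.range_subtype]
  generalize (LinearMap.ker f).subtype ∘ₗ g = d at hex
  have hs := bidualHom_surjective (A := A) (B := B) (I := I) hf
  constructor
  · intro c c' hc
    have h1 : c.comp (bidualHom I f) = c'.comp (bidualHom I f) := by
      apply h.charEval_pi_injective hρ n₀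
      rw [← charEval_comp, ← charEval_comp, hc]
    exact (AddMonoidHom.cancel_right hs).1 h1
  · intro φ
    obtain ⟨c₀, hc₀⟩ := h.charEval_pi_surjective hρ n₀ (φ ∘ₗ f)
    have h1 : c₀.comp (bidualHom I d) = 0 := by
      apply h.charEval_pi_injective hρ n₁
      rw [← charEval_comp, hc₀]
      refine LinearMap.ext fun x => CharDual.hom_ext fun y => ?_
      rw [charEval_apply, LinearMap.comp_apply, LinearMap.comp_apply, hex.apply_apply_eq_zero,
        map_zero]
      rfl
    let c := AddMonoidHom.liftOfSurjective (bidualHom I f) hs ⟨c₀, fun θ hθ => by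
      obtain ⟨θ', rfl⟩ := bidualHom_exact hex hf hθ
      exact DFunLike.congr_fun h1 θ'⟩
    have hc : c.comp (bidualHom I f) = c₀ := AddMonoidHom.ext fun θ =>
      AddMonoidHom.liftOfRightInverse_comp_apply (bidualHom I f) _
          (Function.rightInverse_surjInv hs) _ θ
    refine ⟨c, LinearMap.ext fun x => ?_⟩
    obtain ⟨x, rfl⟩ := hf x
    rw [← hc, ← charEval_comp] at hc₀
    exact LinearMap.congr_fun hc₀ x

/-- Through `charEval`, extending maps `K → I⁺` to a free cover of `N` amounts to extending
characters along the double dual of `K → P`. This is always possible exactly when that double dual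
is injective, and its kernel is `Hom(Ext^1(N, B), I)`. Higher degrees follow by passing to syzygies.
-/
theorem subsingleton_ext_charDual_iff (h : IsRegularBimodule A A' b) (hρ : ∀ a : A', a • b = unop (ρ a) • b)
    [IsNoetherianRing A'] [Module.Injective A I] (k : ℕ)
    (N : Type u) [AddCommGroup N] [Module A' N] [Module.Finite A' N] :
    Subsingleton (ExtGroup A' N (CharDual ρ I) (k + 1)) ↔
      ∀ θ : extToBimodule A' A B (ModuleCat.of A' N) (k + 1) →ₗ[A] I, θ = 0 := by
  induction k generalizing N with
  | zero =>
    obtain ⟨n, f, hf⟩ := Module.Finite.exists_fin' A' N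
    have hK := IsShortExact.of_surjective hf
    have hbK := h.charEval_bijective hρ (K := LinearMap.ker f) (I := I)
    have hbP := h.charEval_bijective hρ (K := Fin n → A') (I := I)
    rw [exists_extension_iff_subsingleton_ext_one hK]
    have key : (∀ θ : extToBimodule A' A B (ModuleCat.of A' N) (0 + 1) →ₗ[A] I, θ = 0) ↔
        Function.Injective (bidualHom (A := A) (B := B) I (LinearMap.ker f).subtype) := by
      rw [injective_iff_map_eq_zero]
      constructor
      · intro hθ θ h0
        have h1 := hθ (Submodule.liftQ _ θ (by
          rintro _ ⟨φ, rfl⟩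
          exact LinearMap.congr_fun h0 φ) ∘ₗ (hK.extToOne A B).symm.toLinearMap)
        refine LinearMap.ext fun φ => ?_
        have h2 := LinearMap.congr_fun h1 (hK.extToOne A B (Submodule.Quotient.mk φ))
        rw [LinearMap.comp_apply, LinearEquiv.coe_coe, LinearEquiv.symm_apply_apply] at h2
        exact h2
      · intro hinj θ
        have h1 := hinj (θ ∘ₗ (hK.extToOne A B).toLinearMap ∘ₗ Submodule.mkQ _) (by
          refine LinearMap.ext fun φ => ?_
          have h2 : Submodule.mkQ (LinearMap.range (LinearMap.lcomp A B (LinearMap.ker f).subtype))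
              (LinearMap.lcomp A B (LinearMap.ker f).subtype φ) = 0 :=
            (Submodule.Quotient.mk_eq_zero _).2 ⟨φ, rfl⟩
          change θ (hK.extToOne A B (Submodule.mkQ _ _)) = 0
          rw [h2, map_zero, map_zero])
        refine LinearMap.ext fun x => ?_
        obtain ⟨y, rfl⟩ := (hK.extToOne A B).surjective x
        obtain ⟨φ, rfl⟩ := Submodule.mkQ_surjective _ y
        exact LinearMap.congr_fun h1 φ
    rw [key]
    constructor
    · intro hext
      refine (injective_iff_map_eq_zero _).2 fun θ hθ => ?_
      by_contra hne
      obtain ⟨c, hc⟩ := exists_character_ne_zero hne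
      obtain ⟨ψ, hψ⟩ := hext (h.charEval hρ c)
      obtain ⟨c', rfl⟩ := hbP.2 ψ
      rw [charEval_comp] at hψ
      apply hc
      rw [← hbK.1 hψ, AddMonoidHom.comp_apply, hθ, map_zero]
    · intro hinj φ
      obtain ⟨c, rfl⟩ := hbK.2 φ
      obtain ⟨c', hc'⟩ := exists_addHom_extension _ hinj c
      refine ⟨h.charEval hρ c', ?_⟩
      rw [charEval_comp]
      congr 1
      exact AddMonoidHom.ext hc'
  | succ k ih =>
    obtain ⟨n, f, hf⟩ := Module.Finite.exists_fin' A' N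
    have hK := IsShortExact.of_surjective hf
    have h1 : Subsingleton (ExtGroup A' N (CharDual ρ I) (k + 1 + 1)) ↔
        Subsingleton (ExtGroup A' (LinearMap.ker f) (CharDual ρ I) (k + 1)) :=
      ⟨fun h2 => hK.subsingleton_ext_from_left (subsingleton_ext_of_projective _) h2,
        fun h2 => hK.subsingleton_ext_from_right h2 (subsingleton_ext_of_projective _)⟩
    rw [h1, ih]
    constructor
    · intro h2 θ
      have h3 := h2 (θ ∘ₗ (hK.extToShift A B k).toLinearMap)
      refine LinearMap.ext fun x => ?_
      obtain ⟨y, rfl⟩ := (hK.extToShift A B k).surjective x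
      exact LinearMap.congr_fun h3 y
    · intro h2 θ
      have h3 := h2 (θ ∘ₗ (hK.extToShift A B k).symm.toLinearMap)
      refine LinearMap.ext fun x => ?_
      obtain ⟨y, rfl⟩ := (hK.extToShift A B k).symm.surjective x
      exact LinearMap.congr_fun h3 y

end IsRegularBimodule

end CharDualEval

/-! ### Minimal injective resolutions and strong grade -/

section MinimalInjective

variable {A : Type u} [Ring A] (M : ModuleCat.{u} A)

theorem cosyzygy_isShortExact (k : ℕ) :
    IsShortExact (Z := cosyzygy M (k + 1)) (injectiveEnvelopeMap (cosyzygy M k))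
      (LinearMap.range (injectiveEnvelopeMap (cosyzygy M k))).mkQ :=
  IsShortExact.of_injective (injectiveEnvelopeMap_spec _).injective_map

instance injective_minimalInjectiveTerm (k : ℕ) :
    Module.Injective A (minimalInjectiveTerm M k) :=
  (injectiveEnvelopeMap_spec (cosyzygy M k)).injective_module

/-- Dimension shifting along the resolution: `Ext^p(X, coΩ^q)` is reached from `Hom(X, coΩ^{q+p})`,
and `coΩ^{q+p}` embeds in `I^{q+p}`. Minimality plays no role in this direction. -/
theorem subsingleton_ext_cosyzygy {X : Type u} [AddCommGroup X] [Module A X] (p q : ℕ)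
    (hX : ∀ θ : X →ₗ[A] minimalInjectiveTerm M (q + p), θ = 0) :
    Subsingleton (ExtGroup A X (cosyzygy M q) p) := by
  induction p generalizing q with
  | zero =>
    rw [subsingleton_ext_zero_iff]
    intro f
    have h1 := hX (injectiveEnvelopeMap (cosyzygy M q) ∘ₗ f)
    refine LinearMap.ext fun x => (cosyzygy_isShortExact M q).injective ?_
    rw [LinearMap.zero_apply, map_zero]
    exact LinearMap.congr_fun h1 x
  | succ p ih =>
    refine (cosyzygy_isShortExact M q).subsingleton_ext_left ?_ (ih (q + 1) ?_)
    · have := (injectiveEnvelopeMap_spec (cosyzygy M q)).injective_module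
      exact subsingleton_ext_of_injective p
    · rwa [show q + 1 + p = q + (p + 1) by omega]

/-- This is where minimality enters. On the preimage `X'` of `coΩ^j` under `θ`, dimension shifting
from `Ext^j(X', M) = 0` gives `Hom(X', coΩ^j) = 0`; the only obstructions are maps to earlier terms
`I^q`, excluded by induction. So the image of `θ` meets `coΩ^j` trivially, and essentiality gives `θ
= 0`. The hypothesis must cover all submodules because `X'` is not known in advance. -/
theorem hom_minimalInjectiveTerm_eq_zero {L : Type u} [AddCommGroup L] [Module A L] {i : ℕ}
    (hL : ∀ (X : Type u) [AddCommGroup X] [Module A X] (ι : X →ₗ[A] L), Function.Injective ι →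
      ∀ j < i, Subsingleton (ExtGroup A X M j))
    (j : ℕ) (hj : j < i) (X : Type u) [AddCommGroup X] [Module A X] (ι : X →ₗ[A] L)
    (hι : Function.Injective ι) (θ : X →ₗ[A] minimalInjectiveTerm M j) : θ = 0 := by
  induction j using Nat.strong_induction_on generalizing X with
  | _ j ih =>
  let X' : Submodule A X :=
    Submodule.comap θ (LinearMap.range (injectiveEnvelopeMap (cosyzygy M j)))
  have hι' : Function.Injective (ι ∘ₗ X'.subtype) := hι.comp X'.injective_subtype
  have key : ∀ q p, p + q = j → Subsingleton (ExtGroup A X' (cosyzygy M q) p) := by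
    intro q
    induction q with
    | zero =>
      rintro p rfl
      exact hL X' (ι ∘ₗ X'.subtype) hι' _ hj
    | succ q ihq =>
      intro p hpq
      refine (cosyzygy_isShortExact M q).subsingleton_ext_right ?_ (ihq (p + 1) (by omega))
      rcases p with _ | p
      · exact subsingleton_ext_zero_iff.2 (ih q (by omega) (by omega) X' _ hι')
      · have := (injectiveEnvelopeMap_spec (cosyzygy M q)).injective_module
        exact subsingleton_ext_of_injective p
  have h0 := subsingleton_ext_zero_iff.1 (key j 0 (zero_add j))
  have hinj := (injectiveEnvelopeMap_spec (cosyzygy M j)).injective_map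
  let e := LinearEquiv.ofInjective _ hinj
  have h1 := h0 (e.symm.toLinearMap ∘ₗ LinearMap.codRestrict _ (θ ∘ₗ X'.subtype) fun x => x.2)
  have h2 : ∀ x : X, x ∈ X' → θ x = 0 := fun x hx => by
    have h3 := e.symm.map_eq_zero_iff.1 (LinearMap.congr_fun h1 ⟨x, hx⟩)
    exact congrArg Subtype.val h3
  have h4 := (injectiveEnvelopeMap_spec (cosyzygy M j)).essential (LinearMap.range θ) (by
    rw [Submodule.eq_bot_iff]
    rintro _ ⟨⟨x, rfl⟩, hx⟩
    exact h2 x hx)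
  exact LinearMap.range_eq_bot.1 h4

end MinimalInjective

section AuslanderGorenstein

variable {A A' : Type u} [Ring A] [Ring A'] {B : Type u} [AddCommGroup B]
    [Module A B] [Module A' B] [SMulCommClass A' A B] {b : B}

theorem subsingleton_ext_of_le [IsNoetherianRing A] {Y : Type u} [AddCommGroup Y] [Module A Y]
    {k : ℕ} (hY : ∀ (N : Type u) [AddCommGroup N] [Module A N] [Module.Finite A N],
      Subsingleton (ExtGroup A N Y (k + 1))) (l : ℕ) (hl : k ≤ l)
    (N : Type u) [AddCommGroup N] [Module A N] [Module.Finite A N] :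
    Subsingleton (ExtGroup A N Y (l + 1)) := by
  induction l, hl using Nat.le_induction generalizing N with
  | base => exact hY N
  | succ l _ ih =>
    obtain ⟨n, f, hf⟩ := Module.Finite.exists_fin' A N
    exact (IsShortExact.of_surjective hf).subsingleton_ext_from_right (ih _)
      (subsingleton_ext_of_projective _)

/-- Both sides say that the modules `Ext^i(N, B)` and their submodules have no nonzero maps to
`I^j(A)` for `j < i`. Forward, injectivity of `I^j(A)` extends a map from a submodule to all of
`Ext^i(N, B)`. -/
theorem isAuslanderGorenstein_iff [IsNoetherianRing A'] (h : IsRegularBimodule A A' b)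
    {ρ : A' ≃+* Aᵐᵒᵖ} (hρ : ∀ a : A', a • b = unop (ρ a) • b) (n : ℕ) :
    IsAuslanderGorenstein A n ↔ StrongGradeCondition A A' B n := by
  constructor
  · intro hA N _ _ _ i h1 hi Y _ _ ι hι j hj
    refine subsingleton_ext_congr_right h.leftEquiv.symm ?_
    refine subsingleton_ext_cosyzygy (ModuleCat.of A A) j 0 ?_
    rw [zero_add]
    intro θ
    obtain ⟨θ', hθ'⟩ := Module.Injective.out ι hι θ
    obtain ⟨i, rfl⟩ : ∃ i', i = i' + 1 := ⟨i - 1, by omega⟩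
    -- Flat dimension at most `j` gives vanishing in degree `j + 1`, and hence in degree `i + 1`
    -- because `j ≤ i`.
    have h2 := (h.subsingleton_ext_charDual_iff hρ i N).1
      (subsingleton_ext_of_le ((flatDimLE_iff ρ j _).1 (hA j (by omega))) i (by omega) N) θ'
    refine LinearMap.ext fun y => ?_
    rw [← hθ' y, h2]
    rfl
  · intro hS i hi
    rw [flatDimLE_iff ρ]
    intro N _ _ _
    rw [h.subsingleton_ext_charDual_iff hρ]
    intro θ
    -- Strong grade at least `i + 1` is needed to reach the term of index `i`.
    refine hom_minimalInjectiveTerm_eq_zero (ModuleCat.of A A) (i := i + 1) ?_ i (by omega) _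
      LinearMap.id Function.injective_id θ
    intro X _ _ ι hι j hj
    exact subsingleton_ext_congr_right h.leftEquiv (hS N (i + 1) (by omega) hi X ι hι j hj)

end AuslanderGorenstein

/-! ### Matlis duality over a commutative artinian ring -/

section Matlis

variable (R : Type u) [CommRing R]

/-- The embedding of `R / J(R)` into its injective envelope. -/
abbrev matlisMap : (R ⧸ Ring.jacobson R) →ₗ[R] matlisModule R :=
  injectiveEnvelopeMap (ModuleCat.of R (R ⧸ Ring.jacobson R))

theorem matlisMap_isInjectiveEnvelope : IsInjectiveEnvelope (matlisMap R) :=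
  injectiveEnvelopeMap_spec (ModuleCat.of R (R ⧸ Ring.jacobson R))

instance matlisModule_injective : Module.Injective R (matlisModule R) :=
  (matlisMap_isInjectiveEnvelope R).injective_module

variable {R}

theorem mem_ringJacobson_iff {a : R} :
    a ∈ Ring.jacobson R ↔ ∀ m : Ideal R, m.IsMaximal → a ∈ m := by
  rw [Ring.jacobson, Module.jacobson, Submodule.mem_sInf]
  exact ⟨fun h m hm => h m hm.out, fun h m hm => h m ⟨hm⟩⟩

theorem matlisMap_mk_eq_zero_iff {a : R} :
    matlisMap R (Submodule.Quotient.mk a) = 0 ↔ a ∈ Ring.jacobson R := by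
  rw [map_eq_zero_iff _ (matlisMap_isInjectiveEnvelope R).injective_map,
    Submodule.Quotient.mk_eq_zero]

/-- There are finitely many maximal ideals. The product of those other than `m` is not contained in
`m`, and any witness `a` works; its class spans a copy of `R ⧸ m` inside `R ⧸ J(R)`. -/
theorem exists_mul_mem_ringJacobson [IsArtinianRing R] (m : Ideal R) [hm : m.IsMaximal] :
    ∃ a ∉ m, ∀ r ∈ m, r * a ∈ Ring.jacobson R := by
  classical
  let s : Finset (Ideal R) := (IsArtinianRing.setOfPred_isMaximal_finite R).toFinset.erase m
  have hs : ¬ s.prod id ≤ m := by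
    rw [hm.isPrime.prod_le]
    rintro ⟨I, hI, hIm⟩
    have hI' := Finset.mem_erase.1 hI
    have hImax : I.IsMaximal := by simpa using hI'.2
    exact hI'.1 (hImax.eq_of_le hm.ne_top hIm)
  obtain ⟨a, ha, ham⟩ := SetLike.not_le_iff_exists.1 hs
  refine ⟨a, ham, fun r hr => mem_ringJacobson_iff.2 fun p hp => ?_⟩
  by_cases hpm : p = m
  · subst hpm
    exact p.mul_mem_right _ hr
  · refine p.mul_mem_left _ (Ideal.le_of_dvd (Finset.dvd_prod_of_mem id ?_) ha)
    exact Finset.mem_erase.2 ⟨hpm, by simpa using hp⟩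

variable {M : Type u} [AddCommGroup M] [Module R M]

/-- The cyclic module on `x` surjects onto some `R ⧸ m`, which sits inside `R ⧸ J(R)` and so inside
the injective envelope; injectivity extends this map to `M`. -/
theorem exists_matlis_apply_ne_zero [IsArtinianRing R] {x : M} (hx : x ≠ 0) :
    ∃ f : M →ₗ[R] matlisModule R, f x ≠ 0 := by
  have hI : LinearMap.ker (LinearMap.toSpanSingleton R M x) ≠ ⊤ := by
    intro h
    have : (1 : R) ∈ LinearMap.ker (LinearMap.toSpanSingleton R M x) := h ▸ Submodule.mem_top
    exact hx (by simpa using this)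
  obtain ⟨m, hm, hIm⟩ := Ideal.exists_le_maximal _ hI
  obtain ⟨a, ha, ham⟩ := exists_mul_mem_ringJacobson m
  let e := matlisMap R (Submodule.Quotient.mk a)
  have he : e ≠ 0 := fun h => ha (mem_ringJacobson_iff.1 (matlisMap_mk_eq_zero_iff.1 h) m hm)
  have hle : LinearMap.ker (LinearMap.toSpanSingleton R M x) ≤
      LinearMap.ker (LinearMap.toSpanSingleton R (matlisModule R) e) := by
    intro r hr
    change r • matlisMap R (Submodule.Quotient.mk a) = 0
    rw [← map_smul, ← Submodule.Quotient.mk_smul]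
    exact matlisMap_mk_eq_zero_iff.2 (ham r (hIm hr))
  obtain ⟨f, hf⟩ := (matlisModule_injective R).out
    (Submodule.liftQ _ (LinearMap.toSpanSingleton R M x) le_rfl)
    (LinearMap.ker_eq_bot.1 (Submodule.ker_liftQ_eq_bot _ _ _ le_rfl))
    (Submodule.liftQ _ (LinearMap.toSpanSingleton R (matlisModule R) e) hle)
  refine ⟨f, ?_⟩
  have := hf (Submodule.Quotient.mk 1)
  rw [Submodule.liftQ_apply, Submodule.liftQ_apply, LinearMap.toSpanSingleton_apply, one_smul,
    LinearMap.toSpanSingleton_apply, one_smul] at this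
  rwa [this]

/-- By essentiality some multiple `r z ≠ 0` lies in `R ⧸ J(R)`. Then `r ∉ m`, so `r` acts invertibly
on `z` and `z` itself lies there. -/
theorem exists_matlisMap_eq {m : Ideal R} [hm : m.IsMaximal] {z : matlisModule R}
    (hz : ∀ r ∈ m, r • z = 0) : ∃ a : R, matlisMap R (Submodule.Quotient.mk a) = z := by
  by_cases h0 : z = 0
  · exact ⟨0, by rw [h0]; exact map_zero _⟩
  have h : Submodule.span R {z} ⊓ LinearMap.range (matlisMap R) ≠ ⊥ := fun h =>
    h0 (Submodule.span_singleton_eq_bot.1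
      ((matlisMap_isInjectiveEnvelope R).essential _ h))
  obtain ⟨y, ⟨hy, q, hq⟩, hy0⟩ := Submodule.exists_mem_ne_zero_of_ne_bot h
  obtain ⟨r, rfl⟩ := Submodule.mem_span_singleton.1 hy
  obtain ⟨b, rfl⟩ := Submodule.Quotient.mk_surjective _ q
  have hr : r ∉ m := fun hr => hy0 (hz r hr)
  obtain ⟨c, d, hd, hcd⟩ := hm.exists_inv hr
  refine ⟨c * b, ?_⟩
  have h1 : (Submodule.Quotient.mk (c * b) : R ⧸ Ring.jacobson R) =
    c • Submodule.Quotient.mk b := rfl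
  rw [h1, map_smul]
  refine (congrArg (c • ·) hq).trans ?_
  rw [smul_smul, ← add_zero ((c * r) • z), ← hz d hd, ← add_smul, hcd, one_smul]

/-- A simple module is `R ⧸ m`, and the values of `f` and `g` at a generator lie in the `m`-torsion
of `R ⧸ J(R)`, which is one-dimensional over `R ⧸ m`. -/
theorem IsSimpleModule.exists_smul_eq_matlis {S : Type u} [AddCommGroup S] [Module R S]
    [IsSimpleModule R S] {f : S →ₗ[R] matlisModule R} (hf : f ≠ 0) (g : S →ₗ[R] matlisModule R) :
    ∃ r : R, r • f = g := by
  obtain ⟨s, hs⟩ : ∃ s, f s ≠ 0 := by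
    by_contra! h
    exact hf (LinearMap.ext h)
  have hs0 : s ≠ 0 := fun h => hs (by rw [h, map_zero])
  have hgen : Function.Surjective (LinearMap.toSpanSingleton R S s) :=
    IsSimpleModule.toSpanSingleton_surjective R hs0
  let m : Ideal R := LinearMap.ker (LinearMap.toSpanSingleton R S s)
  have hm : m.IsMaximal := IsSimpleModule.ker_toSpanSingleton_isMaximal R hs0
  have hms : ∀ r ∈ m, r • s = 0 := fun r hr => hr
  obtain ⟨a, ha⟩ := exists_matlisMap_eq (m := m) (z := f s)
    fun r hr => by rw [← map_smul, hms r hr, map_zero]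
  obtain ⟨b, hb⟩ := exists_matlisMap_eq (m := m) (z := g s)
    fun r hr => by rw [← map_smul, hms r hr, map_zero]
  have key : ∀ (c : R) (h : S →ₗ[R] matlisModule R) (r : R), r ∈ m →
      matlisMap R (Submodule.Quotient.mk c) = h s → r * c ∈ Ring.jacobson R := by
    intro c h r hr hc
    rw [← matlisMap_mk_eq_zero_iff, ← smul_eq_mul, Submodule.Quotient.mk_smul, map_smul]
    refine (congrArg (r • ·) hc).trans ?_
    rw [← map_smul, hms r hr, map_zero]
  -- If `a ∈ m` then `a * a` lies in every maximal ideal, hence so does `a`, and `f s` would be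
  -- zero.
  have ham : a ∉ m := by
    intro h
    refine hs ?_
    rw [← ha, matlisMap_mk_eq_zero_iff, mem_ringJacobson_iff]
    intro p hp
    have := mem_ringJacobson_iff.1 (key a f a h ha) p hp
    exact (hp.isPrime.mem_or_mem this).elim id id
  obtain ⟨c, d, hd, hcd⟩ := hm.exists_inv ham
  have hbs : (c * b) • f s = g s := by
    rw [← ha, ← hb]
    refine (map_smul (matlisMap R) _ _).symm.trans ?_
    rw [← sub_eq_zero, ← map_sub, ← Submodule.Quotient.mk_smul, ← Submodule.Quotient.mk_sub,
      matlisMap_mk_eq_zero_iff]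
    -- With `c a + d = 1`, the error term is a multiple of `d * b`, which lies in `J(R)` because `d
    -- ∈ m`.
    have : (c * b) • a - b = -(d * b) := by
      have : d = 1 - c * a := by rw [← hcd]; ring
      rw [this, smul_eq_mul]; ring
    rw [this]
    exact neg_mem (key b g d hd hb)
  refine ⟨c * b, LinearMap.ext fun t => ?_⟩
  obtain ⟨q, rfl⟩ := hgen t
  rw [LinearMap.smul_apply, LinearMap.toSpanSingleton_apply, map_smul, map_smul, smul_comm, hbs]

theorem length_matlisDual_le_of_isSimpleModule {S : Type u} [AddCommGroup S] [Module R S]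
    [IsSimpleModule R S] : Module.length R (S →ₗ[R] matlisModule R) ≤ 1 := by
  rcases subsingleton_or_nontrivial (S →ₗ[R] matlisModule R) with h | h
  · rw [Module.length_eq_zero]
    exact zero_le
  · have : IsSimpleModule R (S →ₗ[R] matlisModule R) :=
      isSimpleModule_iff_toSpanSingleton_surjective.2
        ⟨h, fun f hf g => IsSimpleModule.exists_smul_eq_matlis hf g⟩
    rw [Module.length_eq_one]

/-- Induction along a composition series, as the Matlis dual is exact and the dual of a simple
module has length at most one. -/
theorem IsFiniteLength.length_matlisDual_le (h : IsFiniteLength R M) :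
    Module.length R (M →ₗ[R] matlisModule R) ≤ Module.length R M := by
  induction h with
  | of_subsingleton =>
    rw [Module.length_eq_zero]
    exact zero_le
  | @of_simple_quotient M _ _ N _ _ ih =>
    rw [Module.length_eq_add_of_exact N.subtype N.mkQ N.injective_subtype N.mkQ_surjective
      (LinearMap.exact_iff.2 (by simp)),
      Module.length_eq_add_of_exact (LinearMap.lcomp R (matlisModule R) N.mkQ)
        (LinearMap.lcomp R (matlisModule R) N.subtype)
        (fun f g h => LinearMap.ext fun q => by
          obtain ⟨x, rfl⟩ := N.mkQ_surjective q
          exact LinearMap.congr_fun h x)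
        (fun f => by
          obtain ⟨g, hg⟩ := (matlisModule_injective R).out N.subtype N.injective_subtype f
          exact ⟨g, LinearMap.ext hg⟩)
        (fun f => ⟨fun hf => ⟨N.liftQ f fun x hx => LinearMap.congr_fun hf ⟨x, hx⟩,
          LinearMap.ext fun x => rfl⟩, by
            rintro ⟨g, rfl⟩
            ext x
            exact (congrArg g ((Submodule.Quotient.mk_eq_zero N).2 x.2)).trans (map_zero g)⟩),
      add_comm]
    refine add_le_add ih (length_matlisDual_le_of_isSimpleModule.trans ?_)
    rw [Module.length_eq_one]

variable (R M) in
/-- The evaluation map of `M` into its double Matlis dual. -/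
def matlisBidual : M →ₗ[R] ((M →ₗ[R] matlisModule R) →ₗ[R] matlisModule R) :=
  LinearMap.applyₗ

theorem isFiniteLength_of_finite [IsArtinianRing R] [Module.Finite R M] : IsFiniteLength R M :=
  isFiniteLength_iff_isNoetherian_isArtinian.2 ⟨inferInstance, inferInstance⟩

theorem finite_matlisDual [IsArtinianRing R] [Module.Finite R M] :
    Module.Finite R (M →ₗ[R] matlisModule R) := by
  have h := isFiniteLength_of_finite (R := R) (M := M)
  have h' : IsFiniteLength R (M →ₗ[R] matlisModule R) := Module.length_ne_top_iff.1
    (ne_top_of_le_ne_top (Module.length_ne_top_iff.2 h) h.length_matlisDual_le)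
  have := (isFiniteLength_iff_isNoetherian_isArtinian.1 h').1
  infer_instance

/-- Injectivity is the cogenerator property. Surjectivity is a count: dualizing twice does not
increase the length, so a proper embedded copy of `M` is impossible. -/
theorem matlisBidual_bijective [IsArtinianRing R] [Module.Finite R M] :
    Function.Bijective (matlisBidual R M) := by
  have hinj : Function.Injective (matlisBidual R M) := by
    refine (injective_iff_map_eq_zero _).2 fun x hx => ?_
    by_contra h
    obtain ⟨f, hf⟩ := exists_matlis_apply_ne_zero (R := R) h
    exact hf (LinearMap.congr_fun hx f)
  refine ⟨hinj, ?_⟩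
  have : Module.Finite R (M →ₗ[R] matlisModule R) := finite_matlisDual
  have : Module.Finite R ((M →ₗ[R] matlisModule R) →ₗ[R] matlisModule R) := finite_matlisDual
  rw [← LinearMap.range_eq_top]
  by_contra h
  have h1 := Submodule.length_lt h
  rw [← (LinearEquiv.ofInjective _ hinj).length_eq] at h1
  exact absurd h1 (not_lt.2 (isFiniteLength_of_finite.length_matlisDual_le.trans
    isFiniteLength_of_finite.length_matlisDual_le))

end Matlis

/-! ### Bimodules inducing a duality -/

section Duality

/-- The evaluation map `M → Hom_{A'}(Hom_A(M, W), W)`, for a bimodule `W`. -/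
def dualEval (A A' W : Type u) [Ring A] [Ring A'] [AddCommGroup W] [Module A W] [Module A' W]
    [SMulCommClass A A' W] [SMulCommClass A' A W] (M : Type u) [AddCommGroup M] [Module A M] :
    M →ₗ[A] ((M →ₗ[A] W) →ₗ[A'] W) where
  toFun x :=
    { toFun := fun φ => φ x
      map_add' := fun _ _ => rfl
      map_smul' := fun _ _ => rfl }
  map_add' x y := LinearMap.ext fun φ => map_add φ x y
  map_smul' a x := LinearMap.ext fun φ => map_smul φ a x

/-- `W` is an injective cogenerator over `A`, and `Hom_A(-, W)` takes finitely generated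
`A`-modules to finitely generated `A'`-modules and makes them reflexive. -/
structure InducesDuality (A A' W : Type u) [Ring A] [Ring A'] [AddCommGroup W] [Module A W]
    [Module A' W] [SMulCommClass A A' W] [SMulCommClass A' A W] : Prop where
  injective : Module.Injective A W
  exists_ne_zero : ∀ {M : Type u} [AddCommGroup M] [Module A M] {x : M}, x ≠ 0 →
    ∃ f : M →ₗ[A] W, f x ≠ 0
  finite : ∀ (M : Type u) [AddCommGroup M] [Module A M] [Module.Finite A M],
    Module.Finite A' (M →ₗ[A] W)
  reflexive : ∀ (M : Type u) [AddCommGroup M] [Module A M] [Module.Finite A M],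
    Function.Bijective (dualEval A A' W M)

section Coinduced

variable {R A W E : Type u} [CommRing R] [Ring A] [Algebra R A]
  [AddCommGroup W] [Module A W] [Module R W] [IsScalarTower R A W]
  [AddCommGroup E] [Module R E] (τ : W →ₗ[R] E)

variable (A) in
/-- The map `W → Hom_R(A, E)` which corresponds to an `R`-linear map `τ : W → E`. -/
def toCoinduced (w : W) : A →ₗ[R] E :=
  τ ∘ₗ (LinearMap.toSpanSingleton A W w).restrictScalars R

variable {τ}

variable {M : Type u} [AddCommGroup M] [Module A M] [Module R M] [IsScalarTower R A M]

variable (A τ M) in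
/-- The map `Hom_A(M, W) → Hom_R(M, E)` given by composition with `τ : W → E`. -/
def homCoinduced : (M →ₗ[A] W) →ₗ[R] (M →ₗ[R] E) where
  toFun φ := τ ∘ₗ φ.restrictScalars R
  map_add' φ ψ := LinearMap.ext fun x => map_add τ (φ x) (ψ x)
  map_smul' r φ := LinearMap.ext fun x => map_smul τ r (φ x)

/-- The hypothesis `hτ` identifies `W` with the coinduced module `Hom_R(A, E)`, and this is the
adjunction between restriction and coinduction. -/
theorem homCoinduced_bijective (hτ : Function.Bijective (toCoinduced A τ)) :
    Function.Bijective (homCoinduced A τ M) := by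
  constructor
  · intro φ ψ h
    refine LinearMap.ext fun x => hτ.1 (LinearMap.ext fun a => ?_)
    have := LinearMap.congr_fun h (a • x)
    change τ (φ (a • x)) = τ (ψ (a • x)) at this
    rwa [map_smul φ, map_smul ψ] at this
  · intro f
    choose w hw using fun x : M =>
      hτ.2 (f ∘ₗ (LinearMap.toSpanSingleton A M x).restrictScalars R)
    have hw' : ∀ x (a : A), τ (a • w x) = f (a • x) := fun x a => LinearMap.congr_fun (hw x) a
    refine ⟨{ toFun := w, map_add' := fun x y => ?_, map_smul' := fun a x => ?_ }, ?_⟩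
    · refine hτ.1 (LinearMap.ext fun a => ?_)
      change τ (a • w (x + y)) = τ (a • (w x + w y))
      rw [hw', smul_add, smul_add, map_add, map_add, hw', hw']
    · refine hτ.1 (LinearMap.ext fun b => ?_)
      change τ (b • w (a • x)) = τ (b • a • w x)
      rw [hw', smul_smul, smul_smul, hw']
    · refine LinearMap.ext fun x => ?_
      have := hw' x 1
      rwa [one_smul, one_smul] at this

/-- The action of `R` on a module over an `R`-algebra. -/
theorem exists_isScalarTower (R A M : Type u) [CommRing R] [Ring A] [Algebra R A]
    [AddCommGroup M] [Module A M] : ∃ _ : Module R M, IsScalarTower R A M :=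
  letI := Module.compHom M (algebraMap R A)
  ⟨inferInstance, ⟨fun r a x => by
    rw [Algebra.smul_def, mul_smul]
    rfl⟩⟩

theorem injective_of_coinduced (hE : Module.Injective R E)
    (hτ : Function.Bijective (toCoinduced A τ)) : Module.Injective A W := by
  refine ⟨fun X Y _ _ _ _ f hf k => ?_⟩
  obtain ⟨_, _⟩ := exists_isScalarTower R A X
  obtain ⟨_, _⟩ := exists_isScalarTower R A Y
  obtain ⟨g, hg⟩ := hE.out (f.restrictScalars R) hf (homCoinduced A τ X k)
  obtain ⟨g, rfl⟩ := (homCoinduced_bijective hτ).2 g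
  exact ⟨g, LinearMap.congr_fun ((homCoinduced_bijective hτ).1 (a₁ := g ∘ₗ f)
    (LinearMap.ext hg))⟩

end Coinduced

theorem inducesDuality_of_coinduced {R A A' W : Type u} [CommRing R] [IsArtinianRing R]
    [Ring A] [Algebra R A] [Module.Finite R A] [Ring A'] [Algebra R A']
    [AddCommGroup W] [Module A W] [Module A' W] [Module R W] [IsScalarTower R A W]
    [IsScalarTower R A' W] [SMulCommClass A A' W] [SMulCommClass A' A W]
    (τ : W →ₗ[R] matlisModule R) (hτ : Function.Bijective (toCoinduced A τ))
    (hτ' : Function.Bijective (toCoinduced A' τ)) : InducesDuality A A' W where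
  injective := injective_of_coinduced (matlisModule_injective R) hτ
  exists_ne_zero {M} _ _ x hx := by
    obtain ⟨_, _⟩ := exists_isScalarTower R A M
    obtain ⟨f, hf⟩ := exists_matlis_apply_ne_zero (R := R) hx
    obtain ⟨g, rfl⟩ := (homCoinduced_bijective hτ).2 f
    exact ⟨g, fun h => hf ((congrArg τ h).trans (map_zero τ))⟩
  finite M _ _ _ := by
    obtain ⟨_, _⟩ := exists_isScalarTower R A M
    have : Module.Finite R M := Module.Finite.trans A M
    have : Module.Finite R (M →ₗ[R] matlisModule R) := finite_matlisDual
    have : Module.Finite R (M →ₗ[A] W) := Module.Finite.equiv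
      (LinearEquiv.ofBijective _ (homCoinduced_bijective (M := M) hτ)).symm
    exact Module.Finite.of_restrictScalars_finite R A' _
  reflexive M _ _ _ := by
    obtain ⟨_, _⟩ := exists_isScalarTower R A M
    have : Module.Finite R M := Module.Finite.trans A M
    let e := LinearEquiv.ofBijective _ (homCoinduced_bijective (M := M) hτ)
    have h1 : Function.Bijective (LinearMap.lcomp R (matlisModule R) e.symm.toLinearMap) :=
      (LinearEquiv.congrLeft (matlisModule R) R e).bijective
    have h2 : Function.Bijective (homCoinduced A' τ (M →ₗ[A] W)) := homCoinduced_bijective hτ'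
    -- Both duals are Matlis duals over `R` through the same `τ`, so `dualEval` is the Matlis
    -- evaluation up to two bijections.
    have h3 : ⇑(matlisBidual R M) = LinearMap.lcomp R (matlisModule R) e.symm.toLinearMap ∘
        homCoinduced A' τ (M →ₗ[A] W) ∘ dualEval A A' W M := by
      funext x
      refine LinearMap.ext fun f => ?_
      obtain ⟨φ, rfl⟩ := e.surjective f
      change e φ x = τ (e.symm (e φ) x)
      rw [e.symm_apply_apply]
      rfl
    have h4 := matlisBidual_bijective (R := R) (M := M)
    rw [h3] at h4
    exact (Function.Bijective.of_comp_iff' h2 _).1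
      ((Function.Bijective.of_comp_iff' h1 _).1 h4)

namespace MatlisDual

variable (R Λ : Type u) [CommRing R] [Ring Λ] [Algebra R Λ]

instance moduleBase : Module R (MatlisDual R Λ) :=
  inferInstanceAs (Module R (Λ →ₗ[R] matlisModule R))

instance isScalarTower : IsScalarTower R Λ (MatlisDual R Λ) where
  smul_assoc r a f := LinearMap.ext fun x => by
    change toLinearMap f (x * r • a) = r • toLinearMap f (x * a)
    rw [mul_smul_comm, map_smul]

instance isScalarTower_op : IsScalarTower R Λᵐᵒᵖ (MatlisDual R Λ) where
  smul_assoc r a f := LinearMap.ext fun x => by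
    change toLinearMap f (r • unop a * x) = r • toLinearMap f (unop a * x)
    rw [smul_mul_assoc, map_smul]

/-- The evaluation at `1`. -/
def evalOne : MatlisDual R Λ →ₗ[R] matlisModule R :=
  LinearMap.applyₗ (1 : Λ)

theorem toCoinduced_bijective : Function.Bijective (toCoinduced Λ (evalOne R Λ)) := by
  have h : ∀ (f : MatlisDual R Λ) (a : Λ), toCoinduced Λ (evalOne R Λ) f a = toLinearMap f a :=
    fun f a => congrArg (toLinearMap f) (one_mul a)
  refine ⟨fun f g hfg => LinearMap.ext fun a => ?_, fun f => ⟨f, LinearMap.ext fun a => h f a⟩⟩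
  exact (h f a).symm.trans ((LinearMap.congr_fun hfg a).trans (h g a))

theorem toCoinduced_op_bijective : Function.Bijective (toCoinduced Λᵐᵒᵖ (evalOne R Λ)) := by
  have h : ∀ (f : MatlisDual R Λ) (a : Λ),
      toCoinduced Λᵐᵒᵖ (evalOne R Λ) f (op a) = toLinearMap f a :=
    fun f a => congrArg (toLinearMap f) (mul_one a)
  refine ⟨fun f g hfg => LinearMap.ext fun a => ?_, fun f =>
    ⟨f ∘ₗ (opLinearEquiv R).toLinearMap, LinearMap.ext fun a => h _ (unop a)⟩⟩
  exact (h f a).symm.trans ((LinearMap.congr_fun hfg (op a)).trans (h g a))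

instance smulCommClass_op : SMulCommClass Λᵐᵒᵖ Λ (MatlisDual R Λ) := SMulCommClass.symm _ _ _

variable [IsArtinianRing R] [Module.Finite R Λ]

theorem inducesDuality : InducesDuality Λ Λᵐᵒᵖ (MatlisDual R Λ) :=
  inducesDuality_of_coinduced (evalOne R Λ) (toCoinduced_bijective R Λ)
    (toCoinduced_op_bijective R Λ)

theorem inducesDuality_op : InducesDuality Λᵐᵒᵖ Λ (MatlisDual R Λ) :=
  inducesDuality_of_coinduced (evalOne R Λ) (toCoinduced_op_bijective R Λ)
    (toCoinduced_bijective R Λ)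

end MatlisDual

namespace InducesDuality

variable {A A' W : Type u} [Ring A] [Ring A'] [AddCommGroup W] [Module A W] [Module A' W]
  [SMulCommClass A A' W] [SMulCommClass A' A W]

theorem subsingleton_iff (h : InducesDuality A A' W) {M : Type u} [AddCommGroup M] [Module A M] :
    Subsingleton (M →ₗ[A] W) ↔ Subsingleton M := by
  constructor
  · intro hM
    refine subsingleton_of_forall_eq 0 fun x => ?_
    by_contra hx
    obtain ⟨f, hf⟩ := h.exists_ne_zero hx
    exact hf (by rw [Subsingleton.elim f 0, LinearMap.zero_apply])
  · intro hM
    infer_instance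

theorem isShortExact_dual (h : InducesDuality A A' W) {X Y Z : Type u} [AddCommGroup X]
    [Module A X] [AddCommGroup Y] [Module A Y] [AddCommGroup Z] [Module A Z]
    {f : X →ₗ[A] Y} {g : Y →ₗ[A] Z} (hfg : IsShortExact f g) :
    IsShortExact (LinearMap.lcomp A' W g) (LinearMap.lcomp A' W f) where
  injective := injective_lcomp hfg.surjective
  exact := exact_lcomp hfg.exact hfg.surjective
  surjective φ := by
    obtain ⟨ψ, hψ⟩ := h.injective.out f hfg.injective φ
    exact ⟨ψ, LinearMap.ext hψ⟩

/-- The dual of a submodule is a quotient of the dual. -/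
theorem exists_quotient_equiv (h : InducesDuality A A' W) {M : Type u} [AddCommGroup M]
    [Module A M] (X : Submodule A M) :
    ∃ K : Submodule A' (M →ₗ[A] W), Nonempty (((M →ₗ[A] W) ⧸ K) ≃ₗ[A'] (X →ₗ[A] W)) :=
  ⟨_, ⟨LinearMap.quotKerEquivOfSurjective _
    (h.isShortExact_dual (IsShortExact.ker_subtype_mkQ X)).surjective⟩⟩

/-- Every quotient of the dual of a finitely generated module is the dual of a submodule. -/
theorem exists_submodule_equiv (h : InducesDuality A A' W) (h' : InducesDuality A' A W)
    {M : Type u} [AddCommGroup M] [Module A M] [Module.Finite A M]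
    (K : Submodule A' (M →ₗ[A] W)) :
    ∃ X : Submodule A M, Nonempty (((M →ₗ[A] W) ⧸ K) ≃ₗ[A'] (X →ₗ[A] W)) := by
  let X : Submodule A M :=
    { carrier := {x | ∀ φ ∈ K, φ x = 0}
      add_mem' := fun hx hy φ hφ => by rw [map_add, hx φ hφ, hy φ hφ, add_zero]
      zero_mem' := fun φ _ => map_zero φ
      smul_mem' := fun a x hx φ hφ => by rw [map_smul, hx φ hφ, smul_zero] }
  -- The double annihilator of `K` is `K`: a functional separating `φ` from `K` is, by reflexivity,
  -- evaluation at an element of `X`.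
  have hK : K = LinearMap.ker (LinearMap.lcomp A' W X.subtype) := by
    refine le_antisymm (fun φ hφ => LinearMap.ext fun x => x.2 φ hφ) fun φ hφ => ?_
    by_contra hn
    obtain ⟨θ, hθ⟩ := h'.exists_ne_zero (x := K.mkQ φ) (by simpa using hn)
    obtain ⟨x, hx⟩ := (h.reflexive M).2 (θ ∘ₗ K.mkQ)
    have hxX : x ∈ X := fun ψ hψ => (LinearMap.congr_fun hx ψ).trans
      ((congrArg θ ((Submodule.Quotient.mk_eq_zero K).2 hψ)).trans (map_zero θ))
    exact hθ ((LinearMap.congr_fun hx φ).symm.trans (LinearMap.congr_fun hφ ⟨x, hxX⟩))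
  exact ⟨X, ⟨(Submodule.quotEquivOfEq _ _ hK).trans (LinearMap.quotKerEquivOfSurjective _
    (h.isShortExact_dual (IsShortExact.ker_subtype_mkQ X)).surjective)⟩⟩

end InducesDuality

end Duality

/-! ### Ext groups of dual modules -/

theorem isRegularBimodule_one (Λ : Type u) [Ring Λ] : IsRegularBimodule Λ Λᵐᵒᵖ (1 : Λ) where
  left := by
    have : (fun a : Λ => a • (1 : Λ)) = id := funext fun a => mul_one a
    rw [this]
    exact Function.bijective_id
  right := by
    have : (fun a : Λᵐᵒᵖ => a • (1 : Λ)) = unop := funext fun a => one_mul (unop a)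
    rw [this]
    exact unop_bijective

namespace InducesDuality

variable {Λ W : Type u} [Ring Λ] [AddCommGroup W] [Module Λ W] [Module Λᵐᵒᵖ W]
  [SMulCommClass Λ Λᵐᵒᵖ W] [SMulCommClass Λᵐᵒᵖ Λ W]

/-- The dual of `Λᵐᵒᵖ` is `W`, so an endomorphism of `W` is an element of the double dual of `Λᵐᵒᵖ`,
and reflexivity makes it an action of a ring element. Together with `eq_of_op_smul_eq` this
identifies `End_Λ(W)` with `Λ` acting on the right. -/
theorem exists_op_smul_eq (h' : InducesDuality Λᵐᵒᵖ Λ W) (φ : W →ₗ[Λ] W) :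
    ∃ a : Λ, ∀ w, φ w = op a • w := by
  obtain ⟨c, hc⟩ := (h'.reflexive Λᵐᵒᵖ).2
    (φ ∘ₗ dualEval Λᵐᵒᵖ Λ W Λᵐᵒᵖ 1)
  refine ⟨unop c, fun w => ?_⟩
  have := LinearMap.congr_fun hc (LinearMap.toSpanSingleton Λᵐᵒᵖ W w)
  change c • w = φ ((1 : Λᵐᵒᵖ) • w) at this
  rw [one_smul] at this
  exact this.symm

theorem eq_of_op_smul_eq (h' : InducesDuality Λᵐᵒᵖ Λ W) {a b : Λ}
    (hab : ∀ w : W, op a • w = op b • w) : a = b := by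
  refine op_injective ((h'.reflexive Λᵐᵒᵖ).1 (LinearMap.ext fun ψ => ?_))
  have h1 : ∀ c : Λᵐᵒᵖ, ψ c = c • ψ 1 := fun c => by rw [← map_smul, smul_eq_mul, mul_one]
  exact (h1 _).trans ((hab _).trans (h1 _).symm)

section ExtDual

variable (N : Type u) [AddCommGroup N] [Module Λᵐᵒᵖ N]

variable (W) in
/-- The map `Hom_{Λᵒᵖ}(N, Λ) → Hom_Λ(W, Hom_{Λᵒᵖ}(N, W))`, `ν ↦ (w ↦ (x ↦ w ν(x)))`. -/
def homToHomDual :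
    letI := homFromModule Λ Λ W (N →ₗ[Λᵐᵒᵖ] W)
    (N →ₗ[Λᵐᵒᵖ] Λ) →ₗ[Λ] (W →ₗ[Λ] (N →ₗ[Λᵐᵒᵖ] W)) :=
  letI := homFromModule Λ Λ W (N →ₗ[Λᵐᵒᵖ] W)
  { toFun := fun ν =>
      { toFun := fun w =>
          { toFun := fun x => op (ν x) • w
            map_add' := fun x y => by rw [map_add, MulOpposite.op_add, add_smul]
            map_smul' := fun a x => by
              rw [map_smul, RingHom.id_apply, smul_smul]
              rfl }
        map_add' := fun w w' => LinearMap.ext fun x => smul_add _ _ _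
        map_smul' := fun a w => LinearMap.ext fun x => smul_comm _ _ _ }
    map_add' := fun ν ν' => LinearMap.ext fun w => LinearMap.ext fun x => add_smul _ _ _
    map_smul' := fun a ν => LinearMap.ext fun w => LinearMap.ext fun x =>
      mul_smul (op (ν x)) (op a) w }

/-- Exchanging the arguments, a map `W → Hom(N, W)` is a family of endomorphisms of `W` indexed by
`N`, that is, a map `N → Λ`. -/
theorem homToHomDual_bijective (h' : InducesDuality Λᵐᵒᵖ Λ W) :
    Function.Bijective (homToHomDual (Λ := Λ) W N) := by
  constructor
  · intro ν ν' hν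
    refine LinearMap.ext fun x => h'.eq_of_op_smul_eq fun w => ?_
    exact LinearMap.congr_fun (LinearMap.congr_fun hν w) x
  · intro ψ
    have hν : ∀ x : N, ∃ a : Λ, ∀ w, ψ w x = op a • w := fun x =>
      h'.exists_op_smul_eq (dualEval Λᵐᵒᵖ Λ W N x ∘ₗ ψ)
    choose ν hν using hν
    refine ⟨{ toFun := ν, map_add' := fun x y => ?_, map_smul' := fun a x => ?_ },
      LinearMap.ext fun w => LinearMap.ext fun x => (hν x w).symm⟩
    · refine h'.eq_of_op_smul_eq fun w => ?_
      rw [← hν, map_add, hν, hν, MulOpposite.op_add, add_smul]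
    · refine h'.eq_of_op_smul_eq fun w => ?_
      rw [← hν, map_smul, hν, smul_smul]
      rfl

variable {N}

theorem injective_dual_pi (h : InducesDuality Λ Λᵐᵒᵖ W) (n : ℕ) :
    Module.Injective Λ ((Fin n → Λᵐᵒᵖ) →ₗ[Λᵐᵒᵖ] W) := by
  have := h.injective
  let e : (Fin n → W) ≃ₗ[Λ] ((Fin n → Λᵐᵒᵖ) →ₗ[Λᵐᵒᵖ] W) := (Pi.basisFun Λᵐᵒᵖ (Fin n)).constr Λ
  refine ⟨fun X Y _ _ _ _ f hf k => ?_⟩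
  obtain ⟨g, hg⟩ := Module.Injective.out f hf (e.symm.toLinearMap ∘ₗ k)
  exact ⟨e.toLinearMap ∘ₗ g, fun x => (congrArg e (hg x)).trans (e.apply_symm_apply _)⟩

/-- Both groups are the cokernel of `Hom(P, Λ) → Hom(K, Λ)`: one since `P` is projective, the other
since its dual is injective, with `homToHomDual` matching the two Hom groups. -/
theorem nonempty_extFrom_one_equiv (h' : InducesDuality Λᵐᵒᵖ Λ W)
    {K P : Type u} [AddCommGroup K] [Module Λᵐᵒᵖ K] [AddCommGroup P] [Module Λᵐᵒᵖ P]
    [Module.Projective Λᵐᵒᵖ P] [Module.Injective Λ (P →ₗ[Λᵐᵒᵖ] W)]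
    {f : K →ₗ[Λᵐᵒᵖ] P} {g : P →ₗ[Λᵐᵒᵖ] N} (hfg : IsShortExact f g) :
    Nonempty (extFromBimodule Λ Λ W (ModuleCat.of Λ (N →ₗ[Λᵐᵒᵖ] W)) 1 ≃ₗ[Λ]
      extToBimodule Λᵐᵒᵖ Λ Λ (ModuleCat.of Λᵐᵒᵖ N) 1) := by
  let _ := homFromModule Λ Λ W (K →ₗ[Λᵐᵒᵖ] W)
  have hd := h'.isShortExact_dual hfg
  let δ : (K →ₗ[Λᵐᵒᵖ] Λ) →ₗ[Λ]
      extFromBimodule Λ Λ W (ModuleCat.of Λ (N →ₗ[Λᵐᵒᵖ] W)) 1 :=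
    hd.connectingFrom Λ W 0 ∘ₗ (homEquivExtFrom Λ Λ W (K →ₗ[Λᵐᵒᵖ] W)).toLinearMap ∘ₗ
      homToHomDual W K
  have hδ : Function.Surjective δ :=
    (hd.connectingFrom_surjective W 0 (subsingleton_ext_of_injective 0)).comp
      ((homEquivExtFrom Λ Λ W (K →ₗ[Λᵐᵒᵖ] W)).surjective.comp (homToHomDual_bijective K h').2)
  have hker : LinearMap.range (LinearMap.lcomp Λ Λ f) = LinearMap.ker δ := by
    ext ν
    rw [LinearMap.mem_ker]
    change _ ↔ hd.connectingFrom Λ W 0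
      (homEquivExtFrom Λ Λ W (K →ₗ[Λᵐᵒᵖ] W) (homToHomDual W K ν)) = 0
    rw [hd.connectingFrom_zero_eq_zero_iff W]
    constructor
    · rintro ⟨μ, rfl⟩
      exact ⟨homToHomDual W P μ, rfl⟩
    · rintro ⟨ψ, hψ⟩
      obtain ⟨μ, rfl⟩ := (homToHomDual_bijective P h').2 ψ
      exact ⟨μ, (homToHomDual_bijective K h').1 hψ⟩
  exact ⟨(LinearMap.quotKerEquivOfSurjective δ hδ).symm.trans
    ((Submodule.quotEquivOfEq _ _ hker.symm).trans (hfg.extToOne Λ Λ))⟩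

/-- `Ext^i_Λ(W, Hom_{Λᵒᵖ}(N, W)) ≅ Ext^i_{Λᵒᵖ}(N, Λ)` for finitely generated `N`. -/
theorem nonempty_extFrom_equiv [IsNoetherianRing Λᵐᵒᵖ] (h : InducesDuality Λ Λᵐᵒᵖ W)
    (h' : InducesDuality Λᵐᵒᵖ Λ W) (i : ℕ) : ∀ (N : Type u) [AddCommGroup N] [Module Λᵐᵒᵖ N]
    [Module.Finite Λᵐᵒᵖ N],
    Nonempty (extFromBimodule Λ Λ W (ModuleCat.of Λ (N →ₗ[Λᵐᵒᵖ] W)) i ≃ₗ[Λ]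
      extToBimodule Λᵐᵒᵖ Λ Λ (ModuleCat.of Λᵐᵒᵖ N) i) := by
  induction i with
  | zero =>
    intro N _ _ _
    let _ := homFromModule Λ Λ W (N →ₗ[Λᵐᵒᵖ] W)
    exact ⟨(homEquivExtFrom Λ Λ W (N →ₗ[Λᵐᵒᵖ] W)).symm.trans
      ((LinearEquiv.ofBijective _ (homToHomDual_bijective N h')).symm.trans
        (homEquivExtTo Λᵐᵒᵖ Λ Λ N))⟩
  | succ i ih =>
    intro N _ _ _
    obtain ⟨n, g, hg⟩ := Module.Finite.exists_fin' Λᵐᵒᵖ N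
    have := h.injective_dual_pi n
    have hfg := IsShortExact.of_surjective hg
    rcases i with - | i
    · exact nonempty_extFrom_one_equiv h' hfg
    · obtain ⟨e⟩ := ih (LinearMap.ker g)
      exact ⟨((h'.isShortExact_dual hfg).extFromShift Λ W i).symm.trans
        (e.trans (hfg.extToShift Λ Λ i))⟩

theorem subsingleton_ext_dual_iff [IsNoetherianRing Λᵐᵒᵖ] (h : InducesDuality Λ Λᵐᵒᵖ W)
    (h' : InducesDuality Λᵐᵒᵖ Λ W) (i : ℕ) [Module.Finite Λᵐᵒᵖ N] :
    Subsingleton (ExtGroup Λ W (N →ₗ[Λᵐᵒᵖ] W) i) ↔ Subsingleton (ExtGroup Λᵐᵒᵖ N Λ i) :=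
  (h.nonempty_extFrom_equiv h' i N).some.toEquiv.subsingleton_congr

end ExtDual

end InducesDuality

/-! ### Tensor products of dual modules -/

theorem BalancedTensor.linearMap_ext {S : Type v} {A X M : Type u} {Z : Type*} [Ring S] [Ring A] [AddCommGroup X]
    [Module S X] [Module Aᵐᵒᵖ X] [SMulCommClass S Aᵐᵒᵖ X] [AddCommGroup M] [Module A M]
    [AddCommGroup Z] [Module S Z] {f g : BalancedTensor A X M →ₗ[S] Z}
    (hfg : ∀ w x, f (BalancedTensor.tmul A w x) = g (BalancedTensor.tmul A w x)) : f = g :=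
  LinearMap.ext fun z => DFunLike.congr_fun
    (BalancedTensor.addHom_ext (f := f.toAddMonoidHom) (g := g.toAddMonoidHom) hfg) z

namespace InducesDuality

variable {Λ W : Type u} [Ring Λ] [AddCommGroup W] [Module Λ W] [Module Λᵐᵒᵖ W]
  [SMulCommClass Λ Λᵐᵒᵖ W] [SMulCommClass Λᵐᵒᵖ Λ W]

section TensorDual

variable (M : Type u) [AddCommGroup M] [Module Λ M]

variable (Λ W) in
/-- The map `W ⊗_Λ M → Hom_{Λᵒᵖ}(Hom_Λ(M, Λ), W)`, `w ⊗ x ↦ (φ ↦ w φ(x))`. -/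
def tensorToDual : BalancedTensor Λ W M →ₗ[Λ] ((M →ₗ[Λ] Λ) →ₗ[Λᵐᵒᵖ] W) :=
  let F : BalancedTensor Λ W M →+ ((M →ₗ[Λ] Λ) →ₗ[Λᵐᵒᵖ] W) :=
    BalancedTensor.lift
      (AddMonoidHom.mk' (fun w => AddMonoidHom.mk' (fun x =>
          ({ toFun := fun φ => op (φ x) • w
             map_add' := fun φ ψ => by rw [LinearMap.add_apply, MulOpposite.op_add, add_smul]
             map_smul' := fun a φ => by
               rw [RingHom.id_apply, smul_smul]
               rfl } : (M →ₗ[Λ] Λ) →ₗ[Λᵐᵒᵖ] W))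
        fun x y => LinearMap.ext fun φ => by
          change op (φ (x + y)) • w = op (φ x) • w + op (φ y) • w
          rw [map_add, MulOpposite.op_add, add_smul])
        fun w w' => AddMonoidHom.ext fun x => LinearMap.ext fun φ => smul_add _ _ _)
      fun a w x => LinearMap.ext fun φ => by
        change op (φ x) • op a • w = op (φ (a • x)) • w
        rw [map_smul, smul_smul]
        rfl
  { F with
    map_smul' := fun a z => by
      change F (a • z) = a • F z
      induction z using BalancedTensor.tmul_induction with
      | zero => rw [smul_zero, map_zero, smul_zero]
      | tmul w x =>
        exact LinearMap.ext fun φ => smul_comm (op (φ x)) a w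
      | add z z' hz hz' => rw [smul_add, map_add, hz, hz', map_add, smul_add] }

variable {M}

/-- The cogenerator `W` detects both kernel and cokernel. A map `W ⊗ M → W` is a family of
endomorphisms of `W`, hence comes from some `φ : M → Λ` and factors through `tensorToDual`. A
functional vanishing on the image is evaluation at some `φ` by reflexivity, and it kills every `w
φ(x)`, so `φ = 0`. -/
theorem tensorToDual_bijective [IsNoetherianRing Λᵐᵒᵖ] (h : InducesDuality Λ Λᵐᵒᵖ W)
    (h' : InducesDuality Λᵐᵒᵖ Λ W) [Module.Finite Λ M] :
    Function.Bijective (tensorToDual Λ W M) := by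
  constructor
  · refine (injective_iff_map_eq_zero _).2 fun z hz => ?_
    by_contra hz0
    obtain ⟨χ, hχ⟩ := h.exists_ne_zero hz0
    have hφ : ∀ x : M, ∃ a : Λ, ∀ w, χ (BalancedTensor.tmul Λ w x) = op a • w := fun x =>
      h'.exists_op_smul_eq
        { toFun := fun w => χ (BalancedTensor.tmul Λ w x)
          map_add' := fun w w' => by rw [BalancedTensor.add_tmul, map_add]
          map_smul' := fun a w => by
            rw [← BalancedTensor.smul_tmul, map_smul, RingHom.id_apply] }
    choose φ hφ using hφ
    let φ' : M →ₗ[Λ] Λ :=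
      { toFun := φ
        map_add' := fun x y => h'.eq_of_op_smul_eq fun w => by
          rw [← hφ, BalancedTensor.tmul_add, map_add, hφ, hφ, MulOpposite.op_add, add_smul]
        map_smul' := fun a x => h'.eq_of_op_smul_eq fun w => by
          rw [← hφ, ← BalancedTensor.op_smul_tmul, hφ, smul_smul]
          rfl }
    have hχφ : χ = dualEval Λᵐᵒᵖ Λ W (M →ₗ[Λ] Λ) φ' ∘ₗ tensorToDual Λ W M :=
      BalancedTensor.linearMap_ext fun w x => hφ x w
    refine hχ ?_
    rw [hχφ, LinearMap.comp_apply, hz, map_zero]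
  · rw [← LinearMap.range_eq_top]
    by_contra hne
    obtain ⟨y, -, hy⟩ := SetLike.exists_of_lt (lt_top_iff_ne_top.2 hne)
    obtain ⟨θ, hθ⟩ := h.exists_ne_zero (x := (LinearMap.range (tensorToDual Λ W M)).mkQ y)
      (by simpa using hy)
    -- Reflexivity is available only for finitely generated modules.
    have : Module.Finite Λᵐᵒᵖ (M →ₗ[Λ] Λ) := finite_dual (isRegularBimodule_one Λ) M
    obtain ⟨φ, hφ⟩ := (h'.reflexive (M →ₗ[Λ] Λ)).2
      (θ ∘ₗ (LinearMap.range (tensorToDual Λ W M)).mkQ)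
    have h0 : φ = 0 := LinearMap.ext fun x => h'.eq_of_op_smul_eq fun w => by
      have := LinearMap.congr_fun hφ (tensorToDual Λ W M (BalancedTensor.tmul Λ w x))
      refine this.trans ?_
      rw [LinearMap.comp_apply, LinearMap.zero_apply, op_zero, zero_smul]
      exact (congrArg θ ((Submodule.Quotient.mk_eq_zero _).2 ⟨_, rfl⟩)).trans (map_zero θ)
    rw [h0, map_zero] at hφ
    exact hθ (LinearMap.congr_fun hφ y).symm

end TensorDual

end InducesDuality

/-! ### Dimension shifting for left derived functors -/

section Splice

variable {C : Type*} [Category C] [Abelian C] {S : ShortComplex C}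

/-- The augmentation `Q₀ → X` of a projective resolution. -/
def resolutionAugmentation {X : C} (Q : ProjectiveResolution X) : Q.complex.X 0 ⟶ X := Q.π.f 0

theorem d_comp_resolutionAugmentation {X : C} (Q : ProjectiveResolution X) :
    Q.complex.d 1 0 ≫ resolutionAugmentation Q = 0 := Q.complex_d_comp_π_f_zero

theorem d_comp_resolutionAugmentation_comp {X Y : C} (Q : ProjectiveResolution X) (f : X ⟶ Y) :
    Q.complex.d 1 0 ≫ resolutionAugmentation Q ≫ f = 0 := by
  rw [← Category.assoc, d_comp_resolutionAugmentation, Limits.zero_comp]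

instance epi_resolutionAugmentation {X : C} (Q : ProjectiveResolution X) :
    Epi (resolutionAugmentation Q) := inferInstanceAs (Epi (Q.π.f 0))

theorem exact_resolutionAugmentation {X : C} (Q : ProjectiveResolution X) :
    (ShortComplex.mk _ _ (d_comp_resolutionAugmentation Q)).Exact := Q.exact₀

/-- The complex obtained by splicing a projective resolution of `X₁` with an exact sequence
`0 → X₁ → X₂ → X₃ → 0`. -/
abbrev spliceComplex (S : ShortComplex C) (Q : ProjectiveResolution S.X₁) : ChainComplex C ℕ :=
  Q.complex.augment (X := S.X₂) (resolutionAugmentation Q ≫ S.f)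
    (d_comp_resolutionAugmentation_comp Q S.f)

/-- Only the junction differs from `Q`: there the augmentation is followed by the monomorphism
`S.f`, which does not change the kernel. -/
theorem spliceComplex_exactAt_succ (hS : S.ShortExact) (Q : ProjectiveResolution S.X₁) (n : ℕ) :
    (spliceComplex S Q).ExactAt (n + 1) := by
  rw [HomologicalComplex.exactAt_iff' _ (n + 1 + 1) (n + 1) n (by simp) (by simp)]
  match n with
  | 0 =>
    have := hS.mono_f
    let α : ShortComplex.mk _ _ (d_comp_resolutionAugmentation Q) ⟶
        (spliceComplex S Q).sc' (0 + 1 + 1) (0 + 1) 0 :=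
      { τ₁ := 𝟙 _
        τ₂ := 𝟙 _
        τ₃ := S.f
        comm₁₂ := (Category.id_comp _).trans (Category.comp_id _).symm
        comm₂₃ := Category.id_comp _ }
    have h1 : Epi α.τ₁ := inferInstanceAs (Epi (𝟙 _))
    have h2 : IsIso α.τ₂ := inferInstanceAs (IsIso (𝟙 _))
    have h3 : Mono α.τ₃ := this
    exact (ShortComplex.exact_iff_of_epi_of_isIso_of_mono α).1 (exact_resolutionAugmentation Q)
  | n + 1 => exact Q.exact_succ n

/-- The projective resolution of `X₃` obtained by splicing a projective resolution of `X₁` with an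
exact sequence `0 → X₁ → X₂ → X₃ → 0`, where `X₂` is projective. -/
def spliceResolution (hS : S.ShortExact) [Projective S.X₂] (Q : ProjectiveResolution S.X₁) :
    ProjectiveResolution S.X₃ where
  complex := spliceComplex S Q
  projective
    | 0 => inferInstanceAs (Projective S.X₂)
    | n + 1 => inferInstanceAs (Projective (Q.complex.X n))
  π := (ChainComplex.toSingle₀Equiv _ _).symm ⟨S.g, by
    change (resolutionAugmentation Q ≫ S.f) ≫ S.g = 0
    rw [Category.assoc, S.zero, Limits.comp_zero]⟩
  quasiIso := ⟨fun n => by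
    cases n
    · rw [ChainComplex.quasiIsoAt₀_iff, ShortComplex.quasiIso_iff_of_zeros']
      · have := hS.epi_g
        let β : ShortComplex.mk (resolutionAugmentation Q ≫ S.f) S.g
            (by rw [Category.assoc, S.zero, Limits.comp_zero]) ⟶ S :=
          { τ₁ := resolutionAugmentation Q
            τ₂ := 𝟙 _
            τ₃ := 𝟙 _
            comm₁₂ := (Category.comp_id _).symm
            comm₂₃ := (Category.id_comp _).trans (Category.comp_id _).symm }
        have h1 : Epi β.τ₁ := inferInstanceAs (Epi (resolutionAugmentation Q))
        have h2 : IsIso β.τ₂ := inferInstanceAs (IsIso (𝟙 _))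
        have h3 : Mono β.τ₃ := inferInstanceAs (Mono (𝟙 _))
        refine (ShortComplex.exact_and_epi_g_iff_of_iso ?_).2
          ⟨(ShortComplex.exact_iff_of_epi_of_isIso_of_mono β).2 hS.exact, this⟩
        refine ShortComplex.isoMk (Iso.refl _) (Iso.refl _) (Iso.refl _) ?_ ?_
        · exact (Category.id_comp _).trans (Category.comp_id _).symm
        · refine (Category.id_comp _).trans (Eq.trans ?_ (Category.comp_id _).symm)
          exact (ChainComplex.toSingle₀Equiv_symm_apply_f_zero (V := C) (X := S.X₃)
            (C := spliceComplex S Q) S.g _).symm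
      all_goals rfl
    · rw [quasiIsoAt_iff_exactAt']
      · apply spliceComplex_exactAt_succ hS
      · apply ChainComplex.exactAt_succ_single_obj⟩

variable {D : Type*} [Category D] [Abelian D] (F : C ⥤ D) [F.Additive] [HasProjectiveResolutions C]

/-- `L_{n+2} F (X₃) ≅ L_{n+1} F (X₁)` if `X₂` is projective. -/
def leftDerivedShift (hS : S.ShortExact) [Projective S.X₂] (n : ℕ) :
    (F.leftDerived (n + 2)).obj S.X₃ ≅ (F.leftDerived (n + 1)).obj S.X₁ :=
  let Q := projectiveResolution S.X₁
  (spliceResolution hS Q).isoLeftDerivedObj F (n + 2) ≪≫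
    ShortComplex.homologyMapIso (HomologicalComplex.isoSc' _ (n + 3) (n + 2) (n + 1)
      (by simp) (by simp)) ≪≫
    ShortComplex.homologyMapIso (ShortComplex.isoMk (Iso.refl _) (Iso.refl _) (Iso.refl _)
      ((Category.id_comp _).trans (Category.comp_id _).symm)
      ((Category.id_comp _).trans (Category.comp_id _).symm) :
      ((F.mapHomologicalComplex _).obj (spliceComplex S Q)).sc' (n + 3) (n + 2) (n + 1) ≅
      ((F.mapHomologicalComplex _).obj Q.complex).sc' (n + 2) (n + 1) n) ≪≫
    (ShortComplex.homologyMapIso (HomologicalComplex.isoSc' _ (n + 2) (n + 1) n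
      (by simp) (by simp))).symm ≪≫
    (Q.isoLeftDerivedObj F (n + 1)).symm

/-- `L_1 F (X₃)` is the homology of `F(Q₁) → F(Q₀) → F(X₂)` if `X₂` is projective and `Q` is a
projective resolution of `X₁`. -/
def leftDerivedOne (hS : S.ShortExact) [Projective S.X₂] (Q : ProjectiveResolution S.X₁) :
    (F.leftDerived 1).obj S.X₃ ≅
      (ShortComplex.mk (F.map (Q.complex.d 1 0)) (F.map (resolutionAugmentation Q ≫ S.f)) (by
        rw [← F.map_comp, d_comp_resolutionAugmentation_comp, F.map_zero])).homology :=
  (spliceResolution hS Q).isoLeftDerivedObj F 1 ≪≫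
    ShortComplex.homologyMapIso (HomologicalComplex.isoSc' _ 2 1 0 (by simp) (by simp)) ≪≫
    ShortComplex.homologyMapIso (ShortComplex.isoMk (Iso.refl _) (Iso.refl _) (Iso.refl _)
      ((Category.id_comp _).trans (Category.comp_id _).symm)
      ((Category.id_comp _).trans (Category.comp_id _).symm))

end Splice

/-! ### Tor modules in low degrees -/

section TorModule

variable {S : Type v} {A : Type u} [Ring S] [Ring A] {X : Type u} [AddCommGroup X] [Module S X]
  [Module Aᵐᵒᵖ X] [SMulCommClass S Aᵐᵒᵖ X]

namespace BalancedTensor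

variable {K Y Z : Type u} [AddCommGroup K] [Module A K] [AddCommGroup Y] [Module A Y]
  [AddCommGroup Z] [Module A Z] {f : K →ₗ[A] Y} {g : Y →ₗ[A] Z}

theorem mapRight_tmul (x : X) (y : Y) : mapRight S X g (tmul A x y) = tmul A x (g y) := rfl

theorem mapRight_surjective (hg : Function.Surjective g) :
    Function.Surjective (mapRight (S := S) (X := X) g) := by
  intro z
  induction z using tmul_induction with
  | zero => exact ⟨0, map_zero _⟩
  | tmul x z =>
    obtain ⟨y, rfl⟩ := hg z
    exact ⟨tmul A x y, rfl⟩
  | add z w hz hw =>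
    obtain ⟨z, rfl⟩ := hz
    obtain ⟨w, rfl⟩ := hw
    exact ⟨z + w, map_add _ _ _⟩

/-- The induced map from the cokernel to `X ⊗ Z` is injective because `r` is an inverse to it on one
side; `r` is built from a set-theoretic section `s`, and `hwd` removes the dependence on that
choice. -/
theorem mapRight_exact (hfg : Function.Exact f g) (hg : Function.Surjective g) :
    Function.Exact (mapRight S X f) (mapRight S X g) := by
  let I := LinearMap.range (mapRight S X f)
  have hf : ∀ (x : X) (k : K), I.mkQ (tmul A x (f k)) = 0 := fun x k =>
    (Submodule.Quotient.mk_eq_zero I).2 ⟨tmul A x k, rfl⟩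
  have hwd : ∀ (x : X) (y y' : Y), g y = g y' → I.mkQ (tmul A x y) = I.mkQ (tmul A x y') := by
    intro x y y' h
    obtain ⟨k, hk⟩ := (hfg (y - y')).1 (by rw [map_sub, h, sub_self])
    have : y = f k + y' := by rw [hk, sub_add_cancel]
    rw [this, tmul_add, map_add, hf, zero_add]
  let s := Function.surjInv hg
  have hs : ∀ z, g (s z) = z := Function.surjInv_eq hg
  let r : BalancedTensor A X Z →+ (BalancedTensor A X Y ⧸ I) :=
    lift (AddMonoidHom.mk' (fun x => AddMonoidHom.mk' (fun z => I.mkQ (tmul A x (s z)))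
        fun z z' => by
          rw [← map_add, ← tmul_add]
          exact hwd _ _ _ (by rw [map_add, hs, hs, hs]))
        fun x x' => AddMonoidHom.ext fun z => by
          change I.mkQ (tmul A (x + x') (s z)) = I.mkQ (tmul A x (s z)) + I.mkQ (tmul A x' (s z))
          rw [add_tmul, map_add])
      fun a x z => by
        change I.mkQ (tmul A (op a • x) (s z)) = I.mkQ (tmul A x (s (a • z)))
        rw [op_smul_tmul]
        exact hwd _ _ _ (by rw [map_smul, hs, hs])
  have hr : ∀ t, r (mapRight S X g t) = I.mkQ t := fun t =>
    DFunLike.congr_fun (addHom_ext (f := r.comp (mapRight S X g).toAddMonoidHom)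
      (g := I.mkQ.toAddMonoidHom) fun x y => hwd x _ _ (hs _)) t
  intro t
  constructor
  · intro ht
    have := hr t
    rw [ht, map_zero] at this
    exact (Submodule.Quotient.mk_eq_zero I).1 this.symm
  · rintro ⟨t, rfl⟩
    have h0 : mapRight S X g ∘ₗ mapRight S X f = 0 := by
      refine BalancedTensor.linearMap_ext fun x k => ?_
      rw [LinearMap.comp_apply, mapRight_tmul, mapRight_tmul, hfg.apply_apply_eq_zero]
      have := tmul_add (A := A) x (0 : Z) 0
      rw [add_zero] at this
      exact left_eq_add.1 this
    exact LinearMap.congr_fun h0 t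

end BalancedTensor

end TorModule

section TorModule

variable (S : Type u) {A : Type u} [Ring S] [Ring A] (X : Type u) [AddCommGroup X] [Module S X]
  [Module Aᵐᵒᵖ X] [SMulCommClass S Aᵐᵒᵖ X]

instance tensorFunctor_preservesFiniteColimits :
    Limits.PreservesFiniteColimits (tensorFunctor S A X) := by
  rw [Functor.preservesFiniteColimits_iff_forall_exact_map_and_epi]
  intro T hT
  have hg := hT.moduleCat_surjective_g
  have hfg := (ShortComplex.ShortExact.moduleCat_exact_iff_function_exact _).1 hT.exact
  exact ⟨(ShortComplex.ShortExact.moduleCat_exact_iff_function_exact _).2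
    (BalancedTensor.mapRight_exact hfg hg),
    (ModuleCat.epi_iff_surjective _).2 (BalancedTensor.mapRight_surjective hg)⟩

variable {K Y Z : Type u} [AddCommGroup K] [Module A K] [AddCommGroup Y] [Module A Y]
  [AddCommGroup Z] [Module A Z] {f : K →ₗ[A] Y} {g : Y →ₗ[A] Z}

variable (Y) in
/-- `Tor_0^A(X, Y) ≅ X ⊗_A Y`. -/
def torZero : torModule S A X 0 (ModuleCat.of A Y) ≃ₗ[S] BalancedTensor A X Y :=
  ((tensorFunctor S A X).leftDerivedZeroIsoSelf.app (ModuleCat.of A Y)).toLinearEquiv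

/-- `Tor_{n+2}^A(X, Z) ≅ Tor_{n+1}^A(X, K)` for an exact sequence `0 → K → Y → Z → 0` with `Y`
projective. -/
def IsShortExact.torShift (h : IsShortExact f g) [Module.Projective A Y] (n : ℕ) :
    torModule S A X (n + 2) (ModuleCat.of A Z) ≃ₗ[S] torModule S A X (n + 1) (ModuleCat.of A K) :=
  have : Projective (ModuleCat.of A Y) := (IsProjective.iff_projective Y).1 inferInstance
  (leftDerivedShift (S := h.shortComplex) (tensorFunctor S A X) h.shortExact n).toLinearEquiv

/-- The homology of `X → Y → P`, if the second map is the composite of the cokernel of the first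
one and `u : K → P`, is the kernel of `u`. -/
theorem nonempty_homology_equiv_ker {T : ShortComplex (ModuleCat.{u} S)} {K : Type u}
    [AddCommGroup K] [Module S K] (p : T.X₂ →ₗ[S] K) (u : K →ₗ[S] T.X₃)
    (hp : Function.Surjective p) (hT : Function.Exact T.f.hom p) (hu : T.g.hom = u ∘ₗ p) :
    Nonempty (T.homology ≃ₗ[S] LinearMap.ker u) := by
  let q : LinearMap.ker T.g.hom →ₗ[S] LinearMap.ker u :=
    p.restrict fun x hx => by
      rw [LinearMap.mem_ker, hu] at hx
      exact hx
  have hq : Function.Surjective q := by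
    rintro ⟨k, hk⟩
    obtain ⟨y, rfl⟩ := hp k
    exact ⟨⟨y, by rw [LinearMap.mem_ker, hu]; exact hk⟩, rfl⟩
  have hker : LinearMap.range T.moduleCatToCycles = LinearMap.ker q := by
    ext ⟨y, hy⟩
    rw [LinearMap.mem_ker]
    constructor
    · rintro ⟨x, hx⟩
      refine Subtype.ext ?_
      rw [← hx]
      exact hT.apply_apply_eq_zero x
    · intro h
      obtain ⟨x, hx⟩ := (hT y).1 (congrArg Subtype.val h)
      exact ⟨x, Subtype.ext hx⟩
  exact ⟨T.moduleCatHomologyIso.toLinearEquiv.trans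
    ((Submodule.quotEquivOfEq _ _ hker).trans (LinearMap.quotKerEquivOfSurjective q hq))⟩

/-- `Tor_1^A(X, Z)` is the kernel of `X ⊗_A K → X ⊗_A Y`, for an exact sequence
`0 → K → Y → Z → 0` with `Y` projective. -/
theorem IsShortExact.nonempty_torOne (h : IsShortExact f g) [Module.Projective A Y] :
    Nonempty (torModule S A X 1 (ModuleCat.of A Z) ≃ₗ[S]
      LinearMap.ker (BalancedTensor.mapRight S X f)) := by
  have : Projective (ModuleCat.of A Y) := (IsProjective.iff_projective Y).1 inferInstance
  let Q := projectiveResolution (ModuleCat.of A K)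
  have hsurj : Function.Surjective (resolutionAugmentation Q).hom :=
    (ModuleCat.epi_iff_surjective _).1 inferInstance
  have hex : Function.Exact (Q.complex.d 1 0).hom (resolutionAugmentation Q).hom :=
    (ShortComplex.ShortExact.moduleCat_exact_iff_function_exact _).1
      (exact_resolutionAugmentation Q)
  obtain ⟨e⟩ := nonempty_homology_equiv_ker S
    (T := ShortComplex.mk ((tensorFunctor S A X).map (Q.complex.d 1 0))
      ((tensorFunctor S A X).map (resolutionAugmentation Q ≫ ModuleCat.ofHom f)) (by
        rw [← Functor.map_comp, d_comp_resolutionAugmentation_comp, Functor.map_zero]))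
    (BalancedTensor.mapRight S X (resolutionAugmentation Q).hom)
    (BalancedTensor.mapRight S X f)
    (BalancedTensor.mapRight_surjective hsurj) (BalancedTensor.mapRight_exact hex hsurj)
    (BalancedTensor.linearMap_ext fun _ _ => rfl)
  exact ⟨(leftDerivedOne (S := h.shortComplex) (tensorFunctor S A X)
    h.shortExact Q).toLinearEquiv.trans e⟩

end TorModule

/-! ### Tor modules and duality -/

namespace InducesDuality

variable {Λ W : Type u} [Ring Λ] [AddCommGroup W] [Module Λ W] [Module Λᵐᵒᵖ W]
  [SMulCommClass Λ Λᵐᵒᵖ W] [SMulCommClass Λᵐᵒᵖ Λ W]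

theorem tensorToDual_mapRight {M P : Type u} [AddCommGroup M] [Module Λ M] [AddCommGroup P]
    [Module Λ P] (f : M →ₗ[Λ] P) (z : BalancedTensor Λ W M) :
    tensorToDual Λ W P (BalancedTensor.mapRight Λ W f z) =
      LinearMap.lcomp Λ W (LinearMap.lcomp Λᵐᵒᵖ Λ f) (tensorToDual Λ W M z) :=
  LinearMap.congr_fun (BalancedTensor.linearMap_ext
    (f := tensorToDual Λ W P ∘ₗ BalancedTensor.mapRight Λ W f)
    (g := LinearMap.lcomp Λ W (LinearMap.lcomp Λᵐᵒᵖ Λ f) ∘ₗ tensorToDual Λ W M)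
    fun _ _ => rfl) z

/-- The dual of an isomorphism. -/
def dualCongr (W : Type u) [AddCommGroup W] [Module Λ W] [Module Λᵐᵒᵖ W]
    [SMulCommClass Λᵐᵒᵖ Λ W] {M N : Type u} [AddCommGroup M] [Module Λᵐᵒᵖ M]
    [AddCommGroup N] [Module Λᵐᵒᵖ N] (e : M ≃ₗ[Λᵐᵒᵖ] N) :
    (M →ₗ[Λᵐᵒᵖ] W) ≃ₗ[Λ] (N →ₗ[Λᵐᵒᵖ] W) :=
  LinearEquiv.congrLeft W Λ e

/-- `Tor_1` is the kernel of `W ⊗ K → W ⊗ P`. By `tensorToDual` this is the kernel of the dual of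
`Hom(P, Λ) → Hom(K, Λ)`, hence the dual of its cokernel `Ext^1(M, Λ)`. -/
theorem nonempty_torOne_equiv [IsNoetherianRing Λᵐᵒᵖ] (h : InducesDuality Λ Λᵐᵒᵖ W)
    (h' : InducesDuality Λᵐᵒᵖ Λ W) {K P M : Type u} [AddCommGroup K] [Module Λ K]
    [AddCommGroup P] [Module Λ P] [AddCommGroup M] [Module Λ M] [Module.Finite Λ K]
    [Module.Finite Λ P] [Module.Projective Λ P] {f : K →ₗ[Λ] P} {g : P →ₗ[Λ] M}
    (hfg : IsShortExact f g) :
    Nonempty (torModule Λ Λ W 1 (ModuleCat.of Λ M) ≃ₗ[Λ]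
      (extToBimodule Λ Λᵐᵒᵖ Λ (ModuleCat.of Λ M) 1 →ₗ[Λᵐᵒᵖ] W)) := by
  obtain ⟨e⟩ := hfg.nonempty_torOne Λ W
  let eK := LinearEquiv.ofBijective _ (tensorToDual_bijective (M := K) h h')
  let ρ : (P →ₗ[Λ] Λ) →ₗ[Λᵐᵒᵖ] (K →ₗ[Λ] Λ) := LinearMap.lcomp Λᵐᵒᵖ Λ f
  let e1 : LinearMap.ker (BalancedTensor.mapRight Λ W f) ≃ₗ[Λ]
      LinearMap.ker (LinearMap.lcomp Λ W ρ) :=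
    eK.ofSubmodules _ _ (by
      ext y
      obtain ⟨z, rfl⟩ := eK.surjective y
      rw [Submodule.mem_map_equiv, eK.symm_apply_apply, LinearMap.mem_ker, LinearMap.mem_ker,
        ← map_eq_zero_iff _ (tensorToDual_bijective (M := P) h h').1, tensorToDual_mapRight]
      rfl)
  have hq : LinearMap.range (LinearMap.lcomp Λ W (LinearMap.range ρ).mkQ) =
      LinearMap.ker (LinearMap.lcomp Λ W ρ) :=
    (LinearMap.exact_iff.1 (exact_lcomp (LinearMap.exact_iff.2 (by simp))
      (LinearMap.range ρ).mkQ_surjective)).symm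
  let e2 : (((K →ₗ[Λ] Λ) ⧸ LinearMap.range ρ) →ₗ[Λᵐᵒᵖ] W) ≃ₗ[Λ]
      LinearMap.ker (LinearMap.lcomp Λ W ρ) :=
    (LinearEquiv.ofInjective _ (injective_lcomp (LinearMap.range ρ).mkQ_surjective)).trans
      (LinearEquiv.ofEq _ _ hq)
  exact ⟨e.trans (e1.trans (e2.symm.trans (dualCongr W (hfg.extToOne Λᵐᵒᵖ Λ))))⟩

/-- `Tor_i^Λ(W, M) ≅ Hom_{Λᵒᵖ}(Ext^i_Λ(M, Λ), W)` for finitely generated `M`. -/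
theorem nonempty_tor_equiv [IsNoetherianRing Λ] [IsNoetherianRing Λᵐᵒᵖ]
    (h : InducesDuality Λ Λᵐᵒᵖ W) (h' : InducesDuality Λᵐᵒᵖ Λ W) (i : ℕ) :
    ∀ (M : Type u) [AddCommGroup M] [Module Λ M] [Module.Finite Λ M],
      Nonempty (torModule Λ Λ W i (ModuleCat.of Λ M) ≃ₗ[Λ]
        (extToBimodule Λ Λᵐᵒᵖ Λ (ModuleCat.of Λ M) i →ₗ[Λᵐᵒᵖ] W)) := by
  induction i with
  | zero =>
    intro M _ _ _
    exact ⟨(torZero Λ W M).trans ((LinearEquiv.ofBijective _ (tensorToDual_bijective h h')).trans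
      (dualCongr W (homEquivExtTo Λ Λᵐᵒᵖ Λ M)))⟩
  | succ i ih =>
    intro M _ _ _
    obtain ⟨n, g, hg⟩ := Module.Finite.exists_fin' Λ M
    have hfg := IsShortExact.of_surjective hg
    rcases i with - | i
    · exact nonempty_torOne_equiv h h' hfg
    · obtain ⟨e⟩ := ih (LinearMap.ker g)
      exact ⟨(hfg.torShift Λ W i).trans (e.trans (dualCongr W (hfg.extToShift Λᵐᵒᵖ Λ i)))⟩

end InducesDuality

/-! ### Comparison of the strong grade and cograde conditions -/

section StrongGrade

variable {A A' : Type u} [Ring A] [Ring A'] {B : Type u} [AddCommGroup B]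
  [Module A B] [Module A' B] {b : B}

/-- The grade is defined by Ext into the ring itself; this exchanges the ring for `B`, so that `Λ`
can serve as the regular module on both sides. -/
theorem strongGradeGE_iff (h : IsRegularBimodule A A' b) {M : ModuleCat.{u} A} {m : ℕ} :
    StrongGradeGE M m ↔ ∀ X : Submodule A M, ∀ j < m, Subsingleton (ExtGroup A X B j) := by
  refine forall_congr' fun X => natCast_le_iInf_nontrivial_iff.trans ?_
  refine forall₂_congr fun j _ => ⟨subsingleton_ext_congr_right h.leftEquiv.symm,
    subsingleton_ext_congr_right h.leftEquiv⟩

theorem StrongGradeGE.of_equiv {M M' : ModuleCat.{u} A} {m : ℕ} (hM : StrongGradeGE M m)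
    (e : M' ≃ₗ[A] M) : StrongGradeGE M' m := fun X =>
  natCast_le_iInf_nontrivial_iff.2 fun j hj => subsingleton_ext_congr_left (e.submoduleMap X)
    (natCast_le_iInf_nontrivial_iff.1 (hM (X.map e.toLinearMap)) j hj)

theorem strongGradeCondition_iff [SMulCommClass A' A B] (h : IsRegularBimodule A A' b) {n : ℕ} :
    (∀ (N : ModuleCat.{u} A') [Module.Finite A' N] (i : ℕ), 1 ≤ i → i ≤ n →
      StrongGradeGE (extToBimodule A' A B N i) i) ↔ StrongGradeCondition A A' B n := by
  constructor
  · intro H N _ _ _ i h1 hi Y _ _ ι hι j hj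
    exact subsingleton_ext_congr_left (LinearEquiv.ofInjective ι hι)
      ((strongGradeGE_iff h).1 (H (ModuleCat.of A' N) i h1 hi) _ j hj)
  · intro H N _ i h1 hi
    exact (strongGradeGE_iff h).2 fun X j hj =>
      H N i h1 hi X X.subtype X.injective_subtype j hj

theorem IsRegularBimodule.finite_ext [SMulCommClass A A' B] [IsNoetherianRing A]
    [IsNoetherianRing A'] (h : IsRegularBimodule A A' b) (i : ℕ) :
    ∀ (M : Type u) [AddCommGroup M] [Module A M] [Module.Finite A M],
      Module.Finite A' (extToBimodule A A' B (ModuleCat.of A M) i) := by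
  induction i with
  | zero =>
    intro M _ _ _
    have := finite_dual h M
    exact Module.Finite.equiv (homEquivExtTo A A' B M)
  | succ i ih =>
    intro M _ _ _
    obtain ⟨n, g, hg⟩ := Module.Finite.exists_fin' A M
    have hfg := IsShortExact.of_surjective hg
    rcases i with - | i
    · have := finite_dual h (LinearMap.ker g)
      exact Module.Finite.equiv (hfg.extToOne A' B)
    · have := ih (LinearMap.ker g)
      exact Module.Finite.equiv (hfg.extToShift A' B i)

end StrongGrade

namespace InducesDuality

variable {Λ W : Type u} [Ring Λ] [AddCommGroup W] [Module Λ W] [Module Λᵐᵒᵖ W]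
  [SMulCommClass Λ Λᵐᵒᵖ W] [SMulCommClass Λᵐᵒᵖ Λ W] [IsNoetherianRing Λᵐᵒᵖ]

/-- `Ext^i_Λ(W, M) ≅ Ext^i_{Λᵒᵖ}(Hom_Λ(M, W), Λ)` for finitely generated `M`. -/
theorem nonempty_extFrom_equiv_dual (h : InducesDuality Λ Λᵐᵒᵖ W) (h' : InducesDuality Λᵐᵒᵖ Λ W)
    (M : Type u) [AddCommGroup M] [Module Λ M] [Module.Finite Λ M] (i : ℕ) :
    Nonempty (extFromBimodule Λ Λ W (ModuleCat.of Λ M) i ≃ₗ[Λ]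
      extToBimodule Λᵐᵒᵖ Λ Λ (ModuleCat.of Λᵐᵒᵖ (M →ₗ[Λ] W)) i) := by
  have := h.finite M
  obtain ⟨e⟩ := h.nonempty_extFrom_equiv h' i (M →ₗ[Λ] W)
  exact ⟨(extFromCongr Λ W (LinearEquiv.ofBijective _ (h.reflexive M)) i).trans e⟩

variable [IsNoetherianRing Λ]

/-- `Tor_i(W, M)` is the dual of `Ext^i(M, Λ)`, so its quotients are the duals of the submodules `X`
of that Ext module, and `Ext^j` from `W` into the dual of `X` is `Ext^j(X, Λ)`. -/
theorem strongExtCogradeGE_tor_iff (h : InducesDuality Λ Λᵐᵒᵖ W) (h' : InducesDuality Λᵐᵒᵖ Λ W)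
    (M : ModuleCat.{u} Λ) [Module.Finite Λ M] (i m : ℕ) :
    StrongExtCogradeGE Λ W (torModule Λ Λ W i M) m ↔
      StrongGradeGE (extToBimodule Λ Λᵐᵒᵖ Λ M i) m := by
  obtain ⟨e⟩ := h.nonempty_tor_equiv h' i M
  have : Module.Finite Λᵐᵒᵖ (extToBimodule Λ Λᵐᵒᵖ Λ M i) :=
    (isRegularBimodule_one Λ).finite_ext i M
  rw [strongGradeGE_iff (isRegularBimodule_one Λ).symm]
  constructor
  · intro H X j hj
    obtain ⟨K, ⟨eK⟩⟩ := h'.exists_quotient_equiv X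
    rw [← h.subsingleton_ext_dual_iff h' j]
    exact subsingleton_ext_congr_right
      (eK.symm.trans (Submodule.Quotient.equiv _ _ e.symm rfl))
      (natCast_le_iInf_nontrivial_iff.1 (H (K.map e.symm.toLinearMap)) j hj)
  · intro H K
    refine natCast_le_iInf_nontrivial_iff.2 fun j hj => ?_
    obtain ⟨X, ⟨eX⟩⟩ := h'.exists_submodule_equiv h (K.map e.toLinearMap)
    exact subsingleton_ext_congr_right ((Submodule.Quotient.equiv K _ e rfl).trans eX)
      ((h.subsingleton_ext_dual_iff h' j).2 (H X j hj))

/-- `Tor_j(W, Y)` is the dual of `Ext^j(Y, Λ)`, and a module with zero dual is zero. -/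
theorem strongTorCogradeGE_iff (h : InducesDuality Λ Λᵐᵒᵖ W) (h' : InducesDuality Λᵐᵒᵖ Λ W)
    (M : ModuleCat.{u} Λ) [Module.Finite Λ M] (m : ℕ) :
    StrongTorCogradeGE Λ Λ W M m ↔ StrongGradeGE M m := by
  rw [strongGradeGE_iff (isRegularBimodule_one Λ)]
  refine forall_congr' fun Y => natCast_le_iInf_nontrivial_iff.trans (forall₂_congr fun j _ => ?_)
  obtain ⟨e⟩ := h.nonempty_tor_equiv h' j Y
  exact e.toEquiv.subsingleton_congr.trans h'.subsingleton_iff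

theorem strongTorCogradeGE_ext_iff (h : InducesDuality Λ Λᵐᵒᵖ W) (h' : InducesDuality Λᵐᵒᵖ Λ W)
    (M : ModuleCat.{u} Λ) [Module.Finite Λ M] (i m : ℕ) :
    StrongTorCogradeGE Λ Λ W (extFromBimodule Λ Λ W M i) m ↔
      StrongGradeGE (extToBimodule Λᵐᵒᵖ Λ Λ (ModuleCat.of Λᵐᵒᵖ (M →ₗ[Λ] W)) i) m := by
  obtain ⟨e⟩ := h.nonempty_extFrom_equiv_dual h' M i
  have := h.finite M
  have := (isRegularBimodule_one Λ).symm.finite_ext i (M →ₗ[Λ] W)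
  have : Module.Finite Λ (extFromBimodule Λ Λ W M i) := Module.Finite.equiv e.symm
  rw [h.strongTorCogradeGE_iff h']
  exact ⟨fun H => H.of_equiv e.symm, fun H => H.of_equiv e⟩

/-- As `M` runs over the finitely generated left modules, its dual runs over all finitely generated
right modules up to isomorphism. -/
theorem forall_strongTorCogradeGE_iff (h : InducesDuality Λ Λᵐᵒᵖ W)
    (h' : InducesDuality Λᵐᵒᵖ Λ W) (n : ℕ) :
    (∀ (M : ModuleCat.{u} Λ) [Module.Finite Λ M] (i : ℕ), 1 ≤ i → i ≤ n →
      StrongTorCogradeGE Λ Λ W (extFromBimodule Λ Λ W M i) i) ↔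
    ∀ (N : ModuleCat.{u} Λᵐᵒᵖ) [Module.Finite Λᵐᵒᵖ N] (i : ℕ), 1 ≤ i → i ≤ n →
      StrongGradeGE (extToBimodule Λᵐᵒᵖ Λ Λ N i) i := by
  constructor
  · intro H N _ i h1 hi
    have := h'.finite N
    have hM := (h.strongTorCogradeGE_ext_iff h' (ModuleCat.of Λ (N →ₗ[Λᵐᵒᵖ] W)) i i).1
      (H (ModuleCat.of Λ (N →ₗ[Λᵐᵒᵖ] W)) i h1 hi)
    exact hM.of_equiv (extToCongr Λ Λ (LinearEquiv.ofBijective _ (h'.reflexive N)) i)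
  · intro H M _ i h1 hi
    have := h.finite M
    exact (h.strongTorCogradeGE_ext_iff h' M i i).2
      (H (ModuleCat.of Λᵐᵒᵖ (M →ₗ[Λ] W)) i h1 hi)

end InducesDuality

end

/-! ### The equivalence of the six conditions -/

theorem corollary6p10 (R Λ : Type u) [CommRing R] [IsArtinianRing R] [Ring Λ] [Algebra R Λ]
    [Module.Finite R Λ] (n : ℕ) (hn : 1 ≤ n) :
    List.TFAE [
      IsAuslanderGorenstein Λ n,
      IsAuslanderGorenstein Λᵐᵒᵖ n,
      ∀ (M : ModuleCat.{u} Λ) [Module.Finite Λ M] (i : ℕ), 1 ≤ i → i ≤ n →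
        StrongGradeGE (extToBimodule Λ Λᵐᵒᵖ Λ M i) i,
      ∀ (N : ModuleCat.{u} Λᵐᵒᵖ) [Module.Finite Λᵐᵒᵖ N] (i : ℕ), 1 ≤ i → i ≤ n →
        StrongGradeGE (extToBimodule Λᵐᵒᵖ Λ Λ N i) i,
      ∀ (M : ModuleCat.{u} Λ) [Module.Finite Λ M] (i : ℕ), 1 ≤ i → i ≤ n →
        StrongExtCogradeGE Λ (MatlisDual R Λ) (torModule Λ Λ (MatlisDual R Λ) i M) i,
      ∀ (M : ModuleCat.{u} Λ) [Module.Finite Λ M] (i : ℕ), 1 ≤ i → i ≤ n →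
        StrongTorCogradeGE Λ Λ (MatlisDual R Λ)
          (extFromBimodule Λ Λ (MatlisDual R Λ) M i) i] := by
  have : Module.Finite R Λᵐᵒᵖ := Module.Finite.equiv (opLinearEquiv R)
  have : IsNoetherianRing Λ := IsNoetherianRing.of_finite R Λ
  have : IsNoetherianRing Λᵐᵒᵖ := IsNoetherianRing.of_finite R Λᵐᵒᵖ
  have hreg := isRegularBimodule_one Λ
  have h := MatlisDual.inducesDuality R Λ
  have h' := MatlisDual.inducesDuality_op R Λ
  -- Flatness of left modules is tested by Ext of right modules, hence the change of side.
  tfae_have 1 ↔ 4 := (isAuslanderGorenstein_iff hreg (ρ := RingEquiv.refl _)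
    (fun a => (one_mul (unop a)).trans (mul_one (unop a)).symm) n).trans
    (strongGradeCondition_iff hreg).symm
  -- With `Λᵐᵒᵖ` as base ring, the opposite side is `Λ` itself, identified with the double opposite
  -- only through `ρ`.
  tfae_have 2 ↔ 3 := (isAuslanderGorenstein_iff hreg.symm (ρ := RingEquiv.opOp Λ)
    (fun a => (mul_one a).trans (one_mul a).symm) n).trans
    (strongGradeCondition_iff hreg.symm).symm
  tfae_have 3 ↔ 4 := ((strongGradeCondition_iff hreg.symm).trans
    ⟨StrongGradeCondition.symm hreg.symm, StrongGradeCondition.symm hreg⟩).trans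
    (strongGradeCondition_iff hreg).symm
  tfae_have 5 ↔ 3 := forall₂_congr fun M _ => forall₃_congr fun i _ _ =>
    h.strongExtCogradeGE_tor_iff h' M i i
  tfae_have 6 ↔ 4 := h.forall_strongTorCogradeGE_iff h' n
  tfae_finish
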